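/- Let $N,P,N_r,J\ge 1$ and $M=2N+1$. Index $\mathbb C^{MPN_r}$ by triples $i=(m,p,n)$, $1\le m\le N_r$, $1\le p\le P$, $-N\le n\le N$, with canonical vectors $\mathbf e_i$, and for $\mathbf r=(\tau,\nu,\beta)\in[0,1]^3$ let $\mathbf w(\mathbf r)\in\mathbb C^{MPN_r}$ have the entries $e^{\mathrm j2\pi(n\tau+p\nu+m\beta)}$. Let $\mathbf T\in\mathbb C^{M\times J}$ and $\mathbf D=\operatorname{blockdiag}(\mathbf D_1,\dots,\mathbf D_P)\in\mathbb C^{MP\times PJ}$ with $\mathbf D_p\in\mathbb C^{M\times J}$. Let $\mathbf t_n\in\mathbb C^{J}$ and $\mathbf d_{(n,p)}\in\mathbb C^{PJ}$ be the vectors for which $\mathbf t_n^H$ and $\mathbf d_{(n,p)}^H$ are the rows of $\mathbf T$ and $\mathbf D$. A probability distribution on vectors is called isotropic if $\mathbb E[\mathbf x\mathbf x^H]=\mathbf I$ and incoherent with parameter $\mu$ if $\max_i|x_i|^2\le\mu$ almost surely; a basis is called isotropic (incoherent) if the uniform distribution on its vectors $\mathbf t_n$ (respectively $\mathbf d_{(n,p)}$)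 is. Assume that $\mathbf T$ and $\mathbf D$ are incoherent with some parameter $\mu$, that $\mathbf T$ is isotropic, and that $\mathbf D$ is isotropic, or else that each block $\mathbf D_p$ is. For $\mathbf q\in\mathbb C^{MPN_r}$ let $\mathcal B_r^*(\mathbf q)=\sum_i q_i\,\mathbf t_n\mathbf e_i^H\in\mathbb C^{J\times MPN_r}$ and $\mathcal B_c^*(\mathbf q)=\sum_i q_i\,\mathbf d_{(n,p)}\mathbf e_i^H\in\mathbb C^{PJ\times MPN_r}$. Let $\varepsilon_e\ge0$. For gain errors $\mathbf g\in\mathbb C^{N_r}$ and phase errors $\boldsymbol\phi\in\mathbb R^{N_r}$ put $e_m=(1+g_m)e^{\mathrm j\phi_m}-1$ and $\widetilde{\mathbf E}=\operatorname{diag}(\mathbf e)\otimes\mathbf I_{MP}$. The error-weighted dual atomic norm of a matrix $\mathbf Z$ with $MPN_r$ columns is $$\|\mathbf Z\|^*_{\widetilde{\mathcal A}}=\sup\left\{\left|\left\langle \mathbf u\,\mathbf w(\mathbf r)^H(\widetilde{\mathbf E}+\mathbf I),\mathbf Z\right\rangle\right| \;:\; \|\mathbf u\|_2=1,\ \mathbf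 r\in[0,1]^3,\ \|\widetilde{\mathbf E}\|\le\varepsilon_e\right\},$$ where $\langle\mathbf X,\mathbf Z\rangle=\operatorname{Tr}(\mathbf Z^H\mathbf X)$ and $\|\widetilde{\mathbf E}\|$ is the spectral norm. Let $\boldsymbol\omega\in\mathbb R^{MPN_r}$ have independent $\mathcal N(0,\sigma^2)$ entries, $\sigma\ge0$. Then $$\mathbb E\,\|\mathcal B_r^*(\boldsymbol\omega)\|^*_{\widetilde{\mathcal A}}\le\sigma\left(\varepsilon_e MPN_r+\|\mathbf T\|_F\sqrt{MPJN_r\log(MPN_r)}\right)$$ and $$\mathbb E\,\|\mathcal B_c^*(\boldsymbol\omega)\|^*_{\widetilde{\mathcal A}}\le\sigma\left(\varepsilon_e MPN_r+\|\mathbf D\|_F\sqrt{MP^2JN_r\log(MPN_r)}\right).$$ -/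

import Mathlib

open MeasureTheory ProbabilityTheory
open scoped NNReal ENNReal Matrix Kronecker ComplexConjugate

noncomputable section

namespace JRC

/-- The index set of the measurements: receive antenna, pulse (or message), frequency sample.
There are `M = 2 N + 1` frequency samples, the sample `k` standing for the frequency
`n = k - N ∈ {-N, …, N}`. -/
abbrev Idx (N P Nr : ℕ) : Type := Fin Nr × Fin P × Fin (2 * N + 1)

/-! ### Signal model -/

/-- Delay vector `a(τ)`, with the entries `exp(2πi τ n)`, `n = -N, …, N`. -/
def delayVec (N : ℕ) (τ : ℝ) : Fin (2 * N + 1) → ℂ := fun k =>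
  Complex.exp (2 * Real.pi * Complex.I * (τ * ((k : ℕ) - (N : ℕ) : ℝ)))

/-- Doppler and direction-of-arrival vector, with the entries `exp(2πi θ k)`, `k = 1, …, K`. -/
def harmonicVec (K : ℕ) (θ : ℝ) : Fin K → ℂ := fun k =>
  Complex.exp (2 * Real.pi * Complex.I * (θ * ((k : ℕ) + 1 : ℝ)))

/-- `w(r) = a(β) ⊗ a(ν) ⊗ a(τ)` for `r = (τ, ν, β)`. -/
def w (N P Nr : ℕ) (r : ℝ × ℝ × ℝ) : Idx N P Nr → ℂ := fun i =>
  harmonicVec Nr r.2.2 i.1 * (harmonicVec P r.2.1 i.2.1 * delayVec N r.1 i.2.2)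

/-- The sensing vectors of a transformation basis `A` (`t_n` for `T`, `d_v` for `D`): the column
vectors for which the signal `s = A u` has the entries `s_n = t_nᴴ u`. -/
def sensingVec {κ ι : Type*} (A : Matrix κ ι ℂ) (n : κ) : ι → ℂ := star (A n)

/-- The sensing matrix `e_i bᴴ`, where `e_i` is the `i`-th canonical vector. -/
def sensingMatrix {N P Nr : ℕ} {ι : Type*} (i : Idx N P Nr) (b : ι → ℂ) :
    Matrix (Idx N P Nr) ι ℂ :=
  Matrix.vecMulVec (Pi.single i 1) (star b)

/-- The linear operator `[B X]_i = Tr(G_i X)`, where `G_i = e_i b_iᴴ`. -/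
def sensingOp {N P Nr : ℕ} {ι : Type*} [Fintype ι] (b : Idx N P Nr → ι → ℂ)
    (X : Matrix ι (Idx N P Nr) ℂ) : Idx N P Nr → ℂ := fun i =>
  (sensingMatrix i (b i) * X).trace

/-- The adjoint operator `B⋆ q = ∑_i q_i G_iᴴ`. -/
def sensingAdj {N P Nr : ℕ} {ι : Type*} (b : Idx N P Nr → ι → ℂ)
    (q : Idx N P Nr → ℂ) : Matrix ι (Idx N P Nr) ℂ :=
  ∑ i, q i • (sensingMatrix i (b i))ᴴ

/-- The Frobenius inner product `⟨X, Z⟩ = Tr(Zᴴ X)`. -/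
def frobInner {ι κ : Type*} [Fintype ι] [Fintype κ] (X Z : Matrix ι κ ℂ) : ℂ := (Zᴴ * X).trace

/-- `sensingAdj` is the adjoint of `sensingOp`. -/
theorem sensingAdj_adjoint {N P Nr : ℕ} {ι : Type*} [Fintype ι] (b : Idx N P Nr → ι → ℂ)
    (X : Matrix ι (Idx N P Nr) ℂ) (q : Idx N P Nr → ℂ) :
    frobInner X (sensingAdj b q) = ∑ i, conj (q i) * sensingOp b X i := by
  simp [frobInner, sensingAdj, sensingOp, Matrix.conjTranspose_sum, Matrix.sum_mul,
    Matrix.trace_sum, Matrix.conjTranspose_smul, Matrix.trace_smul]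

/-- The Frobenius norm. -/
def frobNorm {ι κ : Type*} [Fintype ι] [Fintype κ] (A : Matrix ι κ ℂ) : ℝ :=
  Real.sqrt (∑ i, ∑ j, ‖A i j‖ ^ 2)

/-- The vectors `b_i = t_n` of the radar operator, `i = (antenna, pulse, n)`. -/
def radarVec {N J : ℕ} (P Nr : ℕ) (T : Matrix (Fin (2 * N + 1)) (Fin J) ℂ) :
    Idx N P Nr → Fin J → ℂ := fun i => sensingVec T i.2.2

/-- The adjoint `B_r⋆` of the radar operator. -/
def radarAdj {N J : ℕ} (P Nr : ℕ) (T : Matrix (Fin (2 * N + 1)) (Fin J) ℂ) :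
    (Idx N P Nr → ℂ) → Matrix (Fin J) (Idx N P Nr) ℂ := sensingAdj (radarVec P Nr T)

/-- The block diagonal communications basis `D = blockdiag(D_1, …, D_P)`. -/
def commBasis {N P J : ℕ} (D : Fin P → Matrix (Fin (2 * N + 1)) (Fin J) ℂ) :
    Matrix (Fin (2 * N + 1) × Fin P) (Fin J × Fin P) ℂ := Matrix.blockDiagonal D

/-- The vectors `b_i = d_v` of the communications operator, `i = (antenna, p, n)`,
`v = (n, p)`. -/
def commVec {N P J : ℕ} (Nr : ℕ) (D : Fin P → Matrix (Fin (2 * N + 1)) (Fin J) ℂ) :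
    Idx N P Nr → Fin J × Fin P → ℂ := fun i => sensingVec (commBasis D) (i.2.2, i.2.1)

/-- The adjoint `B_c⋆` of the communications operator. -/
def commAdj {N P J : ℕ} (Nr : ℕ) (D : Fin P → Matrix (Fin (2 * N + 1)) (Fin J) ℂ) :
    (Idx N P Nr → ℂ) → Matrix (Fin J × Fin P) (Idx N P Nr) ℂ := sensingAdj (commVec Nr D)

/-! ### Steering-vector errors and the error-weighted dual atomic norm -/

/-- The error vector `e_m = (1 + g_m) exp(i φ_m) - 1` of the gain errors `g` and the phase
errors `φ`. -/
def steeringError {Nr : ℕ} (g : Fin Nr → ℂ) (φ : Fin Nr → ℝ) : Fin Nr → ℂ := fun m =>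
  (1 + g m) * Complex.exp (Complex.I * φ m) - 1

/-- The matrix `diag(e) ⊗ I_{MP}`. -/
def errorMatrix (N P : ℕ) {Nr : ℕ} (e : Fin Nr → ℂ) :
    Matrix (Idx N P Nr) (Idx N P Nr) ℂ :=
  Matrix.diagonal e ⊗ₖ (1 : Matrix (Fin P × Fin (2 * N + 1)) (Fin P × Fin (2 * N + 1)) ℂ)

/-- The spectral norm: the operator norm with respect to the Euclidean norm. -/
def opNorm {ι : Type*} [Fintype ι] [DecidableEq ι] (A : Matrix ι ι ℂ) : ℝ :=
  ‖Matrix.toEuclideanCLM (n := ι) (𝕜 := ℂ) A‖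

/-- The error-weighted atoms `u w(r)ᴴ (E + I)`, with `‖u‖₂ = 1`, `r ∈ [0,1]³` and `E` the error
matrix of some gain and phase errors, of spectral norm at most `ε`. -/
def weightedAtoms (N P Nr : ℕ) (ι : Type*) [Fintype ι] (ε : ℝ) :
    Set (Matrix ι (Idx N P Nr) ℂ) :=
  {A | ∃ u : ι → ℂ, (∑ j, ‖u j‖ ^ 2 = 1) ∧
    ∃ r : ℝ × ℝ × ℝ, (r.1 ∈ Set.Icc 0 1 ∧ r.2.1 ∈ Set.Icc 0 1 ∧ r.2.2 ∈ Set.Icc 0 1) ∧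
    ∃ (g : Fin Nr → ℂ) (φ : Fin Nr → ℝ), opNorm (errorMatrix N P (steeringError g φ)) ≤ ε ∧
      A = Matrix.vecMulVec u (star (w N P Nr r)) * (errorMatrix N P (steeringError g φ) + 1)}

/-- The error-weighted dual atomic norm of `Z`: the supremum of `|⟨A, Z⟩|` over the
error-weighted atoms `A`, as an extended nonnegative real. -/
def dualAtomicNorm {N P Nr : ℕ} {ι : Type*} [Fintype ι] (ε : ℝ)
    (Z : Matrix ι (Idx N P Nr) ℂ) : ℝ≥0∞ :=
  ⨆ A ∈ weightedAtoms N P Nr ι ε, ‖frobInner A Z‖ₑ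

/-! ### Isotropy, incoherence, noise -/

/-- A distribution `F` on vectors is isotropic if `E[x xᴴ] = I` for `x ∼ F`. -/
def IsIsotropic {ι : Type*} [DecidableEq ι] (F : Measure (ι → ℂ)) : Prop :=
  ∀ i j, Integrable (fun x => x i * conj (x j)) F ∧
    ∫ x, x i * conj (x j) ∂F = if i = j then 1 else 0

/-- A distribution `F` on vectors is incoherent with the coherence parameter `μ` if
`max_i |x_i|² ≤ μ` almost surely for `x ∼ F`. -/
def IsIncoherent {ι : Type*} (μ : ℝ) (F : Measure (ι → ℂ)) : Prop :=
  ∀ᵐ x ∂F, ∀ i, ‖x i‖ ^ 2 ≤ μ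

/-- The distribution of the sensing vectors of a basis `A`: the law of a sensing vector that is
picked uniformly at random. -/
def sensingLaw {κ ι : Type*} [Fintype κ] (A : Matrix κ ι ℂ) : Measure (ι → ℂ) :=
  (Fintype.card κ : ℝ≥0∞)⁻¹ • ∑ n, Measure.dirac (sensingVec A n)

/-- The law of real white Gaussian noise: independent entries of law `N(0, σ²)`. -/
def noiseLaw (N P Nr : ℕ) (σ : ℝ≥0) : Measure (Idx N P Nr → ℝ) :=
  Measure.pi fun _ => gaussianReal 0 (σ ^ 2)

end JRC

end

noncomputable section

namespace JRC

/-! By adjointness, pairing an atom with the noise matrix gives a sum over the measurements. Group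
the measurements by the index `n` on which the sensing vector depends, and let `k` run over the
remaining grid of `K` points: pulses and antennas for the radar, antennas only for communications.
The pairing is then `∑ c n * conj (p n)`, up to unimodular factors and the error term. Here `c n` is
the inner product of the sensing vector with `u`, and `p n` is a random trigonometric polynomial on
the grid with coefficients `ω`. Isotropy bounds `∑ |c n|²` by the number of values of `n`, and
Cauchy–Schwarz removes `u`. The error term is bounded entrywise and costs only `E ‖ω‖₂`. These steps
are `norm_sum_weighted_le` and `lintegral_dualAtomicNorm_le`.

What remains is the expected maximum of `∑ |p n|²`. For one-column radar data with three frequency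
samples the claim has no constant to spare: it requires exactly `3 K log (3 K)` for three
polynomials. More polynomials reduce to three by averaging over cyclic triples
(`exists_bound_grid`), and the three-polynomial bound `exists_bound_triple` combines two methods.

For `K ≤ 13` (`exists_bound_lags`), the function `∑ |p n|²` is a Fourier series whose coefficients
are the autocorrelations of `ω`, so its maximum is at most the sum of their moduli. Lag zero has
mean `3 K`. At any other lag the autocorrelation is a Gaussian chaos on a bipartite graph, whose
first moment is at most `√(2/π)` times its standard deviation.

For `K ≥ 14` (`exists_bound_box`), a point value is dominated by a local average of a reweighted
polynomial. Hence the excess of the maximum over a threshold is at most `4 K` times the integral of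
the pointwise excess over a whole period. Pointwise, the reweighted sum is the squared norm of three
independent complex Gaussians. Polar coordinates in six real dimensions reduce its mean excess to a
Gamma(3) tail, plus a correction quadratic in the pseudo-variance (`lintegral_hinge_le`). By
Parseval that correction is small on average over the period. -/

/-! ### Linear images and low moments of Gaussian vectors -/

/-- The characteristic function of a linear image is the original one at the transposed argument,
and orthogonality of the rows makes the resulting quadratic form diagonal. -/
theorem map_pi_gaussianReal_of_orthogonal {ι m : Type*} [Fintype ι] [Fintype m] [DecidableEq m]
    (a : m → ι → ℝ) (v : m → ℝ≥0)
    (h : ∀ j j', ∑ i, a j i * a j' i = if j = j' then (v j : ℝ) else 0) :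
    (Measure.pi fun _ : ι => gaussianReal 0 1).map (fun ω j => ∑ i, a j i * ω i) =
      Measure.pi fun j => gaussianReal 0 (v j) := by
  have hm : Measurable (fun (ω : ι → ℝ) (j : m) => ∑ i, a j i * ω i) := by fun_prop
  have : IsProbabilityMeasure ((Measure.pi fun _ : ι => gaussianReal 0 1).map
      (fun ω (j : m) => ∑ i, a j i * ω i)) := Measure.isProbabilityMeasure_map hm.aemeasurable
  refine charFun_eq_pi_iff.1 fun t => ?_
  have key : charFun (((Measure.pi fun _ : ι => gaussianReal 0 1).map
      (fun ω (j : m) => ∑ i, a j i * ω i)).map (WithLp.toLp 2)) t =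
      charFun ((Measure.pi fun _ : ι => gaussianReal 0 1).map (WithLp.toLp 2))
        (WithLp.toLp 2 fun i => ∑ j, t j * a j i) := by
    have hL : Measurable (WithLp.toLp 2 : (m → ℝ) → EuclideanSpace ℝ m) := by fun_prop
    rw [charFun_apply, charFun_apply, Measure.map_map hL hm,
      integral_map (hL.comp hm).aemeasurable (by fun_prop), integral_map (by fun_prop) (by fun_prop)]
    congr 1 with ω
    congr 3
    simp only [PiLp.inner_apply, Function.comp, RCLike.inner_apply, conj_trivial, Finset.mul_sum,
      Finset.sum_mul]
    rw [Finset.sum_comm]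
    exact Finset.sum_congr rfl fun i _ => Finset.sum_congr rfl fun j _ => by ring
  rw [key, charFun_pi]
  simp only [charFun_gaussianReal, ← Complex.exp_sum]
  congr 1
  have h2 : ∑ i, (∑ j, t j * a j i) ^ 2 = ∑ j, (v j : ℝ) * t j ^ 2 := by
    calc ∑ i, (∑ j, t j * a j i) ^ 2 = ∑ i, ∑ j, ∑ j', t j * t j' * (a j i * a j' i) := by
          refine Finset.sum_congr rfl fun i _ => ?_
          rw [sq, Finset.sum_mul_sum]
          exact Finset.sum_congr rfl fun j _ => Finset.sum_congr rfl fun j' _ => by ring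
      _ = ∑ j, ∑ j', t j * t j' * ∑ i, a j i * a j' i := by
          rw [Finset.sum_comm]
          refine Finset.sum_congr rfl fun j _ => ?_
          rw [Finset.sum_comm]
          exact Finset.sum_congr rfl fun j' _ => (Finset.mul_sum _ _ _).symm
      _ = _ := by
          refine Finset.sum_congr rfl fun j _ => ?_
          simp only [h, mul_ite, mul_zero, Finset.sum_ite_eq, Finset.mem_univ, if_true]
          ring
  have h3 := congrArg (fun x : ℝ => -(x : ℂ) / 2) h2
  push_cast at h3
  simp only [mul_zero, zero_mul, zero_sub, Complex.ofReal_zero, NNReal.coe_one, Complex.ofReal_one, one_mul]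
  simp only [Finset.sum_neg_distrib, ← Finset.sum_div, ← neg_div]
  push_cast
  exact h3


theorem integral_comp_abs_gaussianReal (f : ℝ → ℝ) :
    ∫ x, f |x| ∂(gaussianReal 0 1) =
      (Real.sqrt (2 * Real.pi))⁻¹ * (2 * ∫ x in Set.Ioi (0 : ℝ), f x * Real.exp (-(1 / 2) * x ^ 2)) := by
  rw [integral_gaussianReal_eq_integral_smul one_ne_zero]
  have h := integral_comp_abs (f := fun x => f x * Real.exp (-(1 / 2) * x ^ 2))
  rw [← h, ← integral_const_mul]
  refine integral_congr_ae (.of_forall fun x => ?_)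
  simp only [gaussianPDFReal, smul_eq_mul, NNReal.coe_one, mul_one, sub_zero, sq_abs]
  rw [show -x ^ 2 / 2 = -(1 / 2) * x ^ 2 by ring]
  ring

theorem integral_pow_mul_exp_neg_half_sq (n : ℕ) :
    ∫ x in Set.Ioi (0 : ℝ), x ^ n * Real.exp (-(1 / 2) * x ^ 2) =
      (1 / 2 : ℝ) ^ (-((n : ℝ) + 1) / 2) * (1 / 2) * Real.Gamma (((n : ℝ) + 1) / 2) := by
  have h := integral_rpow_mul_exp_neg_mul_rpow (p := 2) (q := n) (b := 1 / 2) two_pos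
    (by have : (0 : ℝ) ≤ n := n.cast_nonneg
        linarith) (by norm_num)
  simpa only [Real.rpow_natCast, Real.rpow_two] using h

theorem integral_abs_gaussianReal :
    ∫ x, |x| ∂(gaussianReal 0 1) = Real.sqrt (2 / Real.pi) := by
  rw [integral_comp_abs_gaussianReal (fun x => x)]
  have h := integral_pow_mul_exp_neg_half_sq 1
  simp only [pow_one, Nat.cast_one] at h
  rw [h]
  norm_num [Real.rpow_neg_one]
  have h2 : (Real.sqrt 2)⁻¹ * 2 = Real.sqrt 2 := by
    rw [inv_mul_eq_div, Real.div_sqrt]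
  rw [mul_assoc, h2, div_eq_inv_mul]

theorem integral_pow_four_gaussianReal : ∫ x, x ^ 4 ∂(gaussianReal 0 1) = 3 := by
  have h := integral_comp_abs_gaussianReal (fun x => x ^ 4)
  simp only [Even.pow_abs (by decide : Even 4)] at h
  rw [h, integral_pow_mul_exp_neg_half_sq 4]
  have h1 : Real.Gamma (((4 : ℕ) + 1 : ℝ) / 2) = 3 / 4 * Real.sqrt Real.pi := by
    have := Real.Gamma_nat_add_half 2
    norm_num [Nat.doubleFactorial] at this ⊢
    linarith
  have h2 : (1 / 2 : ℝ) ^ (-(((4 : ℕ) : ℝ) + 1) / 2) = 4 * Real.sqrt 2 := by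
    rw [one_div, Real.inv_rpow zero_le_two, ← Real.rpow_neg zero_le_two,
      show -(-(((4 : ℕ) : ℝ) + 1) / 2) = (2 : ℕ) + 1 / 2 by norm_num, Real.rpow_add two_pos,
      Real.rpow_natCast, ← Real.sqrt_eq_rpow]
    norm_num
  rw [h1, h2, Real.sqrt_mul zero_le_two]
  have := Real.sqrt_pos.2 Real.pi_pos
  have := Real.sqrt_pos.2 (zero_lt_two (α := ℝ))
  field_simp

theorem integrable_pow_gaussianReal (n : ℕ) (v : ℝ≥0) :
    Integrable (fun x => x ^ n) (gaussianReal 0 v) :=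
  integrable_pow_of_mem_interior_integrableExpSet (X := id) (by simp) n

theorem variance_sq_gaussianReal : Var[fun x => x ^ 2; gaussianReal 0 1] = 2 := by
  have h2 : ∫ x, x ^ 2 ∂(gaussianReal 0 1) = 1 := by
    have := variance_id_gaussianReal (μ := 0) (v := 1)
    rw [variance_eq_integral (by fun_prop)] at this
    simpa using this
  have hL : MemLp (fun x : ℝ => x ^ 2) 2 (gaussianReal 0 1) := by
    rw [memLp_two_iff_integrable_sq (by fun_prop)]
    simpa only [← pow_mul] using integrable_pow_gaussianReal 4 1
  rw [variance_eq_sub hL, h2]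
  simp only [Pi.pow_apply, ← pow_mul]
  rw [integral_pow_four_gaussianReal]
  norm_num

theorem gaussianReal_eq_map_sqrt (v : ℝ≥0) :
    gaussianReal 0 v = (gaussianReal 0 1).map (fun x => Real.sqrt v * x) := by
  rw [gaussianReal_map_const_mul, mul_zero, mul_one]
  congr 1
  ext
  simp

theorem lintegral_enorm_gaussianReal (v : ℝ≥0) :
    ∫⁻ x, ‖x‖ₑ ∂(gaussianReal 0 v) = ENNReal.ofReal (Real.sqrt (2 / Real.pi) * Real.sqrt v) := by
  have h1 : ∫⁻ x, ‖x‖ₑ ∂(gaussianReal 0 1) = ENNReal.ofReal (Real.sqrt (2 / Real.pi)) := by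
    rw [← integral_abs_gaussianReal, ofReal_integral_eq_lintegral_ofReal]
    · simp only [← Real.norm_eq_abs, ofReal_norm]
    · simpa using (integrable_pow_gaussianReal 1 1).abs
    · exact .of_forall fun x => abs_nonneg x
  rw [gaussianReal_eq_map_sqrt, lintegral_map (by fun_prop) (by fun_prop)]
  simp only [enorm_mul]
  rw [lintegral_const_mul _ (by fun_prop), h1, ENNReal.ofReal_mul (by positivity), mul_comm,
    Real.enorm_of_nonneg (Real.sqrt_nonneg _)]

theorem map_pi_gaussianReal_linear {ι : Type*} [Fintype ι] (c : ι → ℝ) :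
    (Measure.pi fun _ : ι => gaussianReal 0 1).map (fun ω => ∑ i, c i * ω i) =
      gaussianReal 0 (∑ i, c i ^ 2).toNNReal := by
  have h := map_pi_gaussianReal_of_orthogonal (m := Unit) (fun _ => c)
    (fun _ => (∑ i, c i ^ 2).toNNReal) (fun _ _ => by
      rw [if_pos rfl, Real.coe_toNNReal _ (Finset.sum_nonneg fun i _ => sq_nonneg _)]
      exact Finset.sum_congr rfl fun i _ => (sq _).symm)
  have h2 := congrArg (Measure.map fun f : Unit → ℝ => f ()) h
  rw [Measure.map_map (by fun_prop) (by fun_prop),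
    (measurePreserving_eval (fun _ : Unit => gaussianReal 0 (∑ i, c i ^ 2).toNNReal) ()).map_eq] at h2
  exact h2

theorem lintegral_enorm_linear {ι : Type*} [Fintype ι] (c : ι → ℝ) :
    ∫⁻ ω, ‖∑ i, c i * ω i‖ₑ ∂(Measure.pi fun _ : ι => gaussianReal 0 1) =
      ENNReal.ofReal (Real.sqrt (2 / Real.pi) * Real.sqrt (∑ i, c i ^ 2)) := by
  have h := lintegral_map (μ := Measure.pi fun _ : ι => gaussianReal 0 1)
    (f := fun x : ℝ => ‖x‖ₑ) (g := fun ω => ∑ i, c i * ω i) (by fun_prop) (by fun_prop)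
  rw [← h, map_pi_gaussianReal_linear, lintegral_enorm_gaussianReal,
    Real.coe_toNNReal _ (Finset.sum_nonneg fun i _ => sq_nonneg _)]

theorem lintegral_sq_gaussianReal (v : ℝ≥0) :
    ∫⁻ x, ENNReal.ofReal (x ^ 2) ∂(gaussianReal 0 v) = v := by
  rw [← ofReal_integral_eq_lintegral_ofReal (integrable_pow_gaussianReal 2 v)
    (.of_forall fun x => sq_nonneg x)]
  have := variance_id_gaussianReal (μ := 0) (v := v)
  rw [variance_eq_integral (by fun_prop)] at this
  simp only [id, integral_id_gaussianReal, sub_zero] at this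
  rw [this, ENNReal.ofReal_coe_nnreal]

theorem lintegral_sq_linear {ι : Type*} [Fintype ι] (c : ι → ℝ) :
    ∫⁻ ω, ENNReal.ofReal ((∑ i, c i * ω i) ^ 2) ∂(Measure.pi fun _ : ι => gaussianReal 0 1) =
      ENNReal.ofReal (∑ i, c i ^ 2) := by
  have h := lintegral_map (μ := Measure.pi fun _ : ι => gaussianReal 0 1)
    (f := fun x : ℝ => ENNReal.ofReal (x ^ 2)) (g := fun ω => ∑ i, c i * ω i)
    (by fun_prop) (by fun_prop)
  rw [← h, map_pi_gaussianReal_linear, lintegral_sq_gaussianReal]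
  rfl

/-- Jensen for the square root, as Hölder's inequality against the constant 1. -/
theorem lintegral_rpow_half_le {Ω : Type*} [MeasurableSpace Ω] (μ : Measure Ω)
    [IsProbabilityMeasure μ] {f : Ω → ℝ≥0∞} (hf : AEMeasurable f μ) :
    ∫⁻ ω, f ω ^ (1 / 2 : ℝ) ∂μ ≤ (∫⁻ ω, f ω ∂μ) ^ (1 / 2 : ℝ) := by
  have h := ENNReal.lintegral_mul_le_Lp_mul_Lq μ Real.HolderConjugate.two_two
    (hf.pow_const (1 / 2 : ℝ)) (aemeasurable_const (b := 1))
  have h2 : ∀ x : ℝ≥0∞, (x ^ (1 / 2 : ℝ)) ^ (2 : ℝ) = x := fun x => by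
    rw [← ENNReal.rpow_mul]
    norm_num
  simpa only [Pi.mul_apply, mul_one, h2, ENNReal.one_rpow, lintegral_const, measure_univ] using h

theorem ofReal_sqrt_eq_rpow {x : ℝ} (hx : 0 ≤ x) :
    ENNReal.ofReal (Real.sqrt x) = ENNReal.ofReal x ^ (1 / 2 : ℝ) := by
  rw [Real.sqrt_eq_rpow, ENNReal.ofReal_rpow_of_nonneg hx (by norm_num)]

theorem lintegral_sqrt_le {Ω : Type*} [MeasurableSpace Ω] (μ : Measure Ω)
    [IsProbabilityMeasure μ] {f : Ω → ℝ} (hf : Measurable f) (hf0 : ∀ ω, 0 ≤ f ω) {B : ℝ}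
    (hB : 0 ≤ B) (h : ∫⁻ ω, ENNReal.ofReal (f ω) ∂μ ≤ ENNReal.ofReal B) :
    ∫⁻ ω, ENNReal.ofReal (Real.sqrt (f ω)) ∂μ ≤ ENNReal.ofReal (Real.sqrt B) := by
  simp only [ofReal_sqrt_eq_rpow (hf0 _), ofReal_sqrt_eq_rpow hB]
  exact (lintegral_rpow_half_le μ hf.ennreal_ofReal.aemeasurable).trans
    (ENNReal.rpow_le_rpow h (by norm_num))

/-! ### Bipartite Gaussian chaos -/

/-- Taking some of the coordinates from one sample and the others from an independent sample
does not change a product law. -/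
theorem measurePreserving_mix {ι : Type*} [Fintype ι] (χ : ι → Prop) [DecidablePred χ]
    (μ : Measure ℝ) [IsProbabilityMeasure μ] :
    MeasurePreserving (fun (z : (ι → ℝ) × (ι → ℝ)) i => if χ i then z.1 i else z.2 i)
      ((Measure.pi fun _ : ι => μ).prod (Measure.pi fun _ : ι => μ)) (Measure.pi fun _ : ι => μ) := by
  have hm : Measurable (fun (z : (ι → ℝ) × (ι → ℝ)) i => if χ i then z.1 i else z.2 i) := by
    refine measurable_pi_lambda _ fun i => ?_
    by_cases h : χ i <;> simp only [h, if_true, if_false] <;> fun_prop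
  refine ⟨hm, (Measure.pi_eq fun s hs => ?_).symm⟩
  rw [Measure.map_apply hm (MeasurableSet.univ_pi hs)]
  have : (fun (z : (ι → ℝ) × (ι → ℝ)) i => if χ i then z.1 i else z.2 i) ⁻¹' Set.univ.pi s =
      (Set.univ.pi fun i => if χ i then s i else Set.univ) ×ˢ
      (Set.univ.pi fun i => if χ i then Set.univ else s i) := by
    ext z
    simp only [Set.mem_preimage, Set.mem_univ_pi, Set.mem_prod, ← forall_and]
    refine forall_congr' fun i => ?_
    by_cases h : χ i <;> simp [h]
  rw [this, Measure.prod_prod, Measure.pi_pi, Measure.pi_pi, ← Finset.prod_mul_distrib]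
  refine Finset.prod_congr rfl fun i _ => ?_
  by_cases h : χ i <;> simp [h]

/-- The first moment of a bipartite Gaussian chaos. -/
theorem lintegral_enorm_chaos_le {ι : Type*} [Fintype ι] (χ : ι → Prop) [DecidablePred χ]
    (a : ι → ι → ℝ) (ha : ∀ i j, a i j ≠ 0 → χ i ∧ ¬ χ j) :
    ∫⁻ ω, ‖∑ j, (∑ i, a i j * ω i) * ω j‖ₑ ∂(Measure.pi fun _ : ι => gaussianReal 0 1) ≤
      ENNReal.ofReal (Real.sqrt (2 / Real.pi) * Real.sqrt (∑ j, ∑ i, a i j ^ 2)) := by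
  rw [← (measurePreserving_mix χ (gaussianReal 0 1)).lintegral_comp (by fun_prop),
    lintegral_prod _ (by
      refine Measurable.aemeasurable (Measurable.comp (g := fun ω : ι → ℝ =>
        ‖∑ j, (∑ i, a i j * ω i) * ω j‖ₑ) (by fun_prop)
          (measurePreserving_mix χ (gaussianReal 0 1)).measurable))]
  have h1 : ∀ x y : ι → ℝ, (∑ j, (∑ i, a i j * if χ i then x i else y i) *
      if χ j then x j else y j) = ∑ j, (∑ i, a i j * x i) * y j := by
    intro x y
    simp only [Finset.sum_mul]
    refine Finset.sum_congr rfl fun j _ => Finset.sum_congr rfl fun i _ => ?_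
    by_cases h : a i j = 0
    · simp [h]
    · simp [ha i j h]
  -- With the `χ`-coordinates `x` frozen, the chaos is a Gaussian linear form in the independent
  -- `y`, so its first absolute moment is explicit; Jensen then handles the integral over `x`.
  simp only [h1, lintegral_enorm_linear]
  simp only [ENNReal.ofReal_mul (Real.sqrt_nonneg _)]
  rw [lintegral_const_mul' _ _ ENNReal.ofReal_ne_top]
  gcongr
  refine lintegral_sqrt_le _ (by fun_prop) (fun ω => Finset.sum_nonneg fun i _ => sq_nonneg _)
    (Finset.sum_nonneg fun i _ => Finset.sum_nonneg fun i _ => sq_nonneg _) ?_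
  simp only [ENNReal.ofReal_sum_of_nonneg fun i _ => sq_nonneg _]
  rw [lintegral_finsetSum _ (by fun_prop), ENNReal.ofReal_sum_of_nonneg fun i _ =>
    Finset.sum_nonneg fun i _ => sq_nonneg _]
  simp only [lintegral_sq_linear]
  exact le_rfl

/-- Every nonzero coefficient joins the two colour classes, so the form can be folded onto the block
`χ × ¬χ`. As `A i j` and `A j i` are never both nonzero, folding creates no cross terms and
preserves the sum of squares. -/
theorem lintegral_enorm_bipartite_le {ι : Type*} [Fintype ι] (χ : ι → Prop) [DecidablePred χ]
    (A : ι → ι → ℝ) (hχ : ∀ i j, A i j ≠ 0 → (χ i ↔ ¬ χ j)) (hA : ∀ i j, A i j * A j i = 0) :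
    ∫⁻ ω, ‖∑ i, ∑ j, A i j * (ω i * ω j)‖ₑ ∂(Measure.pi fun _ : ι => gaussianReal 0 1) ≤
      ENNReal.ofReal (Real.sqrt (2 / Real.pi) * Real.sqrt (∑ i, ∑ j, A i j ^ 2)) := by
  have split : ∀ g : ι → ι → ℝ, (∀ i j, g i j ≠ 0 → A i j ≠ 0) →
      ∑ i, ∑ j, g i j = ∑ j, ∑ i, if χ i ∧ ¬ χ j then g i j + g j i else 0 := by
    intro g hg
    have h1 : ∀ i j, (if χ i ∧ ¬ χ j then g i j + g j i else 0) =
        (if χ i ∧ ¬ χ j then g i j else 0) + if χ i ∧ ¬ χ j then g j i else 0 := by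
      intro i j
      split_ifs <;> simp
    simp only [h1, Finset.sum_add_distrib]
    rw [Finset.sum_comm (f := fun j i => if χ i ∧ ¬ χ j then g i j else 0),
      ← Finset.sum_add_distrib]
    refine Finset.sum_congr rfl fun i _ => ?_
    rw [← Finset.sum_add_distrib]
    refine Finset.sum_congr rfl fun j _ => ?_
    by_cases h : g i j = 0
    · simp [h]
    · have := hχ i j (hg i j h)
      by_cases hi : χ i <;> simp_all
  have e1 : ∀ ω : ι → ℝ, ∑ i, ∑ j, A i j * (ω i * ω j) =
      ∑ j, (∑ i, (if χ i ∧ ¬ χ j then A i j + A j i else 0) * ω i) * ω j := by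
    intro ω
    rw [split (fun i j => A i j * (ω i * ω j)) fun i j => left_ne_zero_of_mul]
    refine Finset.sum_congr rfl fun j _ => ?_
    rw [Finset.sum_mul]
    refine Finset.sum_congr rfl fun i _ => ?_
    split_ifs
    · ring
    · ring
  have e2 : ∑ i, ∑ j, A i j ^ 2 =
      ∑ j, ∑ i, (if χ i ∧ ¬ χ j then A i j + A j i else 0) ^ 2 := by
    rw [split (fun i j => A i j ^ 2) fun i j h => by simpa using h]
    refine Finset.sum_congr rfl fun j _ => Finset.sum_congr rfl fun i _ => ?_
    split_ifs
    · linear_combination -2 * hA i j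
    · ring
  simp only [e1]
  rw [e2]
  refine lintegral_enorm_chaos_le χ _ fun i j h => ?_
  by_contra hc
  simp [hc] at h

/-! ### Autocorrelations: the bound for small grids -/

/-- The coefficients of a trigonometric polynomial in two variables, evaluated. -/
def gridPoly {P Q : ℕ} (c : Fin P × Fin Q → ℂ) (x : ℝ × ℝ) : ℂ :=
  ∑ k, c k * (harmonicVec P x.1 k.1 * harmonicVec Q x.2 k.2)

theorem harmonicVec_mul_conj {P : ℕ} (θ : ℝ) (k l : Fin P) :
    harmonicVec P θ k * conj (harmonicVec P θ l) =
      Complex.exp (2 * Real.pi * Complex.I * (θ * (((k : ℤ) - (l : ℤ) : ℤ) : ℝ) : ℝ)) := by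
  rw [harmonicVec, harmonicVec, ← Complex.exp_conj, ← Complex.exp_add]
  congr 1
  simp only [map_mul, map_ofNat, Complex.conj_ofReal, Complex.conj_I]
  push_cast
  ring

/-- The difference of two grid points. -/
def lag {P Q : ℕ} (k l : Fin P × Fin Q) : ℤ × ℤ :=
  ((k.1 : ℤ) - (l.1 : ℤ), (k.2 : ℤ) - (l.2 : ℤ))

def lagSet (P Q : ℕ) : Finset (ℤ × ℤ) :=
  Finset.Ioo (-(P : ℤ)) P ×ˢ Finset.Ioo (-(Q : ℤ)) Q

theorem lag_mem_lagSet {P Q : ℕ} (k l : Fin P × Fin Q) : lag k l ∈ lagSet P Q := by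
  have := k.1.2
  have := k.2.2
  have := l.1.2
  have := l.2.2
  simp only [lagSet, lag, Finset.mem_product, Finset.mem_Ioo]
  omega

theorem lag_eq_zero_iff {P Q : ℕ} (k l : Fin P × Fin Q) : lag k l = 0 ↔ k = l := by
  simp only [lag, Prod.ext_iff, Prod.fst_zero, Prod.snd_zero, Fin.ext_iff]
  omega

theorem card_lagSet {P Q : ℕ} (hP : 1 ≤ P) (hQ : 1 ≤ Q) :
    ((lagSet P Q).card : ℝ) = (2 * P - 1) * (2 * Q - 1) := by
  rw [lagSet, Finset.card_product, Int.card_Ioo, Int.card_Ioo]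
  have h : ∀ n : ℕ, 1 ≤ n → (((n : ℤ) - -(n : ℤ) - 1).toNat : ℝ) = 2 * n - 1 := by
    intro n hn
    rw [show ((n : ℤ) - -(n : ℤ) - 1).toNat = 2 * n - 1 by omega, Nat.cast_sub (by omega)]
    push_cast
    ring
  rw [Nat.cast_mul, h P hP, h Q hQ]

/-- The autocorrelation at the lag `d` of a vector-valued coefficient array. -/
def autocorr {P Q : ℕ} (d : ℤ × ℤ) (ω : Fin 3 × (Fin P × Fin Q) → ℝ) : ℝ :=
  ∑ i, ∑ j, (if i.1 = j.1 ∧ lag i.2 j.2 = d then 1 else 0) * (ω i * ω j)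

/-- Expanding the squares and collecting the pairs of equal lag gives a Fourier series in `x` with
the autocorrelations as coefficients; its characters have modulus 1. -/
theorem sum_norm_gridPoly_sq_le {P Q : ℕ} (ω : Fin 3 × (Fin P × Fin Q) → ℝ) (x : ℝ × ℝ) :
    ∑ n, ‖gridPoly (fun k => (ω (n, k) : ℂ)) x‖ ^ 2 ≤ ∑ d ∈ lagSet P Q, |autocorr d ω| := by
  set E : ℤ × ℤ → ℂ := fun d =>
    Complex.exp (2 * Real.pi * Complex.I * (x.1 * (d.1 : ℝ) : ℝ)) *
      Complex.exp (2 * Real.pi * Complex.I * (x.2 * (d.2 : ℝ) : ℝ)) with hE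
  have hEn : ∀ d, ‖E d‖ = 1 := by
    intro d
    have h : ∀ y : ℝ, ‖Complex.exp (2 * Real.pi * Complex.I * (y : ℝ))‖ = 1 := fun y => by
      rw [show 2 * Real.pi * Complex.I * (y : ℂ) = ((2 * Real.pi * y : ℝ) : ℂ) * Complex.I by
        push_cast; ring]
      exact Complex.norm_exp_ofReal_mul_I _
    rw [hE, norm_mul, h, h, one_mul]
  have h1 : ((∑ n, ‖gridPoly (fun k => (ω (n, k) : ℂ)) x‖ ^ 2 : ℝ) : ℂ) =
      ∑ d ∈ lagSet P Q, E d * autocorr d ω := by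
    have h2 : ∀ n, ((‖gridPoly (fun k => (ω (n, k) : ℂ)) x‖ ^ 2 : ℝ) : ℂ) =
        ∑ k, ∑ l, E (lag k l) * (ω (n, k) * ω (n, l)) := by
      intro n
      push_cast
      rw [← Complex.mul_conj', gridPoly, map_sum, Finset.sum_mul_sum]
      refine Finset.sum_congr rfl fun k _ => Finset.sum_congr rfl fun l _ => ?_
      simp only [map_mul, Complex.conj_ofReal, hE, lag]
      rw [← harmonicVec_mul_conj, ← harmonicVec_mul_conj]
      ring
    have h3 : ∀ d, (autocorr d ω : ℂ) =
        ∑ n, ∑ k, ∑ l, if lag k l = d then ((ω (n, k) : ℂ) * ω (n, l)) else 0 := by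
      intro d
      simp only [autocorr, Fintype.sum_prod_type (α₁ := Fin 3)]
      push_cast
      refine Finset.sum_congr rfl fun n _ => Finset.sum_congr rfl fun k _ => ?_
      rw [Finset.sum_eq_single n]
      · refine Finset.sum_congr rfl fun l _ => ?_
        by_cases h : lag k l = d <;> simp [h]
      · intro m _ hm
        exact Finset.sum_eq_zero fun l _ => by simp [hm.symm]
      · simp
    push_cast at h2 ⊢
    simp only [h2, h3, Finset.mul_sum]
    rw [Finset.sum_comm (s := lagSet P Q)]
    refine Finset.sum_congr rfl fun n _ => ?_
    rw [Finset.sum_comm (s := lagSet P Q)]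
    refine Finset.sum_congr rfl fun k _ => ?_
    rw [Finset.sum_comm (s := lagSet P Q)]
    refine Finset.sum_congr rfl fun l _ => ?_
    rw [Finset.sum_eq_single (lag k l)]
    · simp
    · intro d _ hd
      simp [hd.symm]
    · exact fun h => absurd (lag_mem_lagSet k l) h
  have h0 : 0 ≤ ∑ n, ‖gridPoly (fun k => (ω (n, k) : ℂ)) x‖ ^ 2 :=
    Finset.sum_nonneg fun n _ => sq_nonneg _
  rw [← abs_of_nonneg h0, ← Real.norm_eq_abs, ← Complex.norm_real, h1]
  refine (norm_sum_le _ _).trans (Finset.sum_le_sum fun d _ => ?_)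
  rw [norm_mul, hEn, one_mul, Complex.norm_real, Real.norm_eq_abs]

/-- The number of pairs of grid points with the lag `d`. -/
def lagCount (P Q : ℕ) (d : ℤ × ℤ) : ℕ :=
  (Finset.univ.filter fun p : (Fin P × Fin Q) × (Fin P × Fin Q) => lag p.1 p.2 = d).card

theorem sum_autocorr_coeff {P Q : ℕ} (d : ℤ × ℤ) :
    ∑ i : Fin 3 × (Fin P × Fin Q), ∑ j : Fin 3 × (Fin P × Fin Q),
      (if i.1 = j.1 ∧ lag i.2 j.2 = d then (1 : ℝ) else 0) ^ 2 = 3 * lagCount P Q d := by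
  have h : ∀ (n : Fin 3) (k : Fin P × Fin Q),
      ∑ j : Fin 3 × (Fin P × Fin Q), (if n = j.1 ∧ lag k j.2 = d then (1 : ℝ) else 0) ^ 2 =
        ∑ l, if lag k l = d then 1 else 0 := by
    intro n k
    rw [Fintype.sum_prod_type, Finset.sum_eq_single n]
    · simp
    · intro m _ hm
      exact Finset.sum_eq_zero fun l _ => by simp [hm.symm]
    · simp
  rw [Fintype.sum_prod_type]
  simp only [h, lagCount, Finset.sum_const, Finset.card_univ, Fintype.card_fin, nsmul_eq_mul]
  rw [Finset.card_filter, Fintype.sum_prod_type (f := fun p : (Fin P × Fin Q) × (Fin P × Fin Q) =>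
    if lag p.1 p.2 = d then 1 else 0)]
  push_cast
  ring

/-- Moving by `d` changes the quotient by `|d|` by exactly one, so the parity of the quotient is a
proper 2-colouring of the graph joining points at distance `d`. -/
theorem int_div_natAbs_parity {a b d : ℤ} (hd : d ≠ 0) (h : a - b = d) :
    (a / |d| % 2 = 0 ↔ ¬ b / |d| % 2 = 0) := by
  rcases abs_cases d with ⟨h1, _⟩ | ⟨h1, _⟩
  · rw [h1, show a = b + d by omega, Int.add_ediv_of_dvd_right dvd_rfl, Int.ediv_self hd]
    omega
  · rw [h1, show b = a + -d by omega, Int.add_ediv_of_dvd_right dvd_rfl,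
      Int.ediv_self (by omega)]
    omega

theorem lintegral_enorm_autocorr_le {P Q : ℕ} {d : ℤ × ℤ} (hd : d ≠ 0) :
    ∫⁻ ω, ‖autocorr d ω‖ₑ
        ∂(Measure.pi fun _ : Fin 3 × (Fin P × Fin Q) => gaussianReal 0 1) ≤
      ENNReal.ofReal (Real.sqrt (2 / Real.pi) * Real.sqrt (3 * lagCount P Q d)) := by
  rw [← sum_autocorr_coeff]
  -- A pair and its reversal have opposite lags, and a nonzero `d` differs from `-d`.
  have hA : ∀ i j : Fin 3 × (Fin P × Fin Q),
      (if i.1 = j.1 ∧ lag i.2 j.2 = d then (1 : ℝ) else 0) *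
        (if j.1 = i.1 ∧ lag j.2 i.2 = d then 1 else 0) = 0 := by
    intro i j
    by_contra h
    simp only [mul_ite, mul_one, mul_zero] at h
    split_ifs at h with h1 h2 <;> try exact h rfl
    apply hd
    have h3 := h1.2
    have h4 := h2.2
    simp only [lag, Prod.ext_iff] at h3 h4 ⊢
    simp only [Prod.fst_zero, Prod.snd_zero]
    omega
  -- The colouring uses whichever coordinate of the lag is nonzero.
  by_cases h1 : d.1 = 0
  · have h2 : d.2 ≠ 0 := fun h2 => hd (Prod.ext h1 h2)
    refine lintegral_enorm_bipartite_le (fun i => ((i.2.2 : ℕ) : ℤ) / |d.2| % 2 = 0) _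
      (fun i j hij => ?_) hA
    have h3 : lag i.2 j.2 = d := by
      by_contra h
      simp [h] at hij
    exact int_div_natAbs_parity h2 (by rw [← h3]; rfl)
  · refine lintegral_enorm_bipartite_le (fun i => ((i.2.1 : ℕ) : ℤ) / |d.1| % 2 = 0) _
      (fun i j hij => ?_) hA
    have h3 : lag i.2 j.2 = d := by
      by_contra h
      simp [h] at hij
    exact int_div_natAbs_parity h1 (by rw [← h3]; rfl)

theorem lintegral_enorm_autocorr_zero {P Q : ℕ} :
    ∫⁻ ω, ‖autocorr 0 ω‖ₑ
        ∂(Measure.pi fun _ : Fin 3 × (Fin P × Fin Q) => gaussianReal 0 1) =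
      ENNReal.ofReal (3 * (P * Q)) := by
  have h : ∀ ω : Fin 3 × (Fin P × Fin Q) → ℝ, ‖autocorr 0 ω‖ₑ = ∑ i, ENNReal.ofReal (ω i ^ 2) := by
    intro ω
    have : autocorr 0 ω = ∑ i, ω i ^ 2 := by
      refine Finset.sum_congr rfl fun i _ => ?_
      rw [Finset.sum_eq_single i]
      · simp [lag_eq_zero_iff, sq]
      · intro j _ hj
        rw [if_neg, zero_mul]
        rintro ⟨h1, h2⟩
        exact hj (Prod.ext h1.symm ((lag_eq_zero_iff _ _).1 h2).symm)
      · simp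
    rw [this, Real.enorm_of_nonneg (Finset.sum_nonneg fun i _ => sq_nonneg _),
      ENNReal.ofReal_sum_of_nonneg fun i _ => sq_nonneg _]
  simp only [h]
  rw [lintegral_finsetSum _ (by fun_prop)]
  have h2 : ∀ i : Fin 3 × (Fin P × Fin Q), ∫⁻ ω, ENNReal.ofReal (ω i ^ 2)
      ∂(Measure.pi fun _ : Fin 3 × (Fin P × Fin Q) => gaussianReal 0 1) = 1 := by
    intro i
    rw [(measurePreserving_eval (fun _ : Fin 3 × (Fin P × Fin Q) => gaussianReal 0 1) i).lintegral_comp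
      (f := fun x : ℝ => ENNReal.ofReal (x ^ 2)) (by fun_prop), lintegral_sq_gaussianReal]
    rfl
  simp only [h2, Finset.sum_const, Finset.card_univ, Fintype.card_prod, Fintype.card_fin,
    nsmul_eq_mul, mul_one]
  rw [← ENNReal.ofReal_natCast]
  push_cast
  rfl

theorem sum_lagCount {P Q : ℕ} :
    ∑ d ∈ (lagSet P Q).erase 0, (lagCount P Q d : ℝ) = (P * Q : ℝ) ^ 2 - P * Q := by
  have h0 : lagCount P Q 0 = P * Q := by
    rw [lagCount]
    have : (Finset.univ.filter fun p : (Fin P × Fin Q) × (Fin P × Fin Q) => lag p.1 p.2 = 0) =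
        Finset.univ.image fun k => (k, k) := by
      ext p
      simp only [Finset.mem_filter, Finset.mem_univ, true_and, lag_eq_zero_iff, Finset.mem_image]
      constructor
      · intro h
        exact ⟨p.1, Prod.ext rfl h⟩
      · rintro ⟨k, rfl⟩
        rfl
    rw [this, Finset.card_image_of_injective _ fun a b h => (Prod.ext_iff.1 h).1]
    simp
  have h1 : ∑ d ∈ lagSet P Q, lagCount P Q d = (P * Q) ^ 2 := by
    have := Finset.card_eq_sum_card_fiberwise (s := Finset.univ) (t := lagSet P Q)
      (f := fun p : (Fin P × Fin Q) × (Fin P × Fin Q) => lag p.1 p.2)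
      (fun p _ => lag_mem_lagSet p.1 p.2)
    simp only [lagCount]
    rw [← this]
    simp [sq]
  -- On an empty grid `lagSet` need not contain the zero lag, so nothing can be split off there.
  rcases Nat.eq_zero_or_pos (P * Q) with hz | hpos
  · have h3 : ∀ d ∈ (lagSet P Q).erase 0, (lagCount P Q d : ℝ) = 0 := by
      intro d hd
      rw [hz] at h1
      have := (Finset.sum_eq_zero_iff.1 (h1.trans (by norm_num))) d (Finset.mem_of_mem_erase hd)
      exact_mod_cast this
    rw [Finset.sum_eq_zero h3]
    have : (P * Q : ℝ) = 0 := by exact_mod_cast hz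
    simp [this]
  · have hP : 0 < P := Nat.pos_of_mul_pos_right hpos
    have hQ : 0 < Q := Nat.pos_of_mul_pos_left hpos
    have hmem : (0 : ℤ × ℤ) ∈ lagSet P Q := by
      simp only [lagSet, Finset.mem_product, Finset.mem_Ioo, Prod.fst_zero, Prod.snd_zero]
      omega
    have h4 := Finset.add_sum_erase (lagSet P Q) (fun d => (lagCount P Q d : ℝ)) hmem
    have h5 : ∑ d ∈ lagSet P Q, (lagCount P Q d : ℝ) = (P * Q : ℝ) ^ 2 := by exact_mod_cast h1
    rw [h5, h0] at h4
    push_cast at h4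
    linarith

/-- The maximum of a random trigonometric polynomial, bounded through the autocorrelations. -/
theorem exists_bound_lags {P Q : ℕ} (hP : 1 ≤ P) (hQ : 1 ≤ Q) :
    ∃ G : (Fin 3 × (Fin P × Fin Q) → ℝ) → ℝ≥0∞, Measurable G ∧
      (∀ ω x, ENNReal.ofReal (∑ n, ‖gridPoly (fun k => (ω (n, k) : ℂ)) x‖ ^ 2) ≤ G ω) ∧
      ∫⁻ ω, G ω ∂(Measure.pi fun _ => gaussianReal 0 1) ≤
        ENNReal.ofReal (3 * (P * Q) + Real.sqrt (2 / Real.pi) * Real.sqrt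
          (3 * (((2 * P - 1) * (2 * Q - 1) - 1) * ((P * Q) ^ 2 - P * Q)))) := by
  have hmeas : ∀ d, Measurable fun ω : Fin 3 × (Fin P × Fin Q) → ℝ => ‖autocorr d ω‖ₑ := by
    intro d
    unfold autocorr
    fun_prop
  refine ⟨fun ω => ∑ d ∈ lagSet P Q, ‖autocorr d ω‖ₑ, by fun_prop, fun ω x => ?_, ?_⟩
  · refine (ENNReal.ofReal_le_ofReal (sum_norm_gridPoly_sq_le ω x)).trans ?_
    rw [ENNReal.ofReal_sum_of_nonneg fun d _ => abs_nonneg _]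
    simp only [← Real.norm_eq_abs, ofReal_norm]
    exact le_rfl
  · rw [lintegral_finsetSum _ fun d _ => hmeas d]
    have hmem : (0 : ℤ × ℤ) ∈ lagSet P Q := by
      simp only [lagSet, Finset.mem_product, Finset.mem_Ioo, Prod.fst_zero, Prod.snd_zero]
      omega
    rw [← Finset.add_sum_erase _ _ hmem, lintegral_enorm_autocorr_zero,
      ENNReal.ofReal_add (by positivity) (by positivity)]
    gcongr
    calc ∑ d ∈ (lagSet P Q).erase 0, ∫⁻ ω, ‖autocorr d ω‖ₑ
            ∂(Measure.pi fun _ : Fin 3 × (Fin P × Fin Q) => gaussianReal 0 1)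
        ≤ ∑ d ∈ (lagSet P Q).erase 0,
            ENNReal.ofReal (Real.sqrt (2 / Real.pi) * Real.sqrt (3 * lagCount P Q d)) :=
          Finset.sum_le_sum fun d hd => lintegral_enorm_autocorr_le (Finset.ne_of_mem_erase hd)
      _ = ENNReal.ofReal (Real.sqrt (2 / Real.pi) *
            ∑ d ∈ (lagSet P Q).erase 0, Real.sqrt (3 * lagCount P Q d)) := by
          rw [← ENNReal.ofReal_sum_of_nonneg fun d _ => by positivity, Finset.mul_sum]
      _ ≤ _ := by
          refine ENNReal.ofReal_le_ofReal (mul_le_mul_of_nonneg_left ?_ (Real.sqrt_nonneg _))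
          -- Cauchy–Schwarz over the nonzero lags: their number times the number of ordered pairs of
          -- distinct grid points.
          refine Real.le_sqrt_of_sq_le (sq_sum_le_card_mul_sum_sq.trans (le_of_eq ?_))
          have h : ∀ d, Real.sqrt (3 * lagCount P Q d) ^ 2 = 3 * lagCount P Q d := fun d =>
            Real.sq_sqrt (by positivity)
          simp only [h]
          rw [← Finset.mul_sum, sum_lagCount, Finset.card_erase_of_mem hmem,
            Nat.cast_sub (Finset.card_pos.2 ⟨0, hmem⟩), card_lagSet hP hQ]
          push_cast
          ring

/-! ### Numerical verification for at most 13 grid points -/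

theorem div_le_log_of_pow_le {p q : ℕ} {x : ℝ} (hq : 0 < q) (hx : 0 < x)
    (h : (2.7182818286 : ℝ) ^ p ≤ x ^ q) : (p : ℝ) / q ≤ Real.log x := by
  have hq' : (0 : ℝ) < q := by exact_mod_cast hq
  rw [div_le_iff₀ hq', mul_comm, ← Real.log_pow, Real.le_log_iff_exp_le (by positivity)]
  calc Real.exp p = Real.exp 1 ^ p := by rw [← Real.exp_nat_mul, mul_one]
    _ ≤ (2.7182818286 : ℝ) ^ p := by
        gcongr
        exact Real.exp_one_lt_d9.le
    _ ≤ x ^ q := h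

theorem sqrt_two_div_pi_mul_sqrt_le {X Y : ℝ} (hX : 0 ≤ X) (hY : 0 ≤ Y)
    (h : 0.63664 * X ≤ Y ^ 2) : Real.sqrt (2 / Real.pi) * Real.sqrt X ≤ Y := by
  rw [← Real.sqrt_mul (by positivity)]
  refine Real.sqrt_le_iff.2 ⟨hY, le_trans (mul_le_mul_of_nonneg_right ?_ hX) h⟩
  rw [div_le_iff₀ Real.pi_pos]
  nlinarith [Real.pi_gt_d4]

/-- `p / q` is a rational lower bound for `log (3 K)`, and `0.63664` an upper bound for `2 / π`. The
number of nonzero lags is `4 K - 2 S` with `S = P + Q`, so a lower bound `s` for `S` suffices, and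
`hn` is the squared inequality with a common factor removed. -/
theorem lag_bound_aux {K s : ℝ} {p q : ℕ} (hq : 0 < q) (hK : 1 ≤ K)
    (h : (2.7182818286 : ℝ) ^ p ≤ (3 * K) ^ q) (hpq : q ≤ p)
    (hn : 0.63664 * (4 * K - 2 * s) * (K - 1) ≤ 3 * K * ((p : ℝ) / q - 1) ^ 2) {S : ℝ} (hS : s ≤ S)
    (hS2 : 0 ≤ 4 * K - 2 * S) :
    3 * K + Real.sqrt (2 / Real.pi) * Real.sqrt (3 * ((4 * K - 2 * S) * (K ^ 2 - K))) ≤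
      3 * K * Real.log (3 * K) := by
  have hl := div_le_log_of_pow_le hq (by linarith : 0 < 3 * K) h
  have hq' : (0 : ℝ) < q := by exact_mod_cast hq
  have h1 : (1 : ℝ) ≤ p / q := by
    rw [le_div_iff₀ hq', one_mul]
    exact_mod_cast hpq
  have hKK : 0 ≤ K ^ 2 - K := by nlinarith
  have := sqrt_two_div_pi_mul_sqrt_le (X := 3 * ((4 * K - 2 * S) * (K ^ 2 - K)))
    (Y := 3 * K * ((p : ℝ) / q - 1)) (by positivity)
    (mul_nonneg (by linarith) (by linarith)) (by
      have h2 : 3 * ((4 * K - 2 * S) * (K ^ 2 - K)) ≤ 3 * ((4 * K - 2 * s) * (K ^ 2 - K)) := by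
        gcongr
      have h3 := mul_le_mul_of_nonneg_left hn (by linarith : 0 ≤ 3 * K)
      nlinarith)
  nlinarith

theorem lag_bound_le {P Q : ℕ} (hP : 1 ≤ P) (hQ : 1 ≤ Q) (hK : P * Q ≤ 13) :
    3 * (P * Q : ℝ) + Real.sqrt (2 / Real.pi) * Real.sqrt
        (3 * (((2 * P - 1) * (2 * Q - 1) - 1) * ((P * Q) ^ 2 - P * Q))) ≤
      3 * (P * Q) * Real.log (3 * (P * Q)) := by
  have e1 : ((2 * P - 1) * (2 * Q - 1) - 1 : ℝ) = 4 * (P * Q) - 2 * (P + Q) := by ring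
  have hP' : (1 : ℝ) ≤ P := by exact_mod_cast hP
  have hQ' : (1 : ℝ) ≤ Q := by exact_mod_cast hQ
  have hS : (0 : ℝ) ≤ 4 * (P * Q) - 2 * (P + Q) := by nlinarith
  have hamgm : 4 * (P * Q) ≤ (P + Q) ^ 2 := by nlinarith [sq_nonneg ((P : ℤ) - Q)]
  have hK1 : 1 ≤ P * Q := Nat.mul_pos hP hQ
  have hsum : ∀ s : ℕ, s ^ 2 < 4 * (P * Q) → ((s + 1 : ℕ) : ℝ) ≤ P + Q := by
    intro s hs
    have : s < P + Q := lt_of_pow_lt_pow_left₀ 2 (Nat.zero_le _) (hs.trans_le hamgm)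
    exact_mod_cast this
  rw [e1]
  obtain ⟨K, hKe⟩ : ∃ K, K = P * Q := ⟨_, rfl⟩
  have hKr : (P * Q : ℝ) = (K : ℝ) := by exact_mod_cast hKe.symm
  rw [hKr] at hS ⊢
  rw [← hKe] at hK hK1 hsum
  -- In each case `s` is the least integer with `s² ≥ 4 K`, a lower bound for `P + Q` by the
  -- arithmetic–geometric mean inequality. This gain over the trivial lag count is used up to `K =
  -- 13`.
  interval_cases K
  · exact lag_bound_aux (s := 2) (p := 1) (q := 1) one_pos (by norm_num) (by norm_num)
      le_rfl (by norm_num) (by simpa using hsum 1 (by norm_num)) hS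
  · exact lag_bound_aux (s := 3) (p := 17) (q := 10) (by norm_num) (by norm_num) (by norm_num)
      (by norm_num) (by norm_num) (by simpa using hsum 2 (by norm_num)) hS
  · exact lag_bound_aux (s := 4) (p := 21) (q := 10) (by norm_num) (by norm_num) (by norm_num)
      (by norm_num) (by norm_num) (by simpa using hsum 3 (by norm_num)) hS
  · exact lag_bound_aux (s := 4) (p := 24) (q := 10) (by norm_num) (by norm_num) (by norm_num)
      (by norm_num) (by norm_num) (by simpa using hsum 3 (by norm_num)) hS
  · exact lag_bound_aux (s := 5) (p := 26) (q := 10) (by norm_num) (by norm_num) (by norm_num)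
      (by norm_num) (by norm_num) (by simpa using hsum 4 (by norm_num)) hS
  · exact lag_bound_aux (s := 5) (p := 28) (q := 10) (by norm_num) (by norm_num) (by norm_num)
      (by norm_num) (by norm_num) (by simpa using hsum 4 (by norm_num)) hS
  · exact lag_bound_aux (s := 6) (p := 29) (q := 10) (by norm_num) (by norm_num) (by norm_num)
      (by norm_num) (by norm_num) (by simpa using hsum 5 (by norm_num)) hS
  · exact lag_bound_aux (s := 6) (p := 31) (q := 10) (by norm_num) (by norm_num) (by norm_num)
      (by norm_num) (by norm_num) (by simpa using hsum 5 (by norm_num)) hS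
  · exact lag_bound_aux (s := 6) (p := 32) (q := 10) (by norm_num) (by norm_num) (by norm_num)
      (by norm_num) (by norm_num) (by simpa using hsum 5 (by norm_num)) hS
  · exact lag_bound_aux (s := 7) (p := 33) (q := 10) (by norm_num) (by norm_num) (by norm_num)
      (by norm_num) (by norm_num) (by simpa using hsum 6 (by norm_num)) hS
  · exact lag_bound_aux (s := 7) (p := 69) (q := 20) (by norm_num) (by norm_num) (by norm_num)
      (by norm_num) (by norm_num) (by simpa using hsum 6 (by norm_num)) hS
  · exact lag_bound_aux (s := 7) (p := 179) (q := 50) (by norm_num) (by norm_num) (by norm_num)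
      (by norm_num) (by norm_num) (by simpa using hsum 6 (by norm_num)) hS
  · exact lag_bound_aux (s := 8) (p := 183) (q := 50) (by norm_num) (by norm_num) (by norm_num)
      (by norm_num) (by norm_num) (by simpa using hsum 7 (by norm_num)) hS

/-! ### Polar coordinates for six real Gaussians -/

/-- Three complex numbers, with the Euclidean norm. -/
abbrev PolarSpace : Type := EuclideanSpace ℝ (Fin 3 × Bool)

theorem finrank_polarSpace : Module.finrank ℝ PolarSpace = 6 := by
  simp

/-- Both measures are finite and have the same characteristic function, by the Gaussian Fourier
integral in dimension 6. -/
theorem stdGaussian_polarSpace_eq_withDensity :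
    stdGaussian PolarSpace = (volume : Measure PolarSpace).withDensity
      fun x => ENNReal.ofReal (((2 * Real.pi) ^ 3)⁻¹ * Real.exp (-(1 / 2) * ‖x‖ ^ 2)) := by
  have hint : Integrable (fun x : PolarSpace => ((2 * Real.pi) ^ 3)⁻¹ *
      Real.exp (-(1 / 2) * ‖x‖ ^ 2)) := by
    refine Integrable.const_mul ?_ _
    have h := GaussianFourier.integrable_cexp_neg_mul_sq_norm_add (V := PolarSpace) (b := 1 / 2)
      (by norm_num) 0 0
    refine (h.re).congr (.of_forall fun x => ?_)
    simp only [zero_mul, add_zero]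
    rw [show (-(1 / 2) * (‖x‖ : ℂ) ^ 2) = ((-(1 / 2) * ‖x‖ ^ 2 : ℝ) : ℂ) by push_cast; ring,
      ← Complex.ofReal_exp]
    exact Complex.ofReal_re _
  have hfin : IsFiniteMeasure ((volume : Measure PolarSpace).withDensity
      fun x => ENNReal.ofReal (((2 * Real.pi) ^ 3)⁻¹ * Real.exp (-(1 / 2) * ‖x‖ ^ 2))) :=
    isFiniteMeasure_withDensity_ofReal hint.2
  refine Measure.ext_of_charFun (funext fun t => ?_)
  rw [charFun_stdGaussian, charFun_apply,
    integral_withDensity_eq_integral_toReal_smul (by fun_prop) (.of_forall fun x => ENNReal.ofReal_lt_top)]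
  have h := GaussianFourier.integral_cexp_neg_mul_sq_norm_add (V := PolarSpace) (b := 1 / 2)
      (by norm_num) Complex.I t
  rw [finrank_polarSpace] at h
  have hc : (Real.pi / (1 / 2) : ℂ) ^ (((6 : ℕ) : ℂ) / 2) = (2 * Real.pi) ^ 3 := by
    rw [show (((6 : ℕ) : ℂ) / 2) = ((3 : ℕ) : ℂ) by norm_num, Complex.cpow_natCast]
    congr 1
    ring
  rw [hc] at h
  have h2 : ∀ x : PolarSpace, (ENNReal.ofReal (((2 * Real.pi) ^ 3)⁻¹ *
      Real.exp (-(1 / 2) * ‖x‖ ^ 2))).toReal • Complex.exp (inner ℝ x t * Complex.I) =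
      ((2 * Real.pi) ^ 3 : ℂ)⁻¹ *
        Complex.exp (-(1 / 2) * ‖x‖ ^ 2 + Complex.I * inner ℝ t x) := by
    intro x
    rw [ENNReal.toReal_ofReal (by positivity), Complex.exp_add, real_inner_comm, Complex.real_smul]
    push_cast
    rw [mul_comm Complex.I]
    ring
  simp only [h2]
  rw [integral_const_mul, h, ← mul_assoc, inv_mul_cancel₀ (by
    have := Real.pi_ne_zero
    norm_cast
    positivity), one_mul, Complex.I_sq]
  congr 1
  ring

/-- The exponent 5 is the dimension minus one; removing the origin changes nothing because it is a
null set. -/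
theorem lintegral_polar {f : PolarSpace → ℝ≥0∞} (hf : Measurable f) :
    ∫⁻ x, f x = ∫⁻ ξ, (∫⁻ ρ in Set.Ioi (0 : ℝ), ENNReal.ofReal (ρ ^ 5) * f (ρ • ξ.1))
      ∂((volume : Measure PolarSpace).toSphere) := by
  have hfr := finrank_polarSpace
  calc ∫⁻ x, f x = ∫⁻ x : ({(0)}ᶜ : Set PolarSpace), f x.1 ∂(volume.comap Subtype.val) := by
        rw [lintegral_subtype_comap (measurableSet_singleton _).compl, restrict_compl_singleton]
    _ = ∫⁻ p, f (p.2.1 • p.1.1) ∂(volume : Measure PolarSpace).toSphere.prod (.volumeIoiPow 5) := by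
        have h := (volume : Measure PolarSpace).measurePreserving_homeomorphUnitSphereProd
        rw [hfr] at h
        rw [← h.lintegral_comp (by fun_prop)]
        refine lintegral_congr fun x => ?_
        congr 1
        simp only [homeomorphUnitSphereProd_apply_snd_coe, homeomorphUnitSphereProd_apply_fst_coe]
        rw [smul_smul, mul_inv_cancel₀ (norm_ne_zero_iff.2 x.2), one_smul]
    _ = _ := by
        rw [lintegral_prod _ (by fun_prop)]
        refine lintegral_congr fun ξ => ?_
        rw [Measure.volumeIoiPow, lintegral_withDensity_eq_lintegral_mul _ (by fun_prop) (by fun_prop)]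
        exact lintegral_subtype_comap measurableSet_Ioi
          (fun ρ : ℝ => ENNReal.ofReal (ρ ^ 5) * f (ρ • ξ.1))

theorem lintegral_pow_mul_exp_neg_half_sq (n : ℕ) :
    ∫⁻ ρ in Set.Ioi (0 : ℝ), ENNReal.ofReal (ρ ^ n * Real.exp (-(1 / 2) * ρ ^ 2)) =
      ENNReal.ofReal ((1 / 2 : ℝ) ^ (-((n : ℝ) + 1) / 2) * (1 / 2) * Real.Gamma (((n : ℝ) + 1) / 2)) := by
  rw [← integral_pow_mul_exp_neg_half_sq, ofReal_integral_eq_lintegral_ofReal]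
  · have h := integrableOn_rpow_mul_exp_neg_mul_sq (b := 1 / 2) (by norm_num) (s := n)
      (by have : (0 : ℝ) ≤ n := n.cast_nonneg
          linarith)
    simp only [Real.rpow_natCast] at h
    exact h
  · exact ae_restrict_of_forall_mem measurableSet_Ioi fun x hx => by
      have : (0 : ℝ) < x := hx
      positivity

theorem lintegral_pow_five_mul_exp :
    ∫⁻ ρ in Set.Ioi (0 : ℝ), ENNReal.ofReal (ρ ^ 5 * Real.exp (-(1 / 2) * ρ ^ 2)) = 8 := by
  rw [lintegral_pow_mul_exp_neg_half_sq, show (((5 : ℕ) : ℝ) + 1) / 2 = (2 : ℕ) + 1 by norm_num,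
    show -(((5 : ℕ) : ℝ) + 1) / 2 = ((-3 : ℤ) : ℝ) by norm_num, Real.Gamma_nat_eq_factorial,
    Real.rpow_intCast]
  norm_num [Nat.factorial]

theorem lintegral_pow_nine_mul_exp :
    ∫⁻ ρ in Set.Ioi (0 : ℝ), ENNReal.ofReal (ρ ^ 9 * Real.exp (-(1 / 2) * ρ ^ 2)) = 384 := by
  rw [lintegral_pow_mul_exp_neg_half_sq, show (((9 : ℕ) : ℝ) + 1) / 2 = (4 : ℕ) + 1 by norm_num,
    show -(((9 : ℕ) : ℝ) + 1) / 2 = ((-5 : ℤ) : ℝ) by norm_num, Real.Gamma_nat_eq_factorial,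
    Real.rpow_intCast]
  norm_num [Nat.factorial]

/-! ### The Gamma(3) hinge and its curvature -/

/-- `E (U y - t)₊` for a variable `U` of law `Gamma(3)`. -/
def gammaHinge (t y : ℝ) : ℝ := Real.exp (-(t / y)) * (3 * y + 2 * t + t ^ 2 / (2 * y))

theorem gammaHinge_nonneg {t y : ℝ} (ht : 0 ≤ t) (hy : 0 < y) : 0 ≤ gammaHinge t y := by
  unfold gammaHinge
  positivity

/-- Under the radial weight, `ρ² / 2` has the law Gamma(3) up to the total mass 8, which is the
factor on the right. -/
theorem lintegral_radial_hinge {t y : ℝ} (ht : 0 < t) (hy : 0 < y) :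
    ∫⁻ ρ in Set.Ioi (0 : ℝ), ENNReal.ofReal (ρ ^ 5) *
      (ENNReal.ofReal (Real.exp (-(1 / 2) * ρ ^ 2)) * ENNReal.ofReal (1 / 2 * ρ ^ 2 * y - t)) =
      ENNReal.ofReal (8 * gammaHinge t y) := by
  set ρ₀ := Real.sqrt (2 * (t / y)) with hρ₀
  have hρ₀0 : 0 ≤ ρ₀ := Real.sqrt_nonneg _
  have hρ₀2 : ρ₀ ^ 2 = 2 * (t / y) := Real.sq_sqrt (by positivity)
  set g : ℝ → ℝ := fun ρ => ρ ^ 5 * (Real.exp (-(1 / 2) * ρ ^ 2) * (1 / 2 * ρ ^ 2 * y - t)) with hg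
  -- An explicit primitive of `g`, polynomial times exponential in `ρ² / 2`. The lower limit `ρ₀` is
  -- the radius at which the hinge becomes active.
  set F : ℝ → ℝ := fun ρ => -4 * Real.exp (-(1 / 2) * ρ ^ 2) *
    (y * ((ρ ^ 2 / 2) ^ 3 + 3 * (ρ ^ 2 / 2) ^ 2 + 6 * (ρ ^ 2 / 2) + 6) -
      t * ((ρ ^ 2 / 2) ^ 2 + 2 * (ρ ^ 2 / 2) + 2)) with hF
  have hder : ∀ ρ, HasDerivAt F (g ρ) ρ := by
    intro ρ
    have h1 : HasDerivAt (fun ρ : ℝ => -(1 / 2) * ρ ^ 2) (-ρ) ρ := by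
      exact ((hasDerivAt_pow 2 ρ).const_mul (-(1 / 2) : ℝ)).congr_deriv (by norm_num; ring)
    have h2 : HasDerivAt (fun ρ : ℝ => ρ ^ 2 / 2) ρ ρ := by
      exact ((hasDerivAt_pow 2 ρ).div_const (2 : ℝ)).congr_deriv (by norm_num)
    have h3 := ((h1.exp.const_mul (-4)).mul
      (((((((h2.pow 3).add ((h2.pow 2).const_mul 3)).add (h2.const_mul 6)).add_const 6).const_mul y)).sub
        (((((h2.pow 2).add (h2.const_mul 2)).add_const 2).const_mul t))))
    refine h3.congr_deriv ?_
    simp only [hg, Pi.add_apply, Pi.pow_apply]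
    norm_num
    ring
  have hlim : Filter.Tendsto F Filter.atTop (nhds 0) := by
    have hu : Filter.Tendsto (fun ρ : ℝ => ρ ^ 2 / 2) Filter.atTop Filter.atTop :=
      (Filter.tendsto_pow_atTop two_ne_zero).atTop_div_const two_pos
    have hk : ∀ k : ℕ, Filter.Tendsto (fun ρ : ℝ => (ρ ^ 2 / 2) ^ k * Real.exp (-(ρ ^ 2 / 2)))
        Filter.atTop (nhds 0) := fun k =>
      (Real.tendsto_pow_mul_exp_neg_atTop_nhds_zero k).comp hu
    have := ((((hk 3).add ((hk 2).const_mul 3)).add ((hk 1).const_mul 6)).add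
      ((hk 0).const_mul 6)).const_mul (-4 * y)
    have h' := (((hk 2).add ((hk 1).const_mul 2)).add ((hk 0).const_mul 2)).const_mul (4 * t)
    have h'' := this.add h'
    simp only [mul_zero, add_zero] at h''
    refine h''.congr fun ρ => ?_
    simp only [hF]
    rw [show -(1 / 2) * ρ ^ 2 = -(ρ ^ 2 / 2) by ring]
    ring
  have hpos : ∀ ρ ∈ Set.Ioi ρ₀, 0 ≤ g ρ := by
    intro ρ hρ
    have h0 : ρ₀ < ρ := hρ
    have h1 : ρ₀ ^ 2 < ρ ^ 2 := by gcongr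
    rw [hρ₀2] at h1
    have h2 : t ≤ 1 / 2 * ρ ^ 2 * y := by
      have := mul_lt_mul_of_pos_right h1 hy
      rw [mul_assoc, div_mul_cancel₀ _ hy.ne'] at this
      linarith
    have h3 : 0 ≤ ρ := hρ₀0.trans h0.le
    exact mul_nonneg (by positivity) (mul_nonneg (Real.exp_pos _).le (by linarith))
  have hval : -F ρ₀ = 8 * gammaHinge t y := by
    simp only [hF, gammaHinge]
    rw [show -(1 / 2) * ρ₀ ^ 2 = -(ρ₀ ^ 2 / 2) by ring, hρ₀2,
      show 2 * (t / y) / 2 = t / y by ring]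
    field_simp
    ring
  have hI := integral_Ioi_of_hasDerivAt_of_nonneg' (fun x _ => hder x) hpos hlim
  have hIn := integrableOn_Ioi_deriv_of_nonneg' (fun x _ => hder x) hpos hlim
  calc _ = ∫⁻ ρ in Set.Ioi (0 : ℝ), (Set.Ioi ρ₀).indicator (fun ρ => ENNReal.ofReal (g ρ)) ρ := by
        refine setLIntegral_congr_fun measurableSet_Ioi fun ρ hρ => ?_
        have hρ' : (0 : ℝ) < ρ := hρ
        by_cases h : ρ ∈ Set.Ioi ρ₀
        · simp only [Set.indicator_of_mem h, hg]
          rw [← ENNReal.ofReal_mul (Real.exp_pos _).le, ← ENNReal.ofReal_mul (by positivity)]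
        · simp only [Set.indicator_of_notMem h]
          have h1 : ρ ^ 2 ≤ ρ₀ ^ 2 := by
            have : ρ ≤ ρ₀ := not_lt.1 h
            gcongr
          rw [hρ₀2] at h1
          have h2 : 1 / 2 * ρ ^ 2 * y ≤ t := by
            have := mul_le_mul_of_nonneg_right h1 hy.le
            rw [mul_assoc 2, div_mul_cancel₀ _ hy.ne'] at this
            linarith
          rw [ENNReal.ofReal_of_nonpos (show 1 / 2 * ρ ^ 2 * y - t ≤ 0 by linarith), mul_zero, mul_zero]
    _ = ∫⁻ ρ in Set.Ioi ρ₀, ENNReal.ofReal (g ρ) := by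
        rw [lintegral_indicator measurableSet_Ioi, Measure.restrict_restrict measurableSet_Ioi,
          Set.inter_eq_left.2 (Set.Ioi_subset_Ioi hρ₀0)]
    _ = ENNReal.ofReal (∫ ρ in Set.Ioi ρ₀, g ρ) := by
        rw [ofReal_integral_eq_lintegral_ofReal hIn (ae_restrict_of_forall_mem measurableSet_Ioi hpos)]
    _ = _ := by rw [hI, zero_sub, hval]

/-- The function peaks at `q = 5`; the bound is the fifth power of `q / 5 ≤ exp (q / 5 - 1)`. -/
theorem pow_five_mul_exp_neg_le {q : ℝ} (hq : 0 ≤ q) :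
    q ^ 5 * Real.exp (-q) ≤ 5 ^ 5 * Real.exp (-5) := by
  have h1 : q / 5 ≤ Real.exp (q / 5 - 1) := by
    have := Real.add_one_le_exp (q / 5 - 1)
    linarith
  have h2 : (q / 5) ^ 5 ≤ Real.exp (q - 5) := by
    calc (q / 5) ^ 5 ≤ Real.exp (q / 5 - 1) ^ 5 := by gcongr
      _ = Real.exp (q - 5) := by
        rw [← Real.exp_nat_mul]
        congr 1
        push_cast
        ring
  have h3 : q ^ 5 ≤ 5 ^ 5 * Real.exp (q - 5) := by
    rw [div_pow, div_le_iff₀ (by norm_num)] at h2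
    linarith
  calc q ^ 5 * Real.exp (-q) ≤ 5 ^ 5 * Real.exp (q - 5) * Real.exp (-q) := by gcongr
    _ = 5 ^ 5 * Real.exp (-5) := by
      rw [mul_assoc, ← Real.exp_add]
      congr 2
      ring

theorem pow_five_mul_exp_neg_anti {t q : ℝ} (ht : 5 ≤ t) (hq : t ≤ q) :
    q ^ 5 * Real.exp (-q) ≤ t ^ 5 * Real.exp (-t) := by
  have ht0 : 0 < t := by linarith
  have h1 : q / t ≤ Real.exp ((q - t) / 5) := by
    have h := Real.add_one_le_exp ((q - t) / 5)
    refine le_trans ?_ h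
    rw [div_le_iff₀ ht0]
    nlinarith
  have h2 : (q / t) ^ 5 ≤ Real.exp (q - t) := by
    calc (q / t) ^ 5 ≤ Real.exp ((q - t) / 5) ^ 5 := by
          have : 0 ≤ q / t := div_nonneg (by linarith) ht0.le
          gcongr
      _ = Real.exp (q - t) := by
        rw [← Real.exp_nat_mul]
        congr 1
        push_cast
        ring
  have h3 : q ^ 5 ≤ t ^ 5 * Real.exp (q - t) := by
    rw [div_pow, div_le_iff₀ (by positivity)] at h2
    linarith
  calc q ^ 5 * Real.exp (-q) ≤ t ^ 5 * Real.exp (q - t) * Real.exp (-q) := by gcongr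
    _ = t ^ 5 * Real.exp (-t) := by
      rw [mul_assoc, ← Real.exp_add]
      congr 2
      ring

theorem hasDerivAt_neg_div {t y : ℝ} (hy : y ≠ 0) :
    HasDerivAt (fun y => -(t / y)) (t / y ^ 2) y := by
  have := ((hasDerivAt_inv hy).const_mul t).neg
  refine this.congr_deriv ?_
  field_simp

def gammaHingeDeriv (t y : ℝ) : ℝ :=
  Real.exp (-(t / y)) * (3 + 3 * (t / y) + 3 / 2 * (t / y) ^ 2 + 1 / 2 * (t / y) ^ 3)

theorem hasDerivAt_gammaHinge {t y : ℝ} (hy : y ≠ 0) :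
    HasDerivAt (gammaHinge t) (gammaHingeDeriv t y) y := by
  have h1 := (hasDerivAt_neg_div (t := t) hy).exp
  have h2 : HasDerivAt (fun y => 3 * y + 2 * t + t ^ 2 / (2 * y)) (3 - t ^ 2 / (2 * y ^ 2)) y := by
    have h3 := ((hasDerivAt_inv hy).const_mul (t ^ 2 / 2))
    have h4 := (((hasDerivAt_id y).const_mul 3).add_const (2 * t)).add h3
    refine (h4.congr_deriv ?_).congr_of_eventuallyEq (.of_forall fun z => ?_)
    · field_simp
      ring
    · simp only [id, Pi.add_apply, div_eq_mul_inv, mul_inv]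
      ring
  refine (h1.mul h2).congr_deriv ?_
  simp only [gammaHingeDeriv]
  field_simp
  ring

/-- The second derivative collapses to one term in `q = t / y`, governed by `q ^ 5 * exp (-q)`; this
makes the curvature easy to bound. -/
theorem hasDerivAt_gammaHingeDeriv {t y : ℝ} (ht : t ≠ 0) (hy : y ≠ 0) :
    HasDerivAt (gammaHingeDeriv t) ((t / y) ^ 5 * Real.exp (-(t / y)) / (2 * t)) y := by
  have h1 := (hasDerivAt_neg_div (t := t) hy).exp
  have h2 : HasDerivAt (fun y => t / y) (-(t / y ^ 2)) y := by
    exact (hasDerivAt_neg_div (t := t) hy).neg.congr_of_eventuallyEq (.of_forall fun y => by simp)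
  have h3 := (((h2.const_mul 3).const_add 3).add ((h2.pow 2).const_mul (3 / 2))).add
    ((h2.pow 3).const_mul (1 / 2))
  refine ((h1.mul h3).congr_deriv ?_)
  simp only [Pi.add_apply, Pi.pow_apply]
  norm_num
  field_simp
  ring

/-- The bound for the sum of the second derivatives of `gammaHinge t` at `1 + z` and `1 - z`. -/
def hingeCurv (t : ℝ) : ℝ := (t ^ 5 * Real.exp (-t) + 5 ^ 5 * Real.exp (-5)) / (2 * t)

/-- A second-order Taylor bound; the linear terms cancel by symmetry. For `z ≥ 0`, the curvature at
`1 + z` is controlled by the global maximum of `q ^ 5 * exp (-q)`. At `1 - z` one has `q ≥ t ≥ 5`,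
where that function decreases, so its value at `t` is enough. -/
theorem gammaHinge_add_le {t z : ℝ} (ht : 5 ≤ t) (hz : |z| < 1) :
    gammaHinge t (1 + z) + gammaHinge t (1 - z) ≤ 2 * gammaHinge t 1 + hingeCurv t / 2 * z ^ 2 := by
  wlog hz0 : 0 ≤ z generalizing z
  · have := this (z := -z) (by rwa [abs_neg]) (by linarith)
    rw [neg_sq] at this
    simpa only [← sub_eq_add_neg, sub_neg_eq_add, add_comm (gammaHinge t (1 - z))] using this
  have hz1 : z < 1 := (abs_lt.1 hz).2
  have ht0 : 0 < t := by linarith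
  set A := hingeCurv t with hA
  set G : ℝ → ℝ := fun z => A / 2 * z ^ 2 - gammaHinge t (1 + z) - gammaHinge t (1 - z) with hG
  set G1 : ℝ → ℝ := fun z => A * z - gammaHingeDeriv t (1 + z) + gammaHingeDeriv t (1 - z) with hG1
  have hd1 : ∀ x ∈ Set.Ico (0 : ℝ) 1, HasDerivAt G (G1 x) x := by
    intro x hx
    have ha := (hasDerivAt_gammaHinge (t := t) (y := 1 + x) (by linarith [hx.1])).comp x
      ((hasDerivAt_id x).const_add 1)
    have hb := (hasDerivAt_gammaHinge (t := t) (y := 1 - x) (by linarith [hx.2])).comp x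
      ((hasDerivAt_id x).const_sub 1)
    refine ((((hasDerivAt_pow 2 x).const_mul (A / 2)).sub ha).sub hb).congr_deriv ?_
    simp only [hG1]
    norm_num
    ring
  have hd2 : ∀ x ∈ Set.Ico (0 : ℝ) 1, HasDerivAt G1
      (A - (t / (1 + x)) ^ 5 * Real.exp (-(t / (1 + x))) / (2 * t) -
        (t / (1 - x)) ^ 5 * Real.exp (-(t / (1 - x))) / (2 * t)) x := by
    intro x hx
    have ha := (hasDerivAt_gammaHingeDeriv ht0.ne' (y := 1 + x) (by linarith [hx.1])).comp x
      ((hasDerivAt_id x).const_add 1)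
    have hb := (hasDerivAt_gammaHingeDeriv ht0.ne' (y := 1 - x) (by linarith [hx.2])).comp x
      ((hasDerivAt_id x).const_sub 1)
    refine ((((hasDerivAt_id x).const_mul A).sub ha).add hb).congr_deriv ?_
    ring
  have hconv : Convex ℝ (Set.Ico (0 : ℝ) 1) := convex_Ico 0 1
  have hint : ∀ x ∈ interior (Set.Ico (0 : ℝ) 1), x ∈ Set.Ico (0 : ℝ) 1 := fun x hx =>
    interior_subset hx
  -- The gap `G` has nonnegative second derivative and vanishing derivative at 0, so it is
  -- nondecreasing on `[0, 1)`.
  have hm1 : MonotoneOn G1 (Set.Ico 0 1) := by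
    refine monotoneOn_of_deriv_nonneg hconv (fun x hx => (hd2 x hx).continuousAt.continuousWithinAt)
      (fun x hx => (hd2 x (hint x hx)).differentiableAt.differentiableWithinAt) fun x hx => ?_
    have hx' := hint x hx
    rw [(hd2 x hx').deriv]
    have h1 := pow_five_mul_exp_neg_le (q := t / (1 + x)) (div_nonneg ht0.le (by linarith [hx'.1]))
    have h2 := pow_five_mul_exp_neg_anti (q := t / (1 - x)) ht (by
      rw [le_div_iff₀ (by linarith [hx'.2])]
      nlinarith [hx'.1])
    rw [hA, hingeCurv, ← sub_div, ← sub_div]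
    exact div_nonneg (by linarith) (by linarith)
  have hG10 : G1 0 = 0 := by simp [hG1]
  have hm : MonotoneOn G (Set.Ico 0 1) := by
    refine monotoneOn_of_deriv_nonneg hconv (fun x hx => (hd1 x hx).continuousAt.continuousWithinAt)
      (fun x hx => (hd1 x (hint x hx)).differentiableAt.differentiableWithinAt) fun x hx => ?_
    have hx' := hint x hx
    rw [(hd1 x hx').deriv, ← hG10]
    exact hm1 ⟨le_rfl, one_pos⟩ hx' hx'.1
  have := hm ⟨le_rfl, one_pos⟩ ⟨hz0, hz1⟩ hz0
  simp only [hG, add_zero, sub_zero] at this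
  linarith

theorem hingeCurv_nonneg {t : ℝ} (ht : 0 ≤ t) : 0 ≤ hingeCurv t := by
  unfold hingeCurv
  positivity

/-! ### Moments on the sphere and the mean excess -/

/-- The quadratic form `‖re‖² - ‖im‖²`. -/
def signedSq (x : Fin 3 × Bool → ℝ) : ℝ := ∑ n, (x (n, true) ^ 2 - x (n, false) ^ 2)

/-- Six independent centred terms, each of variance `Var (x²) = 2`. -/
theorem lintegral_signedSq_sq :
    ∫⁻ x, ENNReal.ofReal (signedSq x ^ 2) ∂(Measure.pi fun _ => gaussianReal 0 1) = 12 := by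
  set X : Fin 3 × Bool → ℝ → ℝ := fun i x => (if i.2 then 1 else -1) * x ^ 2 with hX
  have hL : ∀ i, MemLp (X i) 2 (gaussianReal 0 1) := by
    intro i
    refine MemLp.const_mul ?_ _
    rw [memLp_two_iff_integrable_sq (by fun_prop)]
    simpa only [← pow_mul] using integrable_pow_gaussianReal 4 1
  have hv := variance_sum_pi (μ := fun _ : Fin 3 × Bool => gaussianReal 0 1) hL
  have hs : (∑ i, fun ω : Fin 3 × Bool → ℝ => X i (ω i)) = signedSq := by
    ext ω
    simp [hX, signedSq, Fintype.sum_prod_type, sub_eq_add_neg]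
  have h2 : ∀ i, Var[X i; gaussianReal 0 1] = 2 := by
    intro i
    rw [hX, variance_const_mul, variance_sq_gaussianReal]
    split_ifs <;> norm_num
  rw [hs] at hv
  simp only [h2, Finset.sum_const, Finset.card_univ, Fintype.card_prod, Fintype.card_fin,
    Fintype.card_bool, nsmul_eq_mul] at hv
  have hint : ∀ i : Fin 3 × Bool, Integrable (fun ω : Fin 3 × Bool → ℝ => X i (ω i))
      (Measure.pi fun _ => gaussianReal 0 1) := fun i =>
    (measurePreserving_eval (fun _ : Fin 3 × Bool => gaussianReal 0 1) i).integrable_comp_of_integrable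
      ((hL i).integrable (by norm_num))
  have hL2 : MemLp signedSq 2 (Measure.pi fun _ => gaussianReal 0 1) := by
    rw [← hs]
    exact memLp_finsetSum' _ fun i _ => (hL i).comp_measurePreserving
      (measurePreserving_eval (fun _ : Fin 3 × Bool => gaussianReal 0 1) i)
  have h1 : ∫ x, x ^ 2 ∂(gaussianReal 0 1) = 1 := by
    have := variance_id_gaussianReal (μ := 0) (v := 1)
    rw [variance_eq_integral (by fun_prop)] at this
    simpa using this
  have hmean : ∫ x, signedSq x ∂(Measure.pi fun _ => gaussianReal 0 1) = 0 := by
    have h3 : ∀ i : Fin 3 × Bool, ∫ ω : Fin 3 × Bool → ℝ, X i (ω i)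
        ∂(Measure.pi fun _ => gaussianReal 0 1) = if i.2 then 1 else -1 := by
      intro i
      have h4 := integral_map (μ := Measure.pi fun _ : Fin 3 × Bool => gaussianReal 0 1)
        (φ := fun ω => ω i) (f := X i) (measurable_pi_apply i).aemeasurable (by
          rw [(measurePreserving_eval (fun _ : Fin 3 × Bool => gaussianReal 0 1) i).map_eq]
          exact (hL i).1)
      rw [← h4, (measurePreserving_eval (fun _ : Fin 3 × Bool => gaussianReal 0 1) i).map_eq, hX,
        integral_const_mul, h1, mul_one]
    rw [← hs]
    simp only [Finset.sum_apply]
    rw [integral_finsetSum _ fun i _ => hint i]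
    simp only [h3, Fintype.sum_prod_type]
    simp
  rw [variance_of_integral_eq_zero hL2.1.aemeasurable hmean] at hv
  rw [← ofReal_integral_eq_lintegral_ofReal hL2.integrable_sq (.of_forall fun x => sq_nonneg _), hv]
  norm_num

theorem map_comp_pi_gaussianReal {ι m : Type*} [Fintype ι] [Fintype m] {f : m → ι}
    (hf : Function.Injective f) :
    MeasurePreserving (fun (ω : ι → ℝ) j => ω (f j)) (Measure.pi fun _ : ι => gaussianReal 0 1)
      (Measure.pi fun _ : m => gaussianReal 0 1) := by
  classical
  refine ⟨by fun_prop, ?_⟩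
  have h := map_pi_gaussianReal_of_orthogonal (fun (j : m) (i : ι) => if i = f j then 1 else 0)
    (fun _ => 1) (fun j j' => by simp [hf.eq_iff, eq_comm])
  simpa using h

theorem measurable_signedSq : Measurable signedSq := by
  unfold signedSq
  fun_prop

theorem signedSq_smul (ρ : ℝ) (x : PolarSpace) :
    signedSq (ρ • x).ofLp = ρ ^ 2 * signedSq x.ofLp := by
  simp only [signedSq, Finset.mul_sum, PiLp.smul_apply, smul_eq_mul]
  exact Finset.sum_congr rfl fun n _ => by ring

theorem sum_sq_sphere (ξ : Metric.sphere (0 : PolarSpace) 1) : ∑ i, ξ.1 i ^ 2 = 1 := by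
  have h : ‖ξ.1‖ = 1 := by simp
  have h2 := EuclideanSpace.norm_sq_eq ξ.1
  rw [h] at h2
  simpa using h2.symm

theorem abs_signedSq_le (x : Fin 3 × Bool → ℝ) : |signedSq x| ≤ ∑ i, x i ^ 2 := by
  rw [signedSq, Fintype.sum_prod_type]
  refine (Finset.abs_sum_le_sum_abs _ _).trans (Finset.sum_le_sum fun n _ => ?_)
  rw [Fintype.sum_bool, abs_le]
  constructor <;> nlinarith [sq_nonneg (x (n, true)), sq_nonneg (x (n, false))]

theorem lintegral_pi_gaussian_polar {f : (Fin 3 × Bool → ℝ) → ℝ≥0∞} (hf : Measurable f) :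
    ∫⁻ x, f x ∂(Measure.pi fun _ => gaussianReal 0 1) =
      ENNReal.ofReal ((2 * Real.pi) ^ 3)⁻¹ * ∫⁻ ξ, (∫⁻ ρ in Set.Ioi (0 : ℝ),
        ENNReal.ofReal (ρ ^ 5) * (ENNReal.ofReal (Real.exp (-(1 / 2) * ρ ^ 2)) *
          f (ρ • (ξ.1 : PolarSpace)).ofLp)) ∂((volume : Measure PolarSpace).toSphere) := by
  have hf' : Measurable fun x : PolarSpace => f x.ofLp := hf.comp (by fun_prop)
  have hofLp : Measurable (WithLp.toLp 2 : (Fin 3 × Bool → ℝ) → PolarSpace) := by fun_prop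
  have h1 : ∫⁻ x, f x ∂(Measure.pi fun _ => gaussianReal 0 1) =
      ∫⁻ x : PolarSpace, f x.ofLp ∂(stdGaussian PolarSpace) := by
    rw [← map_pi_eq_stdGaussian, lintegral_map hf' hofLp]
  have hc : ENNReal.ofReal ((2 * Real.pi) ^ 3)⁻¹ ≠ ∞ := ENNReal.ofReal_ne_top
  rw [h1, stdGaussian_polarSpace_eq_withDensity,
    lintegral_withDensity_eq_lintegral_mul _ (by fun_prop) hf',
    lintegral_polar ((by fun_prop : Measurable _).mul hf'), ← lintegral_const_mul' _ _ hc]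
  refine lintegral_congr fun ξ => ?_
  rw [← lintegral_const_mul' _ _ hc]
  refine setLIntegral_congr_fun measurableSet_Ioi fun ρ hρ => ?_
  have hρ' : (0 : ℝ) < ρ := hρ
  have hn : ‖ρ • ξ.1‖ = ρ := by
    have h : ‖ξ.1‖ = 1 := by simp
    rw [norm_smul, h, mul_one, Real.norm_of_nonneg hρ'.le]
  simp only [Pi.mul_apply, hn]
  rw [ENNReal.ofReal_mul (by positivity)]
  ring

/-- The polar formula for the constant 1 gives the normalisation, so the area of the sphere is never
computed. -/
theorem sphere_mass :
    ENNReal.ofReal ((2 * Real.pi) ^ 3)⁻¹ * (volume : Measure PolarSpace).toSphere Set.univ =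
      ENNReal.ofReal (1 / 8) := by
  have h := lintegral_pi_gaussian_polar (f := fun _ => 1) measurable_const
  have h2 : ∫⁻ ρ in Set.Ioi (0 : ℝ), ENNReal.ofReal (ρ ^ 5) *
      (ENNReal.ofReal (Real.exp (-(1 / 2) * ρ ^ 2)) * 1) = 8 := by
    rw [← lintegral_pow_five_mul_exp]
    refine setLIntegral_congr_fun measurableSet_Ioi fun ρ hρ => ?_
    have hρ' : (0 : ℝ) < ρ := hρ
    simp only [mul_one]
    rw [ENNReal.ofReal_mul (by positivity)]
  rw [lintegral_congr fun _ => h2] at h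
  simp only [lintegral_const, measure_univ, mul_one] at h
  have h8 : ENNReal.ofReal (1 / 8) = 8⁻¹ := by
    rw [one_div, ENNReal.ofReal_inv_of_pos (x := 8) (by norm_num), ENNReal.ofReal_ofNat]
  rw [h8]
  refine ENNReal.eq_inv_of_mul_eq_one_left ?_
  rw [h]
  ring

/-- Read off from the Gaussian second moment 12: homogeneity of degree four turns the radial weight
into `ρ ^ 9`, whose integral is 384. -/
theorem sphere_second_moment :
    ENNReal.ofReal ((2 * Real.pi) ^ 3)⁻¹ *
      ∫⁻ ξ, ENNReal.ofReal (signedSq ξ.1.ofLp ^ 2) ∂(volume : Measure PolarSpace).toSphere =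
      ENNReal.ofReal (1 / 32) := by
  have h := lintegral_pi_gaussian_polar (f := fun x => ENNReal.ofReal (signedSq x ^ 2))
    (by have := measurable_signedSq
        fun_prop)
  rw [lintegral_signedSq_sq] at h
  have h2 : ∀ ξ : Metric.sphere (0 : PolarSpace) 1, ∫⁻ ρ in Set.Ioi (0 : ℝ), ENNReal.ofReal (ρ ^ 5) *
      (ENNReal.ofReal (Real.exp (-(1 / 2) * ρ ^ 2)) *
        ENNReal.ofReal (signedSq (ρ • (ξ.1 : PolarSpace)).ofLp ^ 2)) =
      384 * ENNReal.ofReal (signedSq ξ.1.ofLp ^ 2) := by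
    intro ξ
    rw [← lintegral_pow_nine_mul_exp, ← lintegral_mul_const' _ _ ENNReal.ofReal_ne_top]
    refine setLIntegral_congr_fun measurableSet_Ioi fun ρ hρ => ?_
    have hρ' : (0 : ℝ) < ρ := hρ
    simp only [signedSq_smul]
    rw [← ENNReal.ofReal_mul (by positivity), ← ENNReal.ofReal_mul (by positivity),
      ← ENNReal.ofReal_mul (by positivity)]
    congr 1
    ring
  simp only [h2] at h
  rw [lintegral_const_mul' _ _ (by norm_num)] at h
  rw [show (1 / 32 : ℝ) = (384)⁻¹ * 12 by norm_num, ENNReal.ofReal_mul (by norm_num),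
    ENNReal.ofReal_inv_of_pos (x := 384) (by norm_num), show ENNReal.ofReal 12 = 12 by simp,
    show ENNReal.ofReal 384 = 384 by simp, h, mul_left_comm, ← mul_assoc (384⁻¹ : ℝ≥0∞),
    ENNReal.inv_mul_cancel (by norm_num) (by norm_num), one_mul]

/-- The mean excess over `t` of half the squared norm of three complex Gaussians whose
pseudo-variance has the modulus `r`. -/
theorem lintegral_hinge_le {r t : ℝ} (hr0 : 0 ≤ r) (hr : r < 1) (ht : 5 ≤ t) :
    ∫⁻ x, ENNReal.ofReal (1 / 2 * (∑ i, x i ^ 2 + r * signedSq x) - t)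
        ∂(Measure.pi fun _ => gaussianReal 0 1) ≤
      ENNReal.ofReal (gammaHinge t 1 + hingeCurv t / 16 * r ^ 2) := by
  have ht0 : 0 < t := by linarith
  have hms := measurable_signedSq
  set Φ : ℝ → ℝ≥0∞ := fun r =>
    ∫⁻ x, ENNReal.ofReal (1 / 2 * (∑ i, x i ^ 2 + r * signedSq x) - t)
        ∂(Measure.pi fun _ => gaussianReal 0 1) with hΦ
  have hf : ∀ r : ℝ, Measurable fun x : Fin 3 × Bool → ℝ =>
      ENNReal.ofReal (1 / 2 * (∑ i, x i ^ 2 + r * signedSq x) - t) := fun r => by fun_prop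
  -- Exchanging real and imaginary parts negates `signedSq`; averaging over `r` and `-r` therefore
  -- loses nothing and removes the first-order term.
  have hsymm : Φ (-r) = Φ r := by
    have hinj : Function.Injective fun i : Fin 3 × Bool => (i.1, !i.2) := by
      rintro ⟨a, b⟩ ⟨c, d⟩ h
      simpa using h
    simp only [hΦ]
    rw [← (map_comp_pi_gaussianReal hinj).lintegral_comp (hf (-r))]
    refine lintegral_congr fun x => ?_
    congr 3
    simp only [signedSq, Fintype.sum_prod_type, Fintype.sum_bool, Bool.not_true, Bool.not_false,
      Fin.sum_univ_three]
    ring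
  -- Along a fixed direction `ξ` the excess is a Gamma(3) hinge with scale `1 + s * signedSq ξ`,
  -- which is positive because `|signedSq ξ| ≤ 1` on the sphere.
  have h8 : ∀ (s : ℝ), |s| < 1 → ∀ ξ : Metric.sphere (0 : PolarSpace) 1,
      ∫⁻ ρ in Set.Ioi (0 : ℝ), ENNReal.ofReal (ρ ^ 5) *
        (ENNReal.ofReal (Real.exp (-(1 / 2) * ρ ^ 2)) * ENNReal.ofReal
          (1 / 2 * (∑ i, (ρ • (ξ.1 : PolarSpace)).ofLp i ^ 2 +
            s * signedSq (ρ • (ξ.1 : PolarSpace)).ofLp) - t)) =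
      ENNReal.ofReal (8 * gammaHinge t (1 + s * signedSq ξ.1.ofLp)) ∧
      |s * signedSq ξ.1.ofLp| < 1 := by
    intro s hs ξ
    have hw : |signedSq ξ.1.ofLp| ≤ 1 := (abs_signedSq_le _).trans_eq (sum_sq_sphere ξ)
    have hsw : |s * signedSq ξ.1.ofLp| < 1 := by
      rw [abs_mul]
      exact (mul_le_of_le_one_right (abs_nonneg _) hw).trans_lt hs
    refine ⟨?_, hsw⟩
    rw [← lintegral_radial_hinge ht0 (by linarith [(abs_lt.1 hsw).1])]
    refine lintegral_congr fun ρ => ?_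
    rw [signedSq_smul]
    congr 4
    have : ∑ i, (ρ • (ξ.1 : PolarSpace)).ofLp i ^ 2 = ρ ^ 2 := by
      simp only [PiLp.smul_apply, smul_eq_mul, mul_pow]
      rw [← Finset.mul_sum, sum_sq_sphere, mul_one]
    rw [this]
    ring
  have hr1 : |r| < 1 := by rwa [abs_of_nonneg hr0]
  have hr2 : |(-r)| < 1 := by rwa [abs_neg]
  have hA := hingeCurv_nonneg ht0.le
  have hH := gammaHinge_nonneg ht0.le one_pos
  have h2 : Φ r + Φ (-r) ≤ ENNReal.ofReal (2 * (gammaHinge t 1 + hingeCurv t / 16 * r ^ 2)) := by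
    simp only [hΦ]
    rw [lintegral_pi_gaussian_polar (hf r), lintegral_pi_gaussian_polar (hf (-r)), ← mul_add]
    simp only [(h8 r hr1 _).1, (h8 (-r) hr2 _).1]
    have hmH : Measurable (gammaHinge t) := by
      unfold gammaHinge
      fun_prop
    have hms' : Measurable fun ξ : Metric.sphere (0 : PolarSpace) 1 => signedSq ξ.1.ofLp :=
      hms.comp (by fun_prop)
    rw [← lintegral_add_left (by fun_prop)]
    calc _ ≤ ENNReal.ofReal ((2 * Real.pi) ^ 3)⁻¹ * ∫⁻ ξ : Metric.sphere (0 : PolarSpace) 1,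
          (ENNReal.ofReal (16 * gammaHinge t 1) + ENNReal.ofReal (4 * hingeCurv t * r ^ 2) *
            ENNReal.ofReal (signedSq ξ.1.ofLp ^ 2)) ∂(volume : Measure PolarSpace).toSphere := by
          refine mul_le_mul_right (lintegral_mono fun ξ => ?_) _
          have hb := gammaHinge_add_le ht (h8 r hr1 ξ).2
          have hlt := abs_lt.1 (h8 r hr1 ξ).2
          have hp := gammaHinge_nonneg ht0.le (y := 1 + r * signedSq ξ.1.ofLp) (by linarith)
          have hm := gammaHinge_nonneg ht0.le (y := 1 + -r * signedSq ξ.1.ofLp) (by linarith)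
          rw [← ENNReal.ofReal_mul (by positivity), ← ENNReal.ofReal_add (by positivity) (by positivity),
            ← ENNReal.ofReal_add (by positivity) (by positivity)]
          refine ENNReal.ofReal_le_ofReal ?_
          rw [show 1 + -r * signedSq ξ.1.ofLp = 1 - r * signedSq ξ.1.ofLp by ring]
          nlinarith
      _ = ENNReal.ofReal (16 * gammaHinge t 1) * ENNReal.ofReal (1 / 8) +
            ENNReal.ofReal (4 * hingeCurv t * r ^ 2) * ENNReal.ofReal (1 / 32) := by
          rw [lintegral_add_left measurable_const, lintegral_const,
            lintegral_const_mul' _ _ ENNReal.ofReal_ne_top, ← sphere_mass, ← sphere_second_moment]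
          ring
      _ = _ := by
          rw [← ENNReal.ofReal_mul (by positivity), ← ENNReal.ofReal_mul (by positivity),
            ← ENNReal.ofReal_add (by positivity) (by positivity)]
          congr 1
          ring
  rw [hsymm, ← two_mul, ENNReal.ofReal_mul zero_le_two, ENNReal.ofReal_ofNat] at h2
  exact (ENNReal.mul_le_mul_iff_right (by norm_num) (by norm_num)).1 h2

/-! ### Point values dominated by local averages -/

/-- The angle `π (k - c) / (2 P)` of the `k`-th frequency, `c` the centre of the spectrum. -/
def centredAngle (P : ℕ) (k : Fin P) : ℝ := Real.pi * (2 * (k : ℕ) + 1 - P) / (4 * P)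

/-- The factor that undoes the average over a box of width `1 / (2 P)`. -/
def sincWeight (P : ℕ) (k : Fin P) : ℝ := (Real.sinc (centredAngle P k))⁻¹

theorem centredAngle_sq_le {P : ℕ} (k : Fin P) : centredAngle P k ^ 2 ≤ 0.616857 := by
  have hk : ((k : ℕ) : ℝ) + 1 ≤ P := by exact_mod_cast k.2
  have hk0 : (0 : ℝ) ≤ (k : ℕ) := Nat.cast_nonneg _
  have hP : (0 : ℝ) < P := by linarith
  have h1 : ((2 * (k : ℕ) + 1 - P : ℝ) / P) ^ 2 ≤ 1 := by
    rw [sq_le_one_iff_abs_le_one, abs_div, abs_of_pos hP, div_le_one hP, abs_le]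
    constructor <;> linarith
  have h2 : centredAngle P k ^ 2 = Real.pi ^ 2 / 16 * ((2 * (k : ℕ) + 1 - P : ℝ) / P) ^ 2 := by
    rw [centredAngle]
    field_simp
    ring
  have h3 : Real.pi ^ 2 ≤ 9.8697 := by nlinarith [Real.pi_lt_d6, Real.pi_pos]
  rw [h2]
  calc _ ≤ Real.pi ^ 2 / 16 * 1 := by gcongr
    _ ≤ _ := by linarith

theorem one_sub_le_sinc (y : ℝ) : 1 - y ^ 2 / 6 ≤ Real.sinc y := by
  have key : ∀ y : ℝ, 0 < y → 1 - y ^ 2 / 6 ≤ Real.sinc y := by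
    intro y hy
    rw [Real.sinc_of_ne_zero hy.ne', le_div_iff₀ hy]
    have := Real.sin_gt_sub_cube hy
    nlinarith
  rcases lt_trichotomy y 0 with h | h | h
  · have := key (-y) (by linarith)
    rwa [Real.sinc_neg, neg_sq] at this
  · simp [h]
  · exact key y h

theorem sinc_centredAngle_pos {P : ℕ} (k : Fin P) : 0 < Real.sinc (centredAngle P k) := by
  have := one_sub_le_sinc (centredAngle P k)
  have := centredAngle_sq_le k
  linarith

theorem sincWeight_pos {P : ℕ} (k : Fin P) : 0 < sincWeight P k :=
  inv_pos.2 (sinc_centredAngle_pos k)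

/-- From `sinc y ≥ 1 - y² / 6`, with `(1 - z)⁻²` replaced by a linear function of `z = y² / 6` on
the range of the centred angles. -/
theorem sincWeight_sq_le {P : ℕ} (k : Fin P) :
    sincWeight P k ^ 2 ≤ 1 + 2.36 / 6 * centredAngle P k ^ 2 := by
  have h1 := one_sub_le_sinc (centredAngle P k)
  have h2 := centredAngle_sq_le k
  have h3 := sinc_centredAngle_pos k
  set s := Real.sinc (centredAngle P k)
  set z := centredAngle P k ^ 2 / 6 with hz
  have hz0 : 0 ≤ z := by positivity
  have hz1 : z ≤ 0.1028095 := by linarith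
  have h4 : (1 - z) ^ 2 ≤ s ^ 2 := by
    have : 0 ≤ 1 - z := by linarith
    gcongr
  rw [sincWeight, inv_pow, inv_le_iff_one_le_mul₀ (by positivity)]
  rw [show 1 + 2.36 / 6 * centredAngle P k ^ 2 = 1 + 2.36 * z by rw [hz]; ring]
  have h5 : 1 ≤ (1 + 2.36 * z) * (1 - z) ^ 2 := by
    -- The product in `h5` is 1 plus `z` times this quadratic; the slope `2.36` just keeps it
    -- nonnegative up to `z = 0.1028095`.
    have h6 : 0 ≤ 0.36 - 3.72 * z + 2.36 * z ^ 2 := by nlinarith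
    nlinarith [mul_nonneg hz0 h6]
  exact h5.trans (mul_le_mul_of_nonneg_left h4 (by linarith))

/-- The sum has a closed form, `π² / 48 * (P - 1 / P)`, and `0.205619` is `π² / 48` rounded up. -/
theorem sum_centredAngle_sq_le (P : ℕ) : ∑ k, centredAngle P k ^ 2 ≤ 0.205619 * P := by
  rcases Nat.eq_zero_or_pos P with rfl | hP
  · simp
  have hP' : (0 : ℝ) < P := by exact_mod_cast hP
  have h1 : ∀ n : ℕ, ∑ k : Fin n, (2 * ((k : ℕ) : ℝ) + 1 - P) ^ 2 =
      (4 * (n : ℝ) ^ 3 - n) / 3 - 2 * P * n ^ 2 + n * P ^ 2 := by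
    intro n
    rw [Fin.sum_univ_eq_sum_range (fun k => (2 * (k : ℝ) + 1 - P) ^ 2) n]
    induction n with
    | zero => simp
    | succ n ih =>
      rw [Finset.sum_range_succ, ih]
      push_cast
      ring
  have h2 : ∑ k, centredAngle P k ^ 2 =
      Real.pi ^ 2 / (16 * P ^ 2) * ∑ k : Fin P, (2 * ((k : ℕ) : ℝ) + 1 - P) ^ 2 := by
    rw [Finset.mul_sum]
    refine Finset.sum_congr rfl fun k _ => ?_
    rw [centredAngle]
    field_simp
    ring
  have h3 : Real.pi ^ 2 ≤ 9.8697 := by nlinarith [Real.pi_lt_d6, Real.pi_pos]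
  rw [h2, h1]
  have h4 : Real.pi ^ 2 / (16 * P ^ 2) *
      ((4 * (P : ℝ) ^ 3 - P) / 3 - 2 * P * P ^ 2 + P * P ^ 2) =
      Real.pi ^ 2 / 48 * (P - 1 / P) := by
    field_simp
    ring
  rw [h4]
  have h5 : (P : ℝ) - 1 / P ≤ P := by
    have : (0 : ℝ) < 1 / P := by positivity
    linarith
  calc _ ≤ Real.pi ^ 2 / 48 * P := by gcongr
    _ ≤ _ := by nlinarith

theorem sum_sincWeight_sq_le (P : ℕ) : ∑ k, sincWeight P k ^ 2 ≤ 1.0809 * P := by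
  calc ∑ k, sincWeight P k ^ 2 ≤ ∑ k : Fin P, (1 + 2.36 / 6 * centredAngle P k ^ 2) :=
        Finset.sum_le_sum fun k _ => sincWeight_sq_le k
    _ = P + 2.36 / 6 * ∑ k, centredAngle P k ^ 2 := by
        rw [Finset.sum_add_distrib, ← Finset.mul_sum]
        simp
    _ ≤ _ := by
        have := sum_centredAngle_sq_le P
        have : (0 : ℝ) ≤ P := Nat.cast_nonneg _
        linarith

theorem sum_sincWeight_pow_four_le (P : ℕ) : ∑ k, sincWeight P k ^ 4 ≤ 1.1815 * P := by
  calc ∑ k, sincWeight P k ^ 4 ≤ ∑ k : Fin P, (1 + 0.8822 * centredAngle P k ^ 2) := by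
        refine Finset.sum_le_sum fun k _ => ?_
        have h1 := sincWeight_sq_le k
        have h2 := centredAngle_sq_le k
        have h3 : 0 ≤ centredAngle P k ^ 2 := sq_nonneg _
        calc sincWeight P k ^ 4 = (sincWeight P k ^ 2) ^ 2 := by ring
          _ ≤ (1 + 2.36 / 6 * centredAngle P k ^ 2) ^ 2 := by gcongr
          _ ≤ _ := by nlinarith
    _ = P + 0.8822 * ∑ k, centredAngle P k ^ 2 := by
        rw [Finset.sum_add_distrib, ← Finset.mul_sum]
        simp
    _ ≤ _ := by
        have := sum_centredAngle_sq_le P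
        have : (0 : ℝ) ≤ P := Nat.cast_nonneg _
        linarith

@[fun_prop]
theorem continuous_harmonicVec {P : ℕ} (k : Fin P) : Continuous fun θ => harmonicVec P θ k := by
  unfold harmonicVec
  fun_prop

theorem norm_harmonicVec {P : ℕ} (θ : ℝ) (k : Fin P) : ‖harmonicVec P θ k‖ = 1 := by
  rw [harmonicVec, show 2 * Real.pi * Complex.I * (θ * ((k : ℕ) + 1 : ℝ) : ℂ) =
    ((2 * Real.pi * (θ * ((k : ℕ) + 1)) : ℝ) : ℂ) * Complex.I by push_cast; ring]
  exact Complex.norm_exp_ofReal_mul_I _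

theorem harmonicVec_add_one {P : ℕ} (θ : ℝ) (k : Fin P) :
    harmonicVec P (θ + 1) k = harmonicVec P θ k := by
  rw [harmonicVec, harmonicVec, Complex.exp_eq_exp_iff_exists_int]
  refine ⟨(k : ℕ) + 1, ?_⟩
  push_cast
  ring

theorem harmonicVec_add {P : ℕ} (θ s : ℝ) (k : Fin P) :
    harmonicVec P (θ + s) k = harmonicVec P θ k * harmonicVec P s k := by
  rw [harmonicVec, harmonicVec, harmonicVec, ← Complex.exp_add]
  congr 1
  push_cast
  ring

theorem integral_exp_symm (a δ : ℝ) (ha : a ≠ 0) :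
    ∫ s in (-δ)..δ, Complex.exp ((a * Complex.I) * s) = 2 * (Real.sin (a * δ) / a : ℝ) := by
  have hc : (a : ℂ) * Complex.I ≠ 0 := by simp [ha]
  rw [integral_exp_mul_complex hc]
  have h1 : Complex.exp ((a : ℂ) * Complex.I * (δ : ℝ)) - Complex.exp ((a : ℂ) * Complex.I * ((-δ : ℝ) : ℂ)) =
      2 * Complex.I * Complex.sin (a * δ) := by
    rw [Complex.sin]
    have h2 : (a : ℂ) * Complex.I * ((-δ : ℝ) : ℂ) = -(a * δ : ℂ) * Complex.I := by push_cast; ring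
    have h3 : (a : ℂ) * Complex.I * (δ : ℝ) = (a * δ : ℂ) * Complex.I := by ring
    rw [h2, h3]
    linear_combination (-Complex.exp (-(a * δ : ℂ) * Complex.I) +
      Complex.exp ((a * δ : ℂ) * Complex.I)) * Complex.I_sq
  rw [h1]
  have ha' : (a : ℂ) ≠ 0 := by exact_mod_cast ha
  push_cast
  field_simp

/-- The box average of a centred frequency. -/
theorem box_average_frequency {P : ℕ} (k : Fin P) :
    (2 * P : ℂ) * ∫ s in (-(1 / (4 * P) : ℝ))..(1 / (4 * P)),
      Complex.exp (-(Real.pi * (P + 1) : ℝ) * Complex.I * s) * harmonicVec P s k =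
    (sincWeight P k : ℂ)⁻¹ := by
  have hP : (0 : ℝ) < P := by exact_mod_cast k.pos
  have hPc : (P : ℂ) ≠ 0 := by exact_mod_cast hP.ne'
  -- The unimodular modulation subtracts the mean frequency `(P + 1) / 2`, keeping all angles within
  -- `π / 4`, where the sinc factor stays away from zero.
  set a : ℝ := Real.pi * (2 * (k : ℕ) + 1 - P) with ha
  have h1 : ∀ s : ℝ, Complex.exp (-(Real.pi * (P + 1) : ℝ) * Complex.I * s) * harmonicVec P s k =
      Complex.exp ((a * Complex.I) * s) := by
    intro s
    rw [harmonicVec, ← Complex.exp_add]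
    congr 1
    rw [ha]
    push_cast
    ring
  simp only [h1]
  have hca : centredAngle P k = a * (1 / (4 * P)) := by
    rw [centredAngle, ha]
    ring
  rw [sincWeight, Complex.ofReal_inv, inv_inv, hca]
  by_cases h0 : a = 0
  · simp only [h0, Complex.ofReal_zero, zero_mul, Complex.exp_zero, Real.sinc_zero]
    rw [intervalIntegral.integral_const]
    simp only [sub_neg_eq_add, Complex.real_smul]
    push_cast
    field_simp
    norm_num
  · have h4 : a * (1 / (4 * P)) ≠ 0 := mul_ne_zero h0 (by positivity)
    rw [integral_exp_symm a _ h0, Real.sinc_of_ne_zero h4]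
    have ha' : (a : ℂ) ≠ 0 := by exact_mod_cast h0
    push_cast
    field_simp
    norm_num

/-- After centring, a box average multiplies each frequency by its sinc factor, and the weights
cancel exactly that. The point value is thus a modulated average of the reweighted polynomial, and
Jensen gives the squares. -/
theorem norm_sq_le_box_average {P : ℕ} (hP : 1 ≤ P) (c : Fin P → ℂ) (θ : ℝ) :
    ‖∑ k, c k * harmonicVec P θ k‖ ^ 2 ≤ 2 * P * ∫ s in (-(1 / (4 * P) : ℝ))..(1 / (4 * P)),
      ‖∑ k, sincWeight P k * c k * harmonicVec P (θ + s) k‖ ^ 2 := by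
  have hP' : (0 : ℝ) < P := by exact_mod_cast hP
  set δ : ℝ := 1 / (4 * P) with hδ
  have hδ0 : 0 < δ := by positivity
  set f : ℝ → ℝ := fun s => ‖∑ k, sincWeight P k * c k * harmonicVec P (θ + s) k‖ with hf
  have hfc : Continuous f := by fun_prop
  have h1 : ∑ k, c k * harmonicVec P θ k = (2 * P : ℂ) * ∫ s in (-δ)..δ,
      Complex.exp (-(Real.pi * (P + 1) : ℝ) * Complex.I * s) *
        ∑ k, sincWeight P k * c k * harmonicVec P (θ + s) k := by
    simp only [Finset.mul_sum]
    rw [intervalIntegral.integral_finsetSum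
      (fun k _ => Continuous.intervalIntegrable (by fun_prop) _ _), Finset.mul_sum]
    refine Finset.sum_congr rfl fun k _ => ?_
    have h2 : ∀ s : ℝ, Complex.exp (-(Real.pi * (P + 1) : ℝ) * Complex.I * s) *
        (sincWeight P k * c k * harmonicVec P (θ + s) k) =
        (sincWeight P k * c k * harmonicVec P θ k) *
          (Complex.exp (-(Real.pi * (P + 1) : ℝ) * Complex.I * s) * harmonicVec P s k) := by
      intro s
      rw [harmonicVec_add]
      ring
    simp only [h2]
    rw [intervalIntegral.integral_const_mul, mul_left_comm, box_average_frequency]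
    have hw : (sincWeight P k : ℂ) ≠ 0 := by exact_mod_cast (sincWeight_pos k).ne'
    field_simp
  set a := ‖∑ k, c k * harmonicVec P θ k‖ with ha
  have h2 : a ≤ 2 * P * ∫ s in (-δ)..δ, f s := by
    rw [ha, h1, norm_mul]
    have h3 : ‖(2 * P : ℂ)‖ = 2 * P := by simp
    rw [h3]
    gcongr
    refine (intervalIntegral.norm_integral_le_integral_norm (by linarith)).trans (le_of_eq ?_)
    refine intervalIntegral.integral_congr fun s _ => ?_
    simp only [norm_mul, hf]
    rw [show (-(Real.pi * (P + 1) : ℝ) * Complex.I * s : ℂ) =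
      ((-(Real.pi * (P + 1)) * s : ℝ) : ℂ) * Complex.I by push_cast; ring,
      Complex.norm_exp_ofReal_mul_I, one_mul]
  -- Jensen for the square, by expanding around the point value `a`, which `h2` bounds by the mean
  -- of `f`.
  have h4 : 0 ≤ ∫ s in (-δ)..δ, (f s - a) ^ 2 :=
    intervalIntegral.integral_nonneg (by linarith) fun s _ => sq_nonneg _
  have h5 : ∫ s in (-δ)..δ, (f s - a) ^ 2 =
      (∫ s in (-δ)..δ, f s ^ 2) - 2 * a * (∫ s in (-δ)..δ, f s) + 2 * δ * a ^ 2 := by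
    have h6 : ∀ s, (f s - a) ^ 2 = f s ^ 2 - 2 * a * f s + a ^ 2 := fun s => by ring
    simp only [h6]
    rw [intervalIntegral.integral_add (Continuous.intervalIntegrable (by fun_prop) _ _)
      (Continuous.intervalIntegrable (by fun_prop) _ _),
      intervalIntegral.integral_sub (Continuous.intervalIntegrable (by fun_prop) _ _)
      (Continuous.intervalIntegrable (by fun_prop) _ _), intervalIntegral.integral_const_mul,
      intervalIntegral.integral_const]
    simp only [smul_eq_mul]
    ring
  rw [h5] at h4
  have h7 : 2 * P * (2 * δ) = 1 := by
    rw [hδ]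
    field_simp
    norm_num
  have h8 := mul_nonneg (by positivity : (0 : ℝ) ≤ 2 * P) h4
  have h9 := mul_le_mul_of_nonneg_left h2 (norm_nonneg _ : 0 ≤ a)
  nlinarith

/-- The box average is normalised, so the threshold can be moved inside it. Positive parts then
allow the box to be enlarged to a full period, which makes the bound independent of `θ`. -/
theorem ofReal_excess_le_lintegral {P : ℕ} (hP : 1 ≤ P) {m : Type*} [Fintype m]
    (c : m → Fin P → ℂ) (θ T : ℝ) :
    ENNReal.ofReal (∑ n, ‖∑ k, c n k * harmonicVec P θ k‖ ^ 2 - T) ≤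
      ENNReal.ofReal (2 * P) * ∫⁻ u in Set.Ioc (0 : ℝ) 1,
        ENNReal.ofReal (∑ n, ‖∑ k, sincWeight P k * c n k * harmonicVec P u k‖ ^ 2 - T) := by
  have hP' : (0 : ℝ) < P := by exact_mod_cast hP
  have hP1 : (1 : ℝ) ≤ P := by exact_mod_cast hP
  set δ : ℝ := 1 / (4 * P) with hδ
  have hδ0 : 0 < δ := by positivity
  have hδ1 : δ ≤ 1 / 2 := by
    rw [hδ]
    gcongr
    linarith
  set Φ : ℝ → ℝ := fun u => ∑ n, ‖∑ k, sincWeight P k * c n k * harmonicVec P u k‖ ^ 2 with hΦ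
  have hΦc : Continuous Φ := by fun_prop
  set Ψ : ℝ → ℝ := fun u => max (Φ u - T) 0 with hΨ
  have hΨc : Continuous Ψ := by fun_prop
  have hΨp : Function.Periodic Ψ 1 := by
    intro u
    simp only [hΨ, hΦ, harmonicVec_add_one]
  have h7 : 2 * P * (2 * δ) = 1 := by
    rw [hδ]
    field_simp
    norm_num
  have h1 : ∑ n, ‖∑ k, c n k * harmonicVec P θ k‖ ^ 2 ≤ 2 * P * ∫ s in (-δ)..δ, Φ (θ + s) := by
    simp only [hΦ]
    rw [intervalIntegral.integral_finsetSum
      (fun n _ => Continuous.intervalIntegrable (by fun_prop) _ _), Finset.mul_sum]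
    exact Finset.sum_le_sum fun n _ => norm_sq_le_box_average hP (c n) θ
  have h2 : ∑ n, ‖∑ k, c n k * harmonicVec P θ k‖ ^ 2 - T ≤ 2 * P * ∫ u in (0 : ℝ)..1, Ψ u := by
    calc _ ≤ 2 * P * (∫ s in (-δ)..δ, Φ (θ + s)) - 2 * P * (2 * δ) * T := by
          rw [h7]
          linarith
      _ = 2 * P * ∫ s in (-δ)..δ, (Φ (θ + s) - T) := by
          rw [intervalIntegral.integral_sub (Continuous.intervalIntegrable (by fun_prop) _ _)
            (Continuous.intervalIntegrable (by fun_prop) _ _), intervalIntegral.integral_const]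
          simp only [smul_eq_mul]
          ring
      _ ≤ 2 * P * ∫ s in (-δ)..δ, Ψ (θ + s) := by
          gcongr
          refine intervalIntegral.integral_mono_on (by linarith)
            (Continuous.intervalIntegrable (by fun_prop) _ _)
            (Continuous.intervalIntegrable (by fun_prop) _ _) fun s _ => le_max_left _ _
      _ = 2 * P * ∫ u in (θ + -δ)..(θ + δ), Ψ u := by
          rw [intervalIntegral.integral_comp_add_left (fun u => Ψ u) θ]
      -- The box half-width `δ` is at most `1 / 2`, so the box lies in one period.
      _ ≤ 2 * P * ∫ u in (θ - 1 / 2)..(θ - 1 / 2 + 1), Ψ u := by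
          gcongr
          refine intervalIntegral.integral_mono_interval (by linarith) (by linarith) (by linarith)
            (.of_forall fun u => le_max_right _ _) (hΨc.intervalIntegrable _ _)
      _ = 2 * P * ∫ u in (0 : ℝ)..1, Ψ u := by
          rw [hΨp.intervalIntegral_add_eq (θ - 1 / 2) 0, zero_add]
  refine (ENNReal.ofReal_le_ofReal h2).trans (le_of_eq ?_)
  rw [ENNReal.ofReal_mul (by positivity), intervalIntegral.integral_of_le zero_le_one,
    ofReal_integral_eq_lintegral_ofReal (hΨc.integrableOn_Ioc)
      (.of_forall fun u => le_max_right _ _)]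
  congr 1
  refine lintegral_congr fun u => ?_
  rw [hΨ, ENNReal.ofReal_max, ENNReal.ofReal_zero, max_eq_left zero_le]

/-! ### The excess of three complex Gaussian sums -/

/-- A rotation that makes the pseudo-variance of a complex vector real and nonnegative. -/
theorem exists_rotation {κ : Type*} [Fintype κ] (b : κ → ℂ) :
    ∃ η : ℂ, ‖η‖ = 1 ∧ ∑ k, (b k * η) ^ 2 = (‖∑ k, b k ^ 2‖ : ℝ) := by
  set ρ := ∑ k, b k ^ 2 with hρ
  refine ⟨Complex.exp ((-(Complex.arg ρ) / 2 : ℝ) * Complex.I), Complex.norm_exp_ofReal_mul_I _, ?_⟩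
  simp only [mul_pow, ← Finset.sum_mul]
  rw [← hρ, ← Complex.exp_nat_mul]
  have : (Complex.arg ρ : ℂ) * Complex.I + ((2 : ℕ) : ℂ) * ((-(Complex.arg ρ) / 2 : ℝ) * Complex.I) = 0 := by
    push_cast
    ring
  set E := ((2 : ℕ) : ℂ) * ((-(Complex.arg ρ) / 2 : ℝ) * Complex.I)
  calc ρ * Complex.exp E = ‖ρ‖ * Complex.exp (Complex.arg ρ * Complex.I) * Complex.exp E := by
        rw [Complex.norm_mul_exp_arg_mul_I]
    _ = ‖ρ‖ := by rw [mul_assoc, ← Complex.exp_add, this, Complex.exp_zero, mul_one]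

theorem pi_gaussianReal_eq_map {m : Type*} [Fintype m] (v : m → ℝ≥0) :
    (Measure.pi fun j => gaussianReal 0 (v j)) =
      (Measure.pi fun _ : m => gaussianReal 0 1).map (fun z j => Real.sqrt (v j) * z j) := by
  have h := Measure.pi_map_pi (μ := fun _ : m => gaussianReal 0 1)
    (f := fun j x => Real.sqrt (v j) * x) (fun j => by fun_prop)
  rw [h]
  congr 1
  ext1 j
  rw [gaussianReal_eq_map_sqrt (v j)]

/-- The mean excess of the squared norm of three independent copies of `∑ b k ω k`. -/
theorem lintegral_excess_le {κ : Type*} [Fintype κ] (b : κ → ℂ) {V t : ℝ}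
    (hV : ∑ k, ‖b k‖ ^ 2 < V) (ht : 5 ≤ t) :
    ∫⁻ ω, ENNReal.ofReal (∑ n, ‖∑ k, b k * (ω (n, k) : ℂ)‖ ^ 2 - t * V)
        ∂(Measure.pi fun _ : Fin 3 × κ => gaussianReal 0 1) ≤
      ENNReal.ofReal (V * gammaHinge t 1 + hingeCurv t / 16 * (‖∑ k, b k ^ 2‖ ^ 2 / V)) := by
  classical
  have hK0 : 0 ≤ ∑ k, ‖b k‖ ^ 2 := Finset.sum_nonneg fun k _ => sq_nonneg _
  have hV0 : 0 < V := hK0.trans_lt hV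
  obtain ⟨η, hη, hηb⟩ := exists_rotation b
  set R := ‖∑ k, b k ^ 2‖ with hR
  have hR0 : 0 ≤ R := norm_nonneg _
  have hRK : R ≤ ∑ k, ‖b k‖ ^ 2 := by
    refine (norm_sum_le _ _).trans (le_of_eq ?_)
    simp only [norm_pow]
  set K := ∑ k, ‖b k‖ ^ 2 with hK
  set c : κ → ℂ := fun k => b k * η with hc
  have hsum1 : ∑ k, ((c k).re ^ 2 + (c k).im ^ 2) = K := by
    rw [hK]
    refine Finset.sum_congr rfl fun k _ => ?_
    rw [show ‖b k‖ ^ 2 = ‖c k‖ ^ 2 by rw [hc, norm_mul, hη, mul_one], ← Complex.normSq_eq_norm_sq,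
      Complex.normSq_apply]
    ring
  have hsum2 : ∑ k, ((c k).re ^ 2 - (c k).im ^ 2) = R := by
    have := congrArg Complex.re hηb
    rw [Complex.re_sum, Complex.ofReal_re] at this
    rw [← this]
    refine Finset.sum_congr rfl fun k _ => ?_
    have e : ∀ z : ℂ, z.re ^ 2 - z.im ^ 2 = (z ^ 2).re := fun z => by
      rw [sq z, Complex.mul_re]
      ring
    exact e (c k)
  have hsum3 : ∑ k, (c k).re * (c k).im = 0 := by
    have := congrArg Complex.im hηb
    rw [Complex.im_sum, Complex.ofReal_im] at this
    have h2 : ∑ k, ((b k * η) ^ 2).im = 2 * ∑ k, (c k).re * (c k).im := by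
      rw [Finset.mul_sum]
      refine Finset.sum_congr rfl fun k _ => ?_
      have e : ∀ z : ℂ, (z ^ 2).im = 2 * (z.re * z.im) := fun z => by
        rw [sq z, Complex.mul_im]
        ring
      exact e (c k)
    linarith
  rw [Finset.sum_add_distrib] at hsum1
  rw [Finset.sum_sub_distrib] at hsum2
  -- After the rotation, real and imaginary parts are uncorrelated, with variances `(K + R) / 2` and
  -- `(K - R) / 2`.
  set v : Fin 3 × Bool → ℝ≥0 := fun j => ((K + if j.2 then R else -R) / 2).toNNReal with hv
  have hvc : ∀ j, (v j : ℝ) = (K + if j.2 then R else -R) / 2 := by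
    intro j
    rw [hv, Real.coe_toNNReal]
    split_ifs <;> linarith
  set a : Fin 3 × Bool → Fin 3 × κ → ℝ := fun j i =>
    if i.1 = j.1 then (if j.2 then (c i.2).re else (c i.2).im) else 0 with ha
  have horth : ∀ j j', ∑ i, a j i * a j' i = if j = j' then (v j : ℝ) else 0 := by
    rintro ⟨n, e⟩ ⟨n', e'⟩
    rw [hvc, Fintype.sum_prod_type, Finset.sum_eq_single n]
    · simp only [ha, if_true]
      by_cases hn : n = n'
      · subst hn
        cases e <;> cases e' <;> simp [← sq]
        · linarith
        · simpa [mul_comm] using hsum3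
        · exact hsum3
        · linarith
      · simp [hn]
    · intro m _ hm
      exact Finset.sum_eq_zero fun k _ => by simp [ha, hm]
    · simp
  have hlaw := map_pi_gaussianReal_of_orthogonal a v horth
  have hrew : ∀ ω : Fin 3 × κ → ℝ, ∑ n, ‖∑ k, b k * (ω (n, k) : ℂ)‖ ^ 2 =
      ∑ j : Fin 3 × Bool, (∑ i, a j i * ω i) ^ 2 := by
    intro ω
    rw [Fintype.sum_prod_type]
    refine Finset.sum_congr rfl fun n _ => ?_
    have h1 : ∀ e, ∑ i, a (n, e) i * ω i =
        ∑ k, (if e then (c k).re else (c k).im) * ω (n, k) := by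
      intro e
      rw [Fintype.sum_prod_type, Finset.sum_eq_single n]
      · simp [ha]
      · intro m _ hm
        exact Finset.sum_eq_zero fun k _ => by simp [ha, hm]
      · simp
    rw [Fintype.sum_bool, h1, h1]
    have h2 : ‖∑ k, b k * (ω (n, k) : ℂ)‖ = ‖∑ k, c k * (ω (n, k) : ℂ)‖ := by
      have : ∑ k, c k * (ω (n, k) : ℂ) = (∑ k, b k * (ω (n, k) : ℂ)) * η := by
        rw [Finset.sum_mul]
        exact Finset.sum_congr rfl fun k _ => by rw [hc]; ring
      rw [this, norm_mul, hη, mul_one]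
    rw [h2, ← Complex.normSq_eq_norm_sq, Complex.normSq_apply, Complex.re_sum, Complex.im_sum]
    simp [sq]
  simp only [hrew]
  have hmeas : Measurable fun y : Fin 3 × Bool → ℝ => ENNReal.ofReal (∑ j, y j ^ 2 - t * V) := by
    fun_prop
  have htr : ∫⁻ ω, ENNReal.ofReal (∑ j : Fin 3 × Bool, (∑ i, a j i * ω i) ^ 2 - t * V)
        ∂(Measure.pi fun _ : Fin 3 × κ => gaussianReal 0 1) =
      ∫⁻ z, ENNReal.ofReal (∑ j : Fin 3 × Bool, v j * z j ^ 2 - t * V)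
        ∂(Measure.pi fun _ => gaussianReal 0 1) := by
    have h1 := lintegral_map (μ := Measure.pi fun _ : Fin 3 × κ => gaussianReal 0 1) hmeas
      (g := fun ω j => ∑ i, a j i * ω i) (by fun_prop)
    have h2 := lintegral_map (μ := Measure.pi fun _ : Fin 3 × Bool => gaussianReal 0 1) hmeas
      (g := fun z j => Real.sqrt (v j) * z j) (by fun_prop)
    rw [← h1, hlaw, pi_gaussianReal_eq_map, h2]
    simp only [mul_pow, Real.sq_sqrt (NNReal.coe_nonneg _)]
  rw [htr]
  have hr1 : R / V < 1 := (div_lt_one hV0).2 (hRK.trans_lt hV)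
  have hmain := lintegral_hinge_le (div_nonneg hR0 hV0.le) hr1 ht
  -- Only the isotropic part `K` of the variance is raised to `V`; the pseudo-variance becomes `R /
  -- V`, strictly below 1.
  have hle : ∀ z : Fin 3 × Bool → ℝ, ENNReal.ofReal (∑ j : Fin 3 × Bool, v j * z j ^ 2 - t * V) ≤
      ENNReal.ofReal V * ENNReal.ofReal (1 / 2 * (∑ i, z i ^ 2 + R / V * signedSq z) - t) := by
    intro z
    rw [← ENNReal.ofReal_mul hV0.le]
    refine ENNReal.ofReal_le_ofReal ?_
    have h1 : V * (1 / 2 * (∑ i, z i ^ 2 + R / V * signedSq z) - t) =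
        1 / 2 * (V * ∑ i, z i ^ 2 + R * signedSq z) - t * V := by
      field_simp
    rw [h1]
    have h2 : ∑ j : Fin 3 × Bool, v j * z j ^ 2 = 1 / 2 * (K * ∑ i, z i ^ 2 + R * signedSq z) := by
      simp only [hvc, signedSq, Fintype.sum_prod_type, Fintype.sum_bool, if_true, Finset.mul_sum]
      rw [← Finset.sum_add_distrib, Finset.mul_sum]
      refine Finset.sum_congr rfl fun n _ => ?_
      simp only [Bool.false_eq_true, if_false]
      ring
    rw [h2]
    have h3 : 0 ≤ ∑ i, z i ^ 2 := Finset.sum_nonneg fun i _ => sq_nonneg _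
    nlinarith
  refine (lintegral_mono hle).trans ?_
  rw [lintegral_const_mul' _ _ ENNReal.ofReal_ne_top]
  refine (mul_le_mul_right hmain _).trans (le_of_eq ?_)
  rw [← ENNReal.ofReal_mul hV0.le]
  congr 1
  field_simp

/-! ### Averaging over the unit square -/

/-- Parseval: the squared harmonics have distinct integer frequencies and remain orthonormal on the
period. -/
theorem integral_norm_sq_harmonic {P : ℕ} (a : Fin P → ℝ) :
    ∫ u in (0 : ℝ)..1, ‖∑ k, (a k : ℂ) * harmonicVec P u k ^ 2‖ ^ 2 = ∑ k, a k ^ 2 := by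
  have hexp : ∀ u : ℝ, ((‖∑ k, (a k : ℂ) * harmonicVec P u k ^ 2‖ ^ 2 : ℝ) : ℂ) =
      ∑ k, ∑ l, (a k * a l : ℂ) *
        Complex.exp (((2 * Real.pi * (2 * ((k : ℕ) - (l : ℕ) : ℝ)) : ℝ) * Complex.I) * u) := by
    intro u
    push_cast
    rw [← Complex.mul_conj', map_sum, Finset.sum_mul_sum]
    refine Finset.sum_congr rfl fun k _ => Finset.sum_congr rfl fun l _ => ?_
    have h := harmonicVec_mul_conj u k l
    have h2 : (a k : ℂ) * harmonicVec P u k ^ 2 * conj ((a l : ℂ) * harmonicVec P u l ^ 2) =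
        (a k * a l : ℂ) * (harmonicVec P u k * conj (harmonicVec P u l)) ^ 2 := by
      rw [map_mul, map_pow, Complex.conj_ofReal]
      ring
    rw [h2, h, ← Complex.exp_nat_mul]
    congr 2
    push_cast
    ring
  have hint : ∀ k l : Fin P, ∫ u in (0 : ℝ)..1, (a k * a l : ℂ) *
      Complex.exp (((2 * Real.pi * (2 * ((k : ℕ) - (l : ℕ) : ℝ)) : ℝ) * Complex.I) * u) =
      if k = l then (a k : ℂ) ^ 2 else 0 := by
    intro k l
    rw [intervalIntegral.integral_const_mul]
    by_cases h : k = l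
    · subst h
      simp [sq]
    · have hkl : ((k : ℕ) : ℝ) - (l : ℕ) ≠ 0 := by
        rw [sub_ne_zero]
        exact_mod_cast fun h' => h (Fin.ext h')
      have hne : ((2 * Real.pi * (2 * ((k : ℕ) - (l : ℕ) : ℝ)) : ℝ) : ℂ) * Complex.I ≠ 0 := by
        refine mul_ne_zero ?_ Complex.I_ne_zero
        exact_mod_cast mul_ne_zero (mul_ne_zero two_ne_zero Real.pi_ne_zero)
          (mul_ne_zero two_ne_zero hkl)
      rw [integral_exp_mul_complex hne, if_neg h]
      have h1 : Complex.exp (((2 * Real.pi * (2 * ((k : ℕ) - (l : ℕ) : ℝ)) : ℝ) * Complex.I) *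
          ((1 : ℝ) : ℂ)) = 1 := by
        rw [Complex.exp_eq_one_iff]
        refine ⟨2 * ((k : ℕ) - (l : ℕ)), ?_⟩
        push_cast
        ring
      rw [h1]
      simp
  have : ((∫ u in (0 : ℝ)..1, ‖∑ k, (a k : ℂ) * harmonicVec P u k ^ 2‖ ^ 2 : ℝ) : ℂ) =
      ((∑ k, a k ^ 2 : ℝ) : ℂ) := by
    rw [← intervalIntegral.integral_ofReal]
    simp only [hexp]
    rw [intervalIntegral.integral_finsetSum
      (fun k _ => Continuous.intervalIntegrable (by fun_prop) _ _)]
    rw [Complex.ofReal_sum]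
    refine Finset.sum_congr rfl fun k _ => ?_
    rw [intervalIntegral.integral_finsetSum
      (fun l _ => Continuous.intervalIntegrable (by fun_prop) _ _)]
    simp only [hint]
    simp
  exact_mod_cast this

theorem lintegral_norm_sq_harmonic {P : ℕ} (a : Fin P → ℝ) :
    ∫⁻ u in Set.Ioc (0 : ℝ) 1, ENNReal.ofReal (‖∑ k, (a k : ℂ) * harmonicVec P u k ^ 2‖ ^ 2) =
      ENNReal.ofReal (∑ k, a k ^ 2) := by
  rw [← integral_norm_sq_harmonic, intervalIntegral.integral_of_le zero_le_one,
    ofReal_integral_eq_lintegral_ofReal (Continuous.integrableOn_Ioc (by fun_prop))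
      (.of_forall fun u => sq_nonneg _)]

/-- The weights that a box average puts on the coefficients of a trigonometric polynomial. -/
def boxCoeff {P Q : ℕ} (x : ℝ × ℝ) (k : Fin P × Fin Q) : ℂ :=
  (sincWeight P k.1 * harmonicVec P x.1 k.1) * (sincWeight Q k.2 * harmonicVec Q x.2 k.2)

theorem sum_norm_boxCoeff_sq {P Q : ℕ} (x : ℝ × ℝ) :
    ∑ k, ‖boxCoeff (P := P) (Q := Q) x k‖ ^ 2 =
      (∑ k, sincWeight P k ^ 2) * ∑ k, sincWeight Q k ^ 2 := by
  rw [Finset.sum_mul_sum, Fintype.sum_prod_type]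
  refine Finset.sum_congr rfl fun k _ => Finset.sum_congr rfl fun l _ => ?_
  simp only [boxCoeff, norm_mul, norm_harmonicVec, mul_one, Complex.norm_real, Real.norm_eq_abs,
    mul_pow, sq_abs]

theorem sum_boxCoeff_sq {P Q : ℕ} (x : ℝ × ℝ) :
    ∑ k, boxCoeff (P := P) (Q := Q) x k ^ 2 =
      (∑ k, ((sincWeight P k ^ 2 : ℝ) : ℂ) * harmonicVec P x.1 k ^ 2) *
        ∑ k, ((sincWeight Q k ^ 2 : ℝ) : ℂ) * harmonicVec Q x.2 k ^ 2 := by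
  rw [Finset.sum_mul_sum, Fintype.sum_prod_type]
  refine Finset.sum_congr rfl fun k _ => Finset.sum_congr rfl fun l _ => ?_
  simp only [boxCoeff]
  push_cast
  ring

/-- The uniform distribution on the unit square. -/
abbrev unitSquare : Measure (ℝ × ℝ) :=
  ((volume : Measure ℝ).restrict (Set.Ioc 0 1)).prod ((volume : Measure ℝ).restrict (Set.Ioc 0 1))

/-- The squared pseudo-variance has average of order `P * Q`, whereas its pointwise bound is of
order `(P * Q) ^ 2`. This keeps the correction term bounded relative to `P * Q`. -/
theorem lintegral_norm_sum_boxCoeff_sq {P Q : ℕ} :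
    ∫⁻ x, ENNReal.ofReal (‖∑ k, boxCoeff (P := P) (Q := Q) x k ^ 2‖ ^ 2) ∂unitSquare ≤
      ENNReal.ofReal (1.1815 * P * (1.1815 * Q)) := by
  simp only [sum_boxCoeff_sq, norm_mul, mul_pow]
  simp only [ENNReal.ofReal_mul (sq_nonneg _)]
  rw [lintegral_prod_mul
    (f := fun u => ENNReal.ofReal (‖∑ k, ((sincWeight P k ^ 2 : ℝ) : ℂ) * harmonicVec P u k ^ 2‖ ^ 2))
    (g := fun v => ENNReal.ofReal (‖∑ k, ((sincWeight Q k ^ 2 : ℝ) : ℂ) * harmonicVec Q v k ^ 2‖ ^ 2))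
    (Continuous.measurable (by fun_prop)).ennreal_ofReal.aemeasurable
    (Continuous.measurable (by fun_prop)).ennreal_ofReal.aemeasurable,
    lintegral_norm_sq_harmonic, lintegral_norm_sq_harmonic, ENNReal.ofReal_mul (by positivity)]
  simp only [← pow_mul]
  exact mul_le_mul' (ENNReal.ofReal_le_ofReal (sum_sincWeight_pow_four_le P))
    (ENNReal.ofReal_le_ofReal (sum_sincWeight_pow_four_le Q))

/-- The one-variable bound applied in each variable, the first application treating the partial sums
over the second index as coefficients. -/
theorem gridPoly_excess_le {P Q : ℕ} (hP : 1 ≤ P) (hQ : 1 ≤ Q)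
    (ω : Fin 3 × (Fin P × Fin Q) → ℝ) (x : ℝ × ℝ) (T : ℝ) :
    ENNReal.ofReal (∑ n, ‖gridPoly (fun k => (ω (n, k) : ℂ)) x‖ ^ 2 - T) ≤
      ENNReal.ofReal (4 * (P * Q)) * ∫⁻ y, ENNReal.ofReal
        (∑ n, ‖∑ k, boxCoeff y k * (ω (n, k) : ℂ)‖ ^ 2 - T) ∂unitSquare := by
  have h1 := ofReal_excess_le_lintegral hP
    (fun (n : Fin 3) k => ∑ l : Fin Q, (ω (n, (k, l)) : ℂ) * harmonicVec Q x.2 l) x.1 T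
  have e1 : ∀ n, ∑ k, (∑ l : Fin Q, (ω (n, (k, l)) : ℂ) * harmonicVec Q x.2 l) * harmonicVec P x.1 k =
      gridPoly (fun k => (ω (n, k) : ℂ)) x := by
    intro n
    rw [gridPoly, Fintype.sum_prod_type]
    refine Finset.sum_congr rfl fun k _ => ?_
    rw [Finset.sum_mul]
    exact Finset.sum_congr rfl fun l _ => by ring
  simp only [e1] at h1
  refine h1.trans ?_
  have h2 : ∀ u : ℝ, ENNReal.ofReal (∑ n, ‖∑ k, (sincWeight P k : ℂ) *
      (∑ l : Fin Q, (ω (n, (k, l)) : ℂ) * harmonicVec Q x.2 l) * harmonicVec P u k‖ ^ 2 - T) ≤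
      ENNReal.ofReal (2 * Q) * ∫⁻ v in Set.Ioc (0 : ℝ) 1, ENNReal.ofReal
        (∑ n, ‖∑ k, boxCoeff (u, v) k * (ω (n, k) : ℂ)‖ ^ 2 - T) := by
    intro u
    have h3 := ofReal_excess_le_lintegral hQ (fun (n : Fin 3) l => ∑ k : Fin P,
      (sincWeight P k : ℂ) * (ω (n, (k, l)) : ℂ) * harmonicVec P u k) x.2 T
    have e2 : ∀ n, ∑ l, (∑ k : Fin P, (sincWeight P k : ℂ) * (ω (n, (k, l)) : ℂ) * harmonicVec P u k) *
        harmonicVec Q x.2 l = ∑ k, (sincWeight P k : ℂ) *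
      (∑ l : Fin Q, (ω (n, (k, l)) : ℂ) * harmonicVec Q x.2 l) * harmonicVec P u k := by
      intro n
      simp only [Finset.sum_mul, Finset.mul_sum]
      rw [Finset.sum_comm]
      exact Finset.sum_congr rfl fun k _ => Finset.sum_congr rfl fun l _ => by ring
    have e3 : ∀ (v : ℝ) (n : Fin 3), ∑ l, (sincWeight Q l : ℂ) * (∑ k : Fin P, (sincWeight P k : ℂ) *
        (ω (n, (k, l)) : ℂ) * harmonicVec P u k) * harmonicVec Q v l =
        ∑ k, boxCoeff (u, v) k * (ω (n, k) : ℂ) := by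
      intro v n
      rw [Fintype.sum_prod_type]
      simp only [Finset.sum_mul, Finset.mul_sum, boxCoeff]
      rw [Finset.sum_comm]
      exact Finset.sum_congr rfl fun k _ => Finset.sum_congr rfl fun l _ => by ring
    simp only [e2, e3] at h3
    exact h3
  have hmeas : Measurable fun y : ℝ × ℝ => ENNReal.ofReal
      (∑ n, ‖∑ k, boxCoeff y k * (ω (n, k) : ℂ)‖ ^ 2 - T) := by
    unfold boxCoeff
    exact (Continuous.measurable (by fun_prop)).ennreal_ofReal
  calc _ ≤ ENNReal.ofReal (2 * P) * ∫⁻ u in Set.Ioc (0 : ℝ) 1, (ENNReal.ofReal (2 * Q) *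
        ∫⁻ v in Set.Ioc (0 : ℝ) 1, ENNReal.ofReal
          (∑ n, ‖∑ k, boxCoeff (u, v) k * (ω (n, k) : ℂ)‖ ^ 2 - T)) :=
        mul_le_mul_right (lintegral_mono h2) _
    _ = _ := by
        rw [lintegral_const_mul' _ _ ENNReal.ofReal_ne_top, ← mul_assoc,
          ← ENNReal.ofReal_mul (by positivity), lintegral_prod _ hmeas.aemeasurable]
        congr 2
        ring

/-- The maximum of a random trigonometric polynomial, bounded through local averages. -/
theorem exists_bound_box {P Q : ℕ} (hP : 1 ≤ P) (hQ : 1 ≤ Q) {t V : ℝ} (ht : 5 ≤ t)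
    (hV : V = 1.081 ^ 2 * (P * Q)) :
    ∃ G : (Fin 3 × (Fin P × Fin Q) → ℝ) → ℝ≥0∞, Measurable G ∧
      (∀ ω x, ENNReal.ofReal (∑ n, ‖gridPoly (fun k => (ω (n, k) : ℂ)) x‖ ^ 2) ≤ G ω) ∧
      ∫⁻ ω, G ω ∂(Measure.pi fun _ => gaussianReal 0 1) ≤
        ENNReal.ofReal (t * V + 4 * (P * Q) * (V * gammaHinge t 1 +
          hingeCurv t / 16 / V * (1.1815 * P * (1.1815 * Q)))) := by
  have hPQ : (0 : ℝ) < P * Q := by exact_mod_cast Nat.mul_pos hP hQ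
  have hV0 : 0 < V := by
    rw [hV]
    positivity
  have ht0 : 0 < t := by linarith
  have hA := hingeCurv_nonneg ht0.le
  have hH := gammaHinge_nonneg ht0.le one_pos
  set D : (Fin 3 × (Fin P × Fin Q) → ℝ) → ℝ × ℝ → ℝ≥0∞ := fun ω y => ENNReal.ofReal
        (∑ n, ‖∑ k, boxCoeff y k * (ω (n, k) : ℂ)‖ ^ 2 - t * V) with hD
  have hDm : Measurable (Function.uncurry D) := by
    simp only [hD, Function.uncurry_def, boxCoeff]
    exact (Continuous.measurable (by fun_prop)).ennreal_ofReal
  -- The threshold plus the integrated excess no longer depends on `x`, so it dominates the supremum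
  -- and is measurable by Fubini.
  refine ⟨fun ω => ENNReal.ofReal (t * V) + ENNReal.ofReal (4 * (P * Q)) * ∫⁻ y, D ω y ∂unitSquare,
    ?_, fun ω x => ?_, ?_⟩
  · exact ((Measurable.lintegral_prod_right hDm).const_mul _).const_add _
  · calc _ = ENNReal.ofReal (t * V + (∑ n, ‖gridPoly (fun k => (ω (n, k) : ℂ)) x‖ ^ 2 - t * V)) := by
          congr 1
          ring
      _ ≤ ENNReal.ofReal (t * V) +
          ENNReal.ofReal (∑ n, ‖gridPoly (fun k => (ω (n, k) : ℂ)) x‖ ^ 2 - t * V) :=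
          ENNReal.ofReal_add_le
      _ ≤ _ := by
          exact add_le_add le_rfl (gridPoly_excess_le hP hQ ω x _)
  · rw [lintegral_add_left measurable_const, lintegral_const, measure_univ, mul_one,
      lintegral_const_mul' _ _ ENNReal.ofReal_ne_top,
      lintegral_lintegral_swap hDm.aemeasurable]
    -- `V` uses `1.081` against the proved `1.0809`; this gap gives the strict inequality that keeps
    -- the normalised pseudo-variance below 1.
    have hb : ∀ y : ℝ × ℝ, ∑ k, ‖boxCoeff (P := P) (Q := Q) y k‖ ^ 2 < V := by
      intro y
      rw [sum_norm_boxCoeff_sq, hV]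
      have h1 := sum_sincWeight_sq_le P
      have h2 := sum_sincWeight_sq_le Q
      have h3 : 0 ≤ ∑ k, sincWeight Q k ^ 2 := Finset.sum_nonneg fun k _ => sq_nonneg _
      calc _ ≤ (1.0809 * P) * (1.0809 * Q : ℝ) := by gcongr
        _ < _ := by nlinarith
    calc _ ≤ ENNReal.ofReal (t * V) + ENNReal.ofReal (4 * (P * Q)) * ∫⁻ y,
          (ENNReal.ofReal (V * gammaHinge t 1) + ENNReal.ofReal (hingeCurv t / 16 / V) *
            ENNReal.ofReal (‖∑ k, boxCoeff (P := P) (Q := Q) y k ^ 2‖ ^ 2)) ∂unitSquare := by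
          refine add_le_add_right (mul_le_mul_right (lintegral_mono fun y => ?_) _) _
          refine (lintegral_excess_le (boxCoeff y) (hb y) ht).trans (le_of_eq ?_)
          rw [← ENNReal.ofReal_mul (by positivity), ← ENNReal.ofReal_add (by positivity) (by positivity)]
          congr 1
          ring
      _ ≤ ENNReal.ofReal (t * V) + ENNReal.ofReal (4 * (P * Q)) *
          (ENNReal.ofReal (V * gammaHinge t 1) + ENNReal.ofReal (hingeCurv t / 16 / V) *
            ENNReal.ofReal (1.1815 * P * (1.1815 * Q))) := by
          refine add_le_add_right (mul_le_mul_right ?_ _) _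
          rw [lintegral_add_left measurable_const, lintegral_const_mul' _ _ ENNReal.ofReal_ne_top]
          refine add_le_add ?_ (mul_le_mul_right lintegral_norm_sum_boxCoeff_sq _)
          rw [lintegral_const, ← Set.univ_prod_univ, Measure.prod_prod]
          simp
      _ = _ := by
          rw [← ENNReal.ofReal_mul (by positivity), ← ENNReal.ofReal_add (by positivity) (by positivity),
            ← ENNReal.ofReal_mul (by positivity), ← ENNReal.ofReal_add (by positivity) (by positivity)]

/-! ### Numerical verification for at least 14 grid points -/

/-- The threshold contributes `2 * 1.081² ≈ 2.34` times `K log (3 K)`, leaving room below the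
coefficient 3. With this `t` the factor `exp (-t)` is a constant times `(3 K)⁻²`, which absorbs the
`4 K` from localisation. All remaining terms are worst at `3 K = 42`. -/
theorem box_bound_le {K : ℝ} (hK : 14 ≤ K) {t V : ℝ} (ht : t = 2 * Real.log (3 * K) + 1 / 2)
    (hV : V = 1.081 ^ 2 * K) :
    5 ≤ t ∧ t * V + 4 * K * (V * gammaHinge t 1 + hingeCurv t / 16 / V * (1.1815 ^ 2 * K)) ≤
      3 * K * Real.log (3 * K) := by
  have hK0 : 0 < K := by linarith
  set x := Real.log (3 * K) with hx
  set x₀ := Real.log 42 with hx₀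
  set t₀ := 2 * x₀ + 1 / 2 with ht₀
  have hx₀l : (71 / 19 : ℝ) ≤ x₀ := by
    have := div_le_log_of_pow_le (p := 71) (q := 19) (x := 42) (by norm_num) (by norm_num) (by norm_num)
    simpa using this
  have hx₀u : x₀ ≤ 86 / 23 := by
    have h1 : (23 : ℕ) * x₀ ≤ 86 := by
      rw [hx₀, ← Real.log_pow, Real.log_le_iff_le_exp (by norm_num)]
      calc (42 : ℝ) ^ 23 ≤ (2.7182818283 : ℝ) ^ 86 := by norm_num
        _ ≤ Real.exp 1 ^ 86 := by
            gcongr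
            exact Real.exp_one_gt_d9.le
        _ = Real.exp 86 := by rw [← Real.exp_nat_mul]; norm_num
    push_cast at h1
    linarith
  have hxx : x₀ ≤ x := Real.log_le_log (by norm_num) (by linarith)
  have htt : t₀ ≤ t := by linarith
  have ht5 : 5 ≤ t₀ := by linarith
  have hhalf : Real.exp (-(1 / 2)) ≤ 0.60654 := by
    have h1 : Real.exp (-(1 / 2)) ^ 2 * Real.exp 1 = 1 := by
      rw [← Real.exp_nat_mul, ← Real.exp_add]
      norm_num
    have h2 := Real.exp_one_gt_d9
    have h3 := Real.exp_pos (-(1 / 2))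
    by_contra! h
    nlinarith
  have hfive : 5 ^ 5 * Real.exp (-5) ≤ 21.057 := by
    have h1 : Real.exp (-5) * Real.exp 1 ^ 5 = 1 := by
      rw [← Real.exp_nat_mul, ← Real.exp_add]
      norm_num
    have h2 : (2.7182818283 : ℝ) ^ 5 ≤ Real.exp 1 ^ 5 := by
      gcongr
      exact Real.exp_one_gt_d9.le
    have h3 := Real.exp_pos (-5)
    nlinarith
  have hexp : ∀ y : ℝ, 0 < y →
      Real.exp (-(2 * Real.log y + 1 / 2)) = (y ^ 2)⁻¹ * Real.exp (-(1 / 2)) := by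
    intro y hy
    rw [show -(2 * Real.log y + 1 / 2) = -(Real.log (y ^ 2)) + -(1 / 2) by
      rw [Real.log_pow]; push_cast; ring, Real.exp_add, Real.exp_neg,
      Real.exp_log (by positivity)]
  -- the curvature term
  have hA : hingeCurv t ≤ 2.02 := by
    have h1 := pow_five_mul_exp_neg_anti ht5 htt
    have h2 : t₀ ^ 5 * Real.exp (-t₀) ≤ 11.13 := by
      rw [ht₀, hexp 42 (by norm_num)]
      have h3 : (2 * x₀ + 1 / 2) ^ 5 ≤ (2 * (86 / 23) + 1 / 2) ^ 5 := by
        gcongr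
      calc _ ≤ (2 * (86 / 23) + 1 / 2) ^ 5 * ((42 ^ 2)⁻¹ * 0.60654 : ℝ) := by gcongr
        _ ≤ _ := by norm_num
    rw [hingeCurv, div_le_iff₀ (by linarith)]
    linarith
  -- the tail term
  have hp : (3 + 2 * t + t ^ 2 / 2) / K ≤ 3.64 := by
    set y := x - x₀ with hy
    have hy0 : 0 ≤ y := by linarith
    -- `K` grows exponentially in `y` while the numerator is quadratic; the second-order Taylor
    -- polynomial of `exp` suffices to compare them coefficientwise.
    have hKy : 14 * (1 + y + y ^ 2 / 2) ≤ K := by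
      have h1 : K = 14 * Real.exp y := by
        rw [hy, Real.exp_sub, hx, hx₀, Real.exp_log (by linarith), Real.exp_log (by norm_num)]
        ring
      rw [h1]
      have := Real.quadratic_le_exp_of_nonneg hy0
      linarith
    rw [div_le_iff₀ hK0]
    have h2 : t = t₀ + 2 * y := by
      rw [ht, ht₀, hy]
      ring
    have h3 : t₀ ≤ 7.979 := by linarith
    have h4 : 0 ≤ t₀ := by linarith
    rw [h2]
    nlinarith
  have hH : 4 * K * gammaHinge t 1 ≤ 0.2695734 * 3.64 := by
    have h1 : gammaHinge t 1 = ((3 * K) ^ 2)⁻¹ * Real.exp (-(1 / 2)) * (3 + 2 * t + t ^ 2 / 2) := by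
      rw [gammaHinge, div_one, ht, hexp (3 * K) (by linarith)]
      ring
    have h2 : 4 * K * gammaHinge t 1 =
        4 / 9 * Real.exp (-(1 / 2)) * ((3 + 2 * t + t ^ 2 / 2) / K) := by
      rw [h1]
      field_simp
      ring
    have h5 : 0 ≤ (3 + 2 * t + t ^ 2 / 2) / K := div_nonneg (by nlinarith) hK0.le
    rw [h2]
    calc _ ≤ 4 / 9 * 0.60654 * (3.64 : ℝ) := by gcongr
      _ ≤ _ := by norm_num
  refine ⟨ht5.trans htt, ?_⟩
  have hsplit : t * V + 4 * K * (V * gammaHinge t 1 + hingeCurv t / 16 / V * (1.1815 ^ 2 * K)) =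
      K * (1.081 ^ 2 * (t + 4 * K * gammaHinge t 1) +
        hingeCurv t * (1.1815 ^ 2 / (4 * 1.081 ^ 2))) := by
    rw [hV]
    field_simp
    ring
  rw [hsplit, show 3 * K * x = K * (3 * x) by ring]
  refine mul_le_mul_of_nonneg_left ?_ hK0.le
  have h6 : (1.1815 ^ 2 / (4 * 1.081 ^ 2) : ℝ) ≤ 0.29865 := by norm_num
  have h7 : hingeCurv t * (1.1815 ^ 2 / (4 * 1.081 ^ 2)) ≤ 2.02 * 0.29865 := by
    gcongr
  norm_num at h7 ⊢
  linarith

/-! ### From three polynomials to arbitrarily many -/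

theorem exists_bound_triple {P Q : ℕ} (hP : 1 ≤ P) (hQ : 1 ≤ Q) :
    ∃ G : (Fin 3 × (Fin P × Fin Q) → ℝ) → ℝ≥0∞, Measurable G ∧
      (∀ ω x, ENNReal.ofReal (∑ n, ‖gridPoly (fun k => (ω (n, k) : ℂ)) x‖ ^ 2) ≤ G ω) ∧
      ∫⁻ ω, G ω ∂(Measure.pi fun _ => gaussianReal 0 1) ≤
        ENNReal.ofReal (3 * (P * Q) * Real.log (3 * (P * Q))) := by
  rcases le_or_gt (P * Q) 13 with hK | hK
  · obtain ⟨G, hG, hle, hint⟩ := exists_bound_lags hP hQ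
    exact ⟨G, hG, hle, hint.trans (ENNReal.ofReal_le_ofReal (lag_bound_le hP hQ hK))⟩
  · have hK' : (14 : ℝ) ≤ P * Q := by exact_mod_cast hK
    obtain ⟨ht, hb⟩ := box_bound_le hK' rfl rfl
    obtain ⟨G, hG, hle, hint⟩ := exists_bound_box hP hQ ht rfl
    refine ⟨G, hG, hle, hint.trans (ENNReal.ofReal_le_ofReal (le_trans (le_of_eq ?_) hb))⟩
    ring

theorem sum_cyclic_triples {m : ℕ} (f : Fin (m + 3) → ℝ) :
    ∑ a, ∑ i : Fin 3, f (a + Fin.castLE (by omega) i) = 3 * ∑ a, f a := by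
  rw [Finset.sum_comm]
  have h : ∀ i : Fin 3, ∑ a, f (a + Fin.castLE (by omega) i) = ∑ a, f a := fun i =>
    Equiv.sum_comp (Equiv.addRight (Fin.castLE (by omega) i)) f
  simp [h]

/-- The sum of the squared moduli of at least three independent random trigonometric polynomials,
bounded uniformly by a random variable of controlled mean. -/
theorem exists_bound_grid {ν ι : Type*} [Fintype ν] [Fintype ι] {P Q : ℕ} (hP : 1 ≤ P)
    (hQ : 1 ≤ Q) (hν : 3 ≤ Fintype.card ν) {e : ν × (Fin P × Fin Q) → ι}
    (he : Function.Injective e) :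
    ∃ G : (ι → ℝ) → ℝ≥0∞, Measurable G ∧
      (∀ ω x, ENNReal.ofReal (∑ n, ‖gridPoly (fun k => (ω (e (n, k)) : ℂ)) x‖ ^ 2) ≤ G ω) ∧
      ∫⁻ ω, G ω ∂(Measure.pi fun _ => gaussianReal 0 1) ≤
        ENNReal.ofReal (Fintype.card ν * (P * Q * Real.log (3 * (P * Q)))) := by
  obtain ⟨m, hm⟩ := Nat.exists_eq_add_of_le' hν
  let s : Fin (m + 3) ≃ ν := (Fintype.equivFinOfCardEq hm).symm
  obtain ⟨G, hG, hle, hint⟩ := exists_bound_triple hP hQ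
  let F : Fin (m + 3) → Fin 3 × (Fin P × Fin Q) → ι := fun a p =>
    e (s (a + Fin.castLE (by omega) p.1), p.2)
  have hF : ∀ a, Function.Injective (F a) := by
    rintro a ⟨i, k⟩ ⟨j, l⟩ h
    have h1 := he h
    simp only [Prod.mk.injEq, EmbeddingLike.apply_eq_iff_eq, add_right_inj] at h1
    obtain ⟨h1, rfl⟩ := h1
    rw [Fin.castLE_injective _ h1]
  have hmp := fun a => map_comp_pi_gaussianReal (hF a)
  -- Each index lies in exactly three cyclic triples, so the full sum is a third of the sum over
  -- triples. Having at least three indices makes every triple injective and hence again standard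
  -- Gaussian; dependence between triples is irrelevant for the mean.
  refine ⟨fun ω => ENNReal.ofReal (1 / 3) * ∑ a, G fun p => ω (F a p), ?_, fun ω x => ?_, ?_⟩
  · exact (Finset.measurable_fun_sum _ fun a _ => hG.comp (hmp a).measurable).const_mul _
  · set f : ν → ℝ := fun n => ‖gridPoly (fun k => (ω (e (n, k)) : ℂ)) x‖ ^ 2 with hf
    have h1 : ∑ n, f n = 1 / 3 * ∑ a, ∑ i : Fin 3, f (s (a + Fin.castLE (by omega) i)) := by
      rw [sum_cyclic_triples fun a => f (s a), Equiv.sum_comp s f]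
      ring
    rw [h1, ENNReal.ofReal_mul (by norm_num), ENNReal.ofReal_sum_of_nonneg
      fun a _ => Finset.sum_nonneg fun i _ => sq_nonneg _]
    exact mul_le_mul_right (Finset.sum_le_sum fun a _ => hle (fun p => ω (F a p)) x) _
  · rw [lintegral_const_mul' _ _ ENNReal.ofReal_ne_top,
      lintegral_finsetSum (f := fun a (ω : ι → ℝ) => G fun p => ω (F a p)) _
        fun a _ => hG.comp (hmp a).measurable]
    have h2 : ∀ a, ∫⁻ ω, G (fun p => ω (F a p)) ∂(Measure.pi fun _ => gaussianReal 0 1) ≤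
        ENNReal.ofReal (3 * (P * Q) * Real.log (3 * (P * Q))) := fun a => by
      rw [(hmp a).lintegral_comp hG]
      exact hint
    refine (mul_le_mul_right (Finset.sum_le_sum fun a _ => h2 a) _).trans (le_of_eq ?_)
    rw [Finset.sum_const, Finset.card_univ, Fintype.card_fin, nsmul_eq_mul, hm,
      ← ENNReal.ofReal_natCast, ← ENNReal.ofReal_mul (by positivity),
      ← ENNReal.ofReal_mul (by positivity)]
    congr 1
    ring

/-! ### From the dual atomic norm to trigonometric polynomials -/

theorem errorMatrix_eq_diagonal (N P : ℕ) {Nr : ℕ} (e : Fin Nr → ℂ) :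
    errorMatrix N P e = Matrix.diagonal fun i => e i.1 := by
  rw [errorMatrix, ← Matrix.diagonal_one, Matrix.diagonal_kronecker_diagonal]
  simp

/-- The error matrix is diagonal, so testing it on a canonical vector exposes each entry. -/
theorem norm_le_opNorm_errorMatrix {N P Nr : ℕ} (e : Fin Nr → ℂ) (i : Idx N P Nr) :
    ‖e i.1‖ ≤ opNorm (errorMatrix N P e) := by
  rw [opNorm, errorMatrix_eq_diagonal]
  have h := (Matrix.toEuclideanCLM (n := Idx N P Nr) (𝕜 := ℂ)
    (Matrix.diagonal fun i => e i.1)).le_opNorm (EuclideanSpace.single i 1)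
  rw [PiLp.norm_single, norm_one, mul_one] at h
  refine le_trans (le_of_eq ?_) h
  have h2 : Matrix.toEuclideanCLM (n := Idx N P Nr) (𝕜 := ℂ) (Matrix.diagonal fun i => e i.1)
      (EuclideanSpace.single i 1) = EuclideanSpace.single i (e i.1) := by
    ext j
    rw [Matrix.ofLp_toEuclideanCLM]
    by_cases hj : j = i
    · subst hj
      simp [Matrix.mulVec_diagonal]
    · simp [Matrix.mulVec_diagonal, hj]
  rw [h2, PiLp.norm_single]

theorem sensingOp_weightedAtom {N P Nr : ℕ} {ι : Type*} [Fintype ι] (b : Idx N P Nr → ι → ℂ)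
    (u : ι → ℂ) (v : Idx N P Nr → ℂ) (e : Fin Nr → ℂ) (i : Idx N P Nr) :
    sensingOp b (Matrix.vecMulVec u (star v) * (errorMatrix N P e + 1)) i =
      (∑ j, conj (b i j) * u j) * (conj (v i) * (e i.1 + 1)) := by
  rw [sensingOp, sensingMatrix, Matrix.trace_mul_comm, Matrix.trace_mul_comm,
    Matrix.vecMulVec_mul, Matrix.trace_vecMulVec, errorMatrix_eq_diagonal, ← Matrix.diagonal_one,
    Matrix.diagonal_add, ← Matrix.vecMul_vecMul]
  rw [single_one_dotProduct, Matrix.vecMul_diagonal, Matrix.vecMul_vecMulVec]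
  simp only [Pi.smul_apply, smul_eq_mul, dotProduct, Pi.star_apply, RCLike.star_def]
  ring

theorem sum_mul_le_sqrt {ν : Type*} [Fintype ν] {c f : ν → ℝ} {B : ℝ}
    (hc : ∑ n, c n ^ 2 ≤ B) : ∑ n, c n * f n ≤ Real.sqrt B * Real.sqrt (∑ n, f n ^ 2) :=
  (Real.sum_mul_le_sqrt_mul_sqrt _ _ _).trans
    (mul_le_mul_of_nonneg_right (Real.sqrt_le_sqrt hc) (Real.sqrt_nonneg _))

/-- The factor `d + 1` is split. The part 1 yields the polynomials; the part `d` is bounded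
entrywise by `ε` with Cauchy–Schwarz over `k`. A further Cauchy–Schwarz over `n` removes `c` from
both parts. -/
theorem norm_sum_weighted_le {ν κ : Type*} [Fintype ν] [Fintype κ] {B ε : ℝ} (hε : 0 ≤ ε)
    {c : ν → ℂ} (hc : ∑ n, ‖c n‖ ^ 2 ≤ B) {η : ν → ℂ} (hη : ∀ n, ‖η n‖ = 1) {h : κ → ℂ}
    (hh : ∀ k, ‖h k‖ = 1) {d : ν → κ → ℂ} (hd : ∀ n k, ‖d n k‖ ≤ ε) (q : ν → κ → ℝ) :
    ‖∑ n, ∑ k, conj (q n k : ℂ) * (c n * (conj (η n * h k) * (d n k + 1)))‖ ≤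
      Real.sqrt B * (Real.sqrt (∑ n, ‖∑ k, (q n k : ℂ) * h k‖ ^ 2) +
        ε * Real.sqrt (Fintype.card κ * ∑ n, ∑ k, q n k ^ 2)) := by
  have h1 : ∀ n, ‖∑ k, conj (q n k : ℂ) * (c n * (conj (η n * h k) * (d n k + 1)))‖ ≤
      ‖c n‖ * ‖∑ k, (q n k : ℂ) * h k‖ + ε * (‖c n‖ * ∑ k, |q n k|) := by
    intro n
    have e1 : ∑ k, conj (q n k : ℂ) * (c n * (conj (η n * h k) * (d n k + 1))) =
        c n * conj (η n) * conj (∑ k, (q n k : ℂ) * h k) +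
          c n * conj (η n) * ∑ k, (q n k : ℂ) * conj (h k) * d n k := by
      rw [map_sum, Finset.mul_sum, Finset.mul_sum, ← Finset.sum_add_distrib]
      refine Finset.sum_congr rfl fun k _ => ?_
      simp only [map_mul, Complex.conj_ofReal]
      ring
    rw [e1]
    refine (norm_add_le _ _).trans ?_
    simp only [norm_mul, RCLike.norm_conj, hη, mul_one]
    refine add_le_add le_rfl ?_
    rw [mul_left_comm]
    refine mul_le_mul_of_nonneg_left ?_ (norm_nonneg _)
    rw [Finset.mul_sum]
    refine (norm_sum_le _ _).trans (Finset.sum_le_sum fun k _ => ?_)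
    rw [norm_mul, norm_mul, RCLike.norm_conj, hh, mul_one, Complex.norm_real, Real.norm_eq_abs,
      mul_comm]
    exact mul_le_mul_of_nonneg_right (hd n k) (abs_nonneg _)
  refine (norm_sum_le _ _).trans ((Finset.sum_le_sum fun n _ => h1 n).trans ?_)
  rw [Finset.sum_add_distrib, ← Finset.mul_sum, mul_add, mul_left_comm]
  refine add_le_add (sum_mul_le_sqrt hc) (mul_le_mul_of_nonneg_left ?_ hε)
  refine (sum_mul_le_sqrt hc).trans (mul_le_mul_of_nonneg_left (Real.sqrt_le_sqrt ?_)
    (Real.sqrt_nonneg _))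
  rw [Finset.mul_sum]
  refine Finset.sum_le_sum fun n _ => ?_
  have h2 := sq_sum_le_card_mul_sum_sq (s := Finset.univ) (f := fun k => |q n k|)
  simpa only [sq_abs, Finset.card_univ] using h2

theorem dualAtomicNorm_sensingAdj_le {N P Nr : ℕ} {ν ι : Type*} [Fintype ν] [Fintype ι]
    {K L : ℕ} {a : ν → ι → ℂ} (e : ν × (Fin K × Fin L) ≃ Idx N P Nr)
    (hw : ∀ r, ∃ (x : ℝ × ℝ) (η : ν → ℂ), (∀ n, ‖η n‖ = 1) ∧
      ∀ n k, w N P Nr r (e (n, k)) = η n * (harmonicVec K x.1 k.1 * harmonicVec L x.2 k.2))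
    (ha : ∀ u : ι → ℂ, ∑ j, ‖u j‖ ^ 2 = 1 →
      ∑ n, ‖∑ j, conj (a n j) * u j‖ ^ 2 ≤ Fintype.card ν)
    {b : Idx N P Nr → ι → ℂ} (hb : ∀ n k, b (e (n, k)) = a n) {ε : ℝ} (hε : 0 ≤ ε)
    (ω : Idx N P Nr → ℝ) {G : ℝ≥0∞}
    (hG : ∀ x, ENNReal.ofReal (∑ n, ‖gridPoly (fun k => (ω (e (n, k)) : ℂ)) x‖ ^ 2) ≤ G) :
    dualAtomicNorm ε (sensingAdj b fun i => (ω i : ℂ)) ≤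
      ENNReal.ofReal (Real.sqrt (Fintype.card ν)) * (G ^ (1 / 2 : ℝ) +
        ENNReal.ofReal (ε * Real.sqrt (K * L)) * ENNReal.ofReal (∑ i, ω i ^ 2) ^ (1 / 2 : ℝ)) := by
  rw [dualAtomicNorm]
  refine iSup₂_le fun A hA => ?_
  obtain ⟨u, hu, r, -, g, φ, hop, rfl⟩ := hA
  obtain ⟨x, η, hη, hwr⟩ := hw r
  rw [sensingAdj_adjoint]
  simp only [sensingOp_weightedAtom]
  rw [← Equiv.sum_comp e, Fintype.sum_prod_type]
  simp only [hb, hwr]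
  have h1 := norm_sum_weighted_le hε (ha u hu) hη
    (h := fun k : Fin K × Fin L => harmonicVec K x.1 k.1 * harmonicVec L x.2 k.2)
    (fun k => by rw [norm_mul, norm_harmonicVec, norm_harmonicVec, one_mul])
    (d := fun n k => steeringError g φ (e (n, k)).1)
    (fun n k => (norm_le_opNorm_errorMatrix _ (e (n, k))).trans hop) (fun n k => ω (e (n, k)))
  rw [← ofReal_norm]
  refine (ENNReal.ofReal_le_ofReal h1).trans ?_
  rw [ENNReal.ofReal_mul (Real.sqrt_nonneg _)]
  refine mul_le_mul_right ?_ _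
  rw [ENNReal.ofReal_add (Real.sqrt_nonneg _) (by positivity)]
  refine add_le_add ?_ (le_of_eq ?_)
  · rw [ofReal_sqrt_eq_rpow (by positivity)]
    exact ENNReal.rpow_le_rpow (hG x) (by norm_num)
  · rw [← ofReal_sqrt_eq_rpow (by positivity), ← ENNReal.ofReal_mul (by positivity), mul_assoc ε,
      ← Real.sqrt_mul (by positivity), ← Equiv.sum_comp e, Fintype.sum_prod_type,
      Fintype.card_prod, Fintype.card_fin, Fintype.card_fin, Nat.cast_mul]

theorem lintegral_sum_sq_gaussianReal {ι : Type*} [Fintype ι] :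
    ∫⁻ ω : ι → ℝ, ENNReal.ofReal (∑ i, ω i ^ 2) ∂(Measure.pi fun _ => gaussianReal 0 1) =
      Fintype.card ι := by
  classical
  simp only [ENNReal.ofReal_sum_of_nonneg fun i _ => sq_nonneg _]
  rw [lintegral_finsetSum _ fun i _ => by fun_prop]
  have h : ∀ i : ι, ∫⁻ ω : ι → ℝ, ENNReal.ofReal (ω i ^ 2)
      ∂(Measure.pi fun _ => gaussianReal 0 1) = 1 := fun i => by
    have := lintegral_sq_linear (fun j => if j = i then (1 : ℝ) else 0)
    simpa using this
  simp [h]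

theorem gridPoly_const_mul {P Q : ℕ} (s : ℝ) (c : Fin P × Fin Q → ℂ) (x : ℝ × ℝ) :
    gridPoly (fun k => s * c k) x = s * gridPoly c x := by
  simp only [gridPoly, Finset.mul_sum, mul_assoc]

theorem noiseLaw_eq_map (N P Nr : ℕ) (σ : ℝ≥0) :
    noiseLaw N P Nr σ =
      (Measure.pi fun _ => gaussianReal 0 1).map fun (z : Idx N P Nr → ℝ) j => (σ : ℝ) * z j := by
  rw [noiseLaw, pi_gaussianReal_eq_map fun _ : Idx N P Nr => σ ^ 2]
  simp

/-- The mean of the dual atomic norm for sensing vectors that are constant along the two last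
factors of a grid. -/
theorem lintegral_dualAtomicNorm_le {N P Nr : ℕ} {ν ι : Type*} [Fintype ν] [Fintype ι]
    {K L : ℕ} (hK : 1 ≤ K) (hL : 1 ≤ L) (hν : 3 ≤ Fintype.card ν) {a : ν → ι → ℂ}
    (e : ν × (Fin K × Fin L) ≃ Idx N P Nr)
    (hw : ∀ r, ∃ (x : ℝ × ℝ) (η : ν → ℂ), (∀ n, ‖η n‖ = 1) ∧
      ∀ n k, w N P Nr r (e (n, k)) = η n * (harmonicVec K x.1 k.1 * harmonicVec L x.2 k.2))
    (ha : ∀ u : ι → ℂ, ∑ j, ‖u j‖ ^ 2 = 1 →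
      ∑ n, ‖∑ j, conj (a n j) * u j‖ ^ 2 ≤ Fintype.card ν)
    {b : Idx N P Nr → ι → ℂ} (hb : ∀ n k, b (e (n, k)) = a n) {ε : ℝ} (hε : 0 ≤ ε) (σ : ℝ≥0) :
    ∫⁻ ω, dualAtomicNorm ε (sensingAdj b fun i => (ω i : ℂ)) ∂(noiseLaw N P Nr σ) ≤
      ENNReal.ofReal (σ * (ε * (Fintype.card ν * (K * L)) +
        Fintype.card ν * Real.sqrt (K * L * Real.log (3 * (K * L))))) := by
  obtain ⟨G, hGm, hG, hGint⟩ := exists_bound_grid hK hL hν e.injective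
  set n : ℝ := (Fintype.card ν : ℝ) with hn
  have hn0 : 0 ≤ n := Nat.cast_nonneg _
  have hσ : (0 : ℝ) ≤ σ := σ.2
  have hlog : 0 ≤ Real.log (3 * (K * L : ℝ)) := by
    have : (1 : ℝ) ≤ K * L := by exact_mod_cast Nat.mul_pos hK hL
    exact Real.log_nonneg (by linarith)
  have hcard : (Fintype.card (Idx N P Nr) : ℝ) = n * (K * L) := by
    rw [← Fintype.card_congr e]
    simp [hn]
  rw [noiseLaw_eq_map]
  -- This inequality needs no measurability of the dual atomic norm, an uncountable supremum; from
  -- here on only the measurable majorant `G` is integrated.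
  refine (lintegral_map_le _ _).trans ?_
  have h1 : ∀ z : Idx N P Nr → ℝ,
      dualAtomicNorm ε (sensingAdj b fun i => ((σ * z i : ℝ) : ℂ)) ≤
      ENNReal.ofReal (Real.sqrt n) * ((ENNReal.ofReal (σ ^ 2) * G z) ^ (1 / 2 : ℝ) +
        ENNReal.ofReal (ε * Real.sqrt (K * L)) *
          (ENNReal.ofReal (σ ^ 2) * ENNReal.ofReal (∑ i, z i ^ 2)) ^ (1 / 2 : ℝ)) := by
    intro z
    have h2 := dualAtomicNorm_sensingAdj_le e hw ha hb hε (fun i => σ * z i)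
      (G := ENNReal.ofReal (σ ^ 2) * G z) fun x => by
        simp only [Complex.ofReal_mul, gridPoly_const_mul, norm_mul, mul_pow, ← Finset.mul_sum]
        rw [ENNReal.ofReal_mul (sq_nonneg _), Complex.norm_real, Real.norm_eq_abs, sq_abs]
        exact mul_le_mul_right (hG z x) _
    simp only [mul_pow, ← Finset.mul_sum] at h2
    rw [ENNReal.ofReal_mul (sq_nonneg _)] at h2
    exact h2
  refine (lintegral_mono h1).trans ?_
  have hm : ∀ {f : (Idx N P Nr → ℝ) → ℝ≥0∞}, Measurable f → ∀ {B : ℝ}, 0 ≤ B →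
      ∫⁻ z, f z ∂(Measure.pi fun _ => gaussianReal 0 1) ≤ ENNReal.ofReal B →
      ∫⁻ z, (ENNReal.ofReal ((σ : ℝ) ^ 2) * f z) ^ (1 / 2 : ℝ)
        ∂(Measure.pi fun _ => gaussianReal 0 1) ≤ ENNReal.ofReal (σ * Real.sqrt B) := by
    intro f hf B hB h
    refine (lintegral_rpow_half_le _ (hf.const_mul _).aemeasurable).trans ?_
    rw [lintegral_const_mul' _ _ ENNReal.ofReal_ne_top]
    rw [← Real.sqrt_sq hσ, ← Real.sqrt_mul (sq_nonneg _), ofReal_sqrt_eq_rpow (by positivity),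
      Real.sqrt_sq hσ, ENNReal.ofReal_mul (sq_nonneg _)]
    exact ENNReal.rpow_le_rpow (mul_le_mul_right h _) (by norm_num)
  have hsum : Measurable fun z : Idx N P Nr → ℝ => ENNReal.ofReal (∑ i, z i ^ 2) := by fun_prop
  rw [lintegral_const_mul' _ _ ENNReal.ofReal_ne_top,
    lintegral_add_left ((hGm.const_mul _).pow_const _),
    lintegral_const_mul' _ _ ENNReal.ofReal_ne_top]
  have hGi := hm hGm (by positivity) hGint
  have hSi := hm hsum (B := n * (K * L)) (by positivity) (by
    rw [lintegral_sum_sq_gaussianReal, ← hcard, ENNReal.ofReal_natCast])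
  refine (mul_le_mul_right (add_le_add hGi (mul_le_mul_right hSi _)) _).trans (le_of_eq ?_)
  rw [← ENNReal.ofReal_mul (by positivity), ← ENNReal.ofReal_add (by positivity) (by positivity),
    ← ENNReal.ofReal_mul (by positivity), Real.sqrt_mul hn0, Real.sqrt_mul hn0]
  congr 1
  have hs := Real.mul_self_sqrt hn0
  have hs2 := Real.mul_self_sqrt (show (0 : ℝ) ≤ K * L by positivity)
  linear_combination (σ * Real.sqrt (K * L * Real.log (3 * (K * L))) + σ * ε * (K * L)) * hs +
    Real.sqrt n * Real.sqrt n * σ * ε * hs2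

/-! ### Consequences of isotropy -/

theorem IsIsotropic.sum_conj_mul {κ ι : Type*} [Fintype κ] [Nonempty κ] [DecidableEq ι]
    {A : Matrix κ ι ℂ} (h : IsIsotropic (sensingLaw A)) (i j : ι) :
    ∑ n, conj (A n i) * A n j = if i = j then (Fintype.card κ : ℂ) else 0 := by
  have h1 := (h i j).2
  have hc : (Fintype.card κ : ℂ) ≠ 0 := Nat.cast_ne_zero.2 Fintype.card_ne_zero
  have hi : ∀ n, Integrable (fun x : ι → ℂ => x i * conj (x j)) (Measure.dirac (sensingVec A n)) :=
    fun n => integrable_dirac' (by fun_prop) enorm_lt_top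
  rw [sensingLaw, integral_smul_measure, integral_finsetSum_measure fun n _ => hi n] at h1
  have h2 : ∀ n, ∫ x : ι → ℂ, x i * conj (x j) ∂(Measure.dirac (sensingVec A n)) =
      conj (A n i) * A n j := fun n => by
    rw [integral_dirac' _ _ (by fun_prop)]
    simp [sensingVec]
  simp only [h2, ENNReal.toReal_inv, ENNReal.toReal_natCast, Complex.real_smul,
    Complex.ofReal_inv, Complex.ofReal_natCast] at h1
  rw [inv_mul_eq_iff_eq_mul₀ hc] at h1
  rw [h1]
  split_ifs <;> simp

/-- Isotropy of the uniform law says that the Gram matrix of the columns is the number of rows times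
the identity. -/
theorem IsIsotropic.sum_norm_sq {κ ι : Type*} [Fintype κ] [Nonempty κ] [Fintype ι] [DecidableEq ι]
    {A : Matrix κ ι ℂ} (h : IsIsotropic (sensingLaw A)) (u : ι → ℂ) :
    ∑ n, ‖∑ j, A n j * u j‖ ^ 2 = Fintype.card κ * ∑ j, ‖u j‖ ^ 2 := by
  have h1 : ((∑ n, ‖∑ j, A n j * u j‖ ^ 2 : ℝ) : ℂ) = (Fintype.card κ * ∑ j, ‖u j‖ ^ 2 : ℝ) := by
    push_cast
    simp only [← Complex.conj_mul', map_sum, map_mul, Finset.sum_mul_sum]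
    rw [Finset.sum_comm]
    calc _ = ∑ i, ∑ j, conj (u i) * u j * ∑ n, conj (A n i) * A n j := by
          refine Finset.sum_congr rfl fun i _ => ?_
          rw [Finset.sum_comm]
          refine Finset.sum_congr rfl fun j _ => ?_
          rw [Finset.mul_sum]
          exact Finset.sum_congr rfl fun n _ => by ring
      _ = _ := by
          simp only [h.sum_conj_mul, mul_ite, mul_zero, Finset.sum_ite_eq, Finset.mem_univ, if_true,
            Finset.mul_sum]
          exact Finset.sum_congr rfl fun i _ => by ring
  exact_mod_cast h1

theorem frobNorm_sq {κ ι : Type*} [Fintype κ] [Fintype ι] (A : Matrix κ ι ℂ) :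
    frobNorm A ^ 2 = ∑ i, ∑ j, ‖A i j‖ ^ 2 :=
  Real.sq_sqrt (by positivity)

theorem IsIsotropic.frobNorm_sq {κ ι : Type*} [Fintype κ] [Nonempty κ] [Fintype ι] [DecidableEq ι]
    {A : Matrix κ ι ℂ} (h : IsIsotropic (sensingLaw A)) :
    frobNorm A ^ 2 = Fintype.card κ * Fintype.card ι := by
  have h1 : ∀ j, ∑ n, ‖A n j‖ ^ 2 = Fintype.card κ := fun j => by
    have := h.sum_norm_sq (Pi.single j 1)
    simpa [Pi.single_apply, apply_ite] using this
  rw [JRC.frobNorm_sq, Finset.sum_comm]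
  simp only [h1, Finset.sum_const, Finset.card_univ, nsmul_eq_mul]
  ring

theorem norm_delayVec {N : ℕ} (τ : ℝ) (k : Fin (2 * N + 1)) : ‖delayVec N τ k‖ = 1 := by
  rw [delayVec, show 2 * Real.pi * Complex.I * (τ * ((k : ℕ) - (N : ℕ) : ℝ) : ℂ) =
    ((2 * Real.pi * (τ * ((k : ℕ) - (N : ℕ))) : ℝ) : ℂ) * Complex.I by push_cast; ring]
  exact Complex.norm_exp_ofReal_mul_I _

theorem sum_commBasis {N P J : ℕ} {R : Type*} [AddCommMonoid R]
    (D : Fin P → Matrix (Fin (2 * N + 1)) (Fin J) ℂ) {f : ℂ → Fin J × Fin P → R}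
    (hf : ∀ x, f 0 x = 0) (n : Fin (2 * N + 1)) (p : Fin P) :
    ∑ x, f (commBasis D (n, p) x) x = ∑ j, f (D p n j) (j, p) := by
  rw [Fintype.sum_prod_type]
  refine Finset.sum_congr rfl fun j _ => ?_
  rw [Finset.sum_eq_single p]
  · simp [commBasis, Matrix.blockDiagonal_apply]
  · intro q _ hq
    simp [commBasis, Matrix.blockDiagonal_apply, hq.symm, hf]
  · simp

/-- Isotropy of the whole basis gives equality. Isotropic blocks act on disjoint parts of `u` and
give the bound even without the factor `P`, so one estimate covers both readings of the hypothesis.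
-/
theorem commBasis_sum_norm_sq_le {N P J : ℕ} (hP : 1 ≤ P)
    {D : Fin P → Matrix (Fin (2 * N + 1)) (Fin J) ℂ}
    (hD : IsIsotropic (sensingLaw (commBasis D)) ∨ ∀ p, IsIsotropic (sensingLaw (D p)))
    (u : Fin J × Fin P → ℂ) :
    ∑ n, ‖∑ x, commBasis D n x * u x‖ ^ 2 ≤ (2 * N + 1 : ℕ) * P * ∑ x, ‖u x‖ ^ 2 := by
  have : Nonempty (Fin P) := ⟨⟨0, hP⟩⟩
  rcases hD with hD | hD
  · rw [hD.sum_norm_sq u, Fintype.card_prod, Fintype.card_fin, Fintype.card_fin, Nat.cast_mul]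
  · have h1 : ∀ n p, ∑ x, commBasis D (n, p) x * u x = ∑ j, D p n j * u (j, p) :=
      sum_commBasis D (f := fun c x => c * u x) fun x => zero_mul _
    rw [Fintype.sum_prod_type, Finset.sum_comm]
    simp only [h1, (hD _).sum_norm_sq, Fintype.card_fin]
    rw [← Finset.mul_sum, Fintype.sum_prod_type_right, mul_assoc]
    refine mul_le_mul_of_nonneg_left ?_ (Nat.cast_nonneg _)
    exact le_mul_of_one_le_left (by positivity) (by exact_mod_cast hP)

/-- Isotropic blocks give equality; isotropy of the whole basis gives an additional factor `P`. -/
theorem le_frobNorm_commBasis_sq {N P J : ℕ} (hP : 1 ≤ P)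
    {D : Fin P → Matrix (Fin (2 * N + 1)) (Fin J) ℂ}
    (hD : IsIsotropic (sensingLaw (commBasis D)) ∨ ∀ p, IsIsotropic (sensingLaw (D p))) :
    (2 * N + 1 : ℕ) * P * J ≤ frobNorm (commBasis D) ^ 2 := by
  have : Nonempty (Fin P) := ⟨⟨0, hP⟩⟩
  rcases hD with hD | hD
  · rw [hD.frobNorm_sq]
    simp only [Fintype.card_prod, Fintype.card_fin, Nat.cast_mul]
    refine mul_le_mul_of_nonneg_left ?_ (by positivity)
    exact le_mul_of_one_le_right (by positivity) (by exact_mod_cast hP)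
  · have h1 : ∀ n p, ∑ x, ‖commBasis D (n, p) x‖ ^ 2 = ∑ j, ‖D p n j‖ ^ 2 :=
      sum_commBasis D (f := fun c _ => ‖c‖ ^ 2) fun x => by simp
    rw [JRC.frobNorm_sq, Fintype.sum_prod_type, Finset.sum_comm]
    have h2 : ∀ p, ∑ n, ∑ j, ‖D p n j‖ ^ 2 = (2 * N + 1 : ℕ) * J := fun p => by
      rw [← JRC.frobNorm_sq, (hD p).frobNorm_sq, Fintype.card_fin, Fintype.card_fin]
    simp only [h1, h2, Finset.sum_const, Finset.card_univ, Fintype.card_fin, nsmul_eq_mul]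
    apply le_of_eq
    ring

theorem mul_sqrt_le_frobNorm_mul_sqrt {n F B S : ℝ} (hn : 0 ≤ n) (hF : 0 ≤ F)
    (h : n ^ 2 * B ≤ F ^ 2 * S) : n * Real.sqrt B ≤ F * Real.sqrt S := by
  calc n * Real.sqrt B = Real.sqrt (n ^ 2 * B) := by
        rw [Real.sqrt_mul (sq_nonneg _), Real.sqrt_sq hn]
    _ ≤ Real.sqrt (F ^ 2 * S) := Real.sqrt_le_sqrt h
    _ = F * Real.sqrt S := by rw [Real.sqrt_mul (sq_nonneg _), Real.sqrt_sq hF]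

theorem frobNorm_nonneg {κ ι : Type*} [Fintype κ] [Fintype ι] (A : Matrix κ ι ℂ) :
    0 ≤ frobNorm A :=
  Real.sqrt_nonneg _

/-! ### The two operators -/

theorem lintegral_dualAtomicNorm_radarAdj_le {N P Nr J : ℕ} (hN : 1 ≤ N) (hP : 1 ≤ P)
    (hNr : 1 ≤ Nr) (hJ : 1 ≤ J) {T : Matrix (Fin (2 * N + 1)) (Fin J) ℂ}
    (hT : IsIsotropic (sensingLaw T)) (σ : ℝ≥0) {ε : ℝ} (hε : 0 ≤ ε) :
    ∫⁻ ω, dualAtomicNorm ε (radarAdj P Nr T fun i => (ω i : ℂ)) ∂(noiseLaw N P Nr σ) ≤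
      ENNReal.ofReal (σ * (ε * (((2 * N + 1 : ℕ) : ℝ) * P * Nr) +
        frobNorm T * Real.sqrt (((2 * N + 1 : ℕ) : ℝ) * P * J * Nr *
          Real.log (((2 * N + 1 : ℕ) : ℝ) * P * Nr)))) := by
  let e : Fin (2 * N + 1) × (Fin P × Fin Nr) ≃ Idx N P Nr :=
    { toFun := fun x => (x.2.2, x.2.1, x.1)
      invFun := fun i => (i.2.2, (i.2.1, i.1))
      left_inv := fun _ => rfl
      right_inv := fun _ => rfl }
  have hM : (3 : ℝ) ≤ (2 * N + 1 : ℕ) := by exact_mod_cast (by omega : 3 ≤ 2 * N + 1)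
  have hP' : (1 : ℝ) ≤ P := by exact_mod_cast hP
  have hNr' : (1 : ℝ) ≤ Nr := by exact_mod_cast hNr
  have hJ' : (1 : ℝ) ≤ J := by exact_mod_cast hJ
  have h := lintegral_dualAtomicNorm_le hP hNr (by simpa using hN) (a := fun n => sensingVec T n) e
    (fun r => ⟨(r.2.1, r.2.2), delayVec N r.1, norm_delayVec _, fun n k => by
      simp only [w, e, Equiv.coe_fn_mk]
      ring⟩)
    (fun u hu => by simp [sensingVec, hT.sum_norm_sq u, hu])
    (b := radarVec P Nr T) (fun n k => rfl) hε σ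
  rw [Fintype.card_fin] at h
  refine h.trans (ENNReal.ofReal_le_ofReal (mul_le_mul_of_nonneg_left (add_le_add (le_of_eq ?_)
    (mul_sqrt_le_frobNorm_mul_sqrt (Nat.cast_nonneg _) (frobNorm_nonneg _) ?_)) σ.2))
  · ring
  · rw [hT.frobNorm_sq, Fintype.card_fin, Fintype.card_fin]
    generalize ((2 * N + 1 : ℕ) : ℝ) = M at hM ⊢
    -- This is where `N ≥ 1` enters, through `M ≥ 3`; at `M = 3` and `J = 1` the comparison is an
    -- equality.
    have hlog : Real.log (3 * (P * Nr)) ≤ Real.log (M * P * Nr) := by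
      refine Real.log_le_log (by positivity) ?_
      rw [mul_assoc]
      gcongr
    have hlog0 : 0 ≤ Real.log (3 * (P * Nr : ℝ)) := Real.log_nonneg (by nlinarith)
    calc M ^ 2 * (P * Nr * Real.log (3 * (P * Nr))) ≤
          M ^ 2 * (P * Nr * Real.log (M * P * Nr)) * 1 := by
            rw [mul_one]
            gcongr
      _ ≤ M ^ 2 * (P * Nr * Real.log (M * P * Nr)) * J ^ 2 := by
            have := hlog0.trans hlog
            gcongr
            exact one_le_pow₀ hJ'
      _ = _ := by ring

theorem lintegral_dualAtomicNorm_commAdj_le {N P Nr J : ℕ} (hN : 1 ≤ N) (hP : 1 ≤ P)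
    (hNr : 1 ≤ Nr) (hJ : 1 ≤ J) {D : Fin P → Matrix (Fin (2 * N + 1)) (Fin J) ℂ}
    (hD : IsIsotropic (sensingLaw (commBasis D)) ∨ ∀ p, IsIsotropic (sensingLaw (D p)))
    (σ : ℝ≥0) {ε : ℝ} (hε : 0 ≤ ε) :
    ∫⁻ ω, dualAtomicNorm ε (commAdj Nr D fun i => (ω i : ℂ)) ∂(noiseLaw N P Nr σ) ≤
      ENNReal.ofReal (σ * (ε * (((2 * N + 1 : ℕ) : ℝ) * P * Nr) +
        frobNorm (commBasis D) * Real.sqrt (((2 * N + 1 : ℕ) : ℝ) * (P : ℝ) ^ 2 * J * Nr *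
          Real.log (((2 * N + 1 : ℕ) : ℝ) * P * Nr)))) := by
  -- The vectors `d_v` vary with frequency and pulse, so only the antenna index is free; a trivial
  -- factor `Fin 1` completes the two-dimensional grid.
  let e : (Fin (2 * N + 1) × Fin P) × (Fin 1 × Fin Nr) ≃ Idx N P Nr :=
    { toFun := fun x => (x.2.2, x.1.2, x.1.1)
      invFun := fun i => ((i.2.2, i.2.1), (0, i.1))
      left_inv := fun x => by
        rw [Subsingleton.elim (0 : Fin 1) x.2.1]
      right_inv := fun _ => rfl }
  have hM : (3 : ℝ) ≤ (2 * N + 1 : ℕ) := by exact_mod_cast (by omega : 3 ≤ 2 * N + 1)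
  have hP' : (1 : ℝ) ≤ P := by exact_mod_cast hP
  have hNr' : (1 : ℝ) ≤ Nr := by exact_mod_cast hNr
  have hJ' : (1 : ℝ) ≤ J := by exact_mod_cast hJ
  have hcard : (Fintype.card (Fin (2 * N + 1) × Fin P) : ℝ) = (2 * N + 1 : ℕ) * P := by simp
  have h := lintegral_dualAtomicNorm_le (K := 1) le_rfl hNr
    (by
      have h1 : (3 : ℝ) ≤ Fintype.card (Fin (2 * N + 1) × Fin P) := by
        rw [hcard]
        nlinarith
      exact_mod_cast h1)
    (a := fun n => sensingVec (commBasis D) n) e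
    (fun r => ⟨(0, r.2.2), fun n => harmonicVec P r.2.1 n.2 * delayVec N r.1 n.1,
      fun n => by rw [norm_mul, norm_harmonicVec, norm_delayVec, one_mul], fun n k => by
      simp only [w, e, Equiv.coe_fn_mk]
      rw [show harmonicVec 1 0 k.1 = 1 by simp [harmonicVec]]
      ring⟩)
    (fun u hu => by
      rw [hcard]
      simpa [sensingVec, hu] using commBasis_sum_norm_sq_le hP hD u)
    (b := commVec Nr D) (fun n k => rfl) hε σ
  rw [hcard, Nat.cast_one, one_mul] at h
  refine h.trans (ENNReal.ofReal_le_ofReal (mul_le_mul_of_nonneg_left (add_le_add le_rfl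
    (mul_sqrt_le_frobNorm_mul_sqrt (by positivity) (frobNorm_nonneg _) ?_)) σ.2))
  have hF := le_frobNorm_commBasis_sq hP hD
  generalize ((2 * N + 1 : ℕ) : ℝ) = M at hM hF ⊢
  have hlog : Real.log (3 * Nr) ≤ Real.log (M * P * Nr) := by
    refine Real.log_le_log (by positivity) ?_
    gcongr
    nlinarith
  have hlog0 : 0 ≤ Real.log (3 * Nr : ℝ) := Real.log_nonneg (by nlinarith)
  have hlog1 := hlog0.trans hlog
  calc (M * P) ^ 2 * (Nr * Real.log (3 * Nr)) ≤ (M * P) ^ 2 * (Nr * Real.log (M * P * Nr)) := by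
        gcongr
    _ = (M * P) ^ 2 * (Nr * Real.log (M * P * Nr)) * (1 * 1 ^ 2) := by ring
    _ ≤ (M * P) ^ 2 * (Nr * Real.log (M * P * Nr)) * (P * J ^ 2) := by gcongr
    _ = M * P * J * (M * P ^ 2 * J * Nr * Real.log (M * P * Nr)) := by ring
    _ ≤ _ := by gcongr

end JRC

end

theorem theorem2 (N P Nr J : ℕ) (hN : 1 ≤ N) (hP : 1 ≤ P) (hNr : 1 ≤ Nr) (hJ : 1 ≤ J)
    (T : Matrix (Fin (2 * N + 1)) (Fin J) ℂ)
    (D : Fin P → Matrix (Fin (2 * N + 1)) (Fin J) ℂ)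
    (μ : ℝ)
    (hT : JRC.IsIsotropic (JRC.sensingLaw T))
    (hTμ : JRC.IsIncoherent μ (JRC.sensingLaw T))
    (hD : JRC.IsIsotropic (JRC.sensingLaw (JRC.commBasis D)) ∨
      ∀ p, JRC.IsIsotropic (JRC.sensingLaw (D p)))
    (hDμ : JRC.IsIncoherent μ (JRC.sensingLaw (JRC.commBasis D)))
    (σ : NNReal) (ε : ℝ) (hε : 0 ≤ ε) :
    (∫⁻ ω, JRC.dualAtomicNorm ε (JRC.radarAdj P Nr T fun i => (ω i : ℂ))
        ∂(JRC.noiseLaw N P Nr σ) ≤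
      ENNReal.ofReal (σ * (ε * (((2 * N + 1 : ℕ) : ℝ) * P * Nr) +
        JRC.frobNorm T * Real.sqrt (((2 * N + 1 : ℕ) : ℝ) * P * J * Nr *
          Real.log (((2 * N + 1 : ℕ) : ℝ) * P * Nr))))) ∧
    (∫⁻ ω, JRC.dualAtomicNorm ε (JRC.commAdj Nr D fun i => (ω i : ℂ))
        ∂(JRC.noiseLaw N P Nr σ) ≤
      ENNReal.ofReal (σ * (ε * (((2 * N + 1 : ℕ) : ℝ) * P * Nr) +
        JRC.frobNorm (JRC.commBasis D) * Real.sqrt (((2 * N + 1 : ℕ) : ℝ) * (P : ℝ) ^ 2 * J * Nr *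
          Real.log (((2 * N + 1 : ℕ) : ℝ) * P * Nr))))) := by
  exact ⟨JRC.lintegral_dualAtomicNorm_radarAdj_le hN hP hNr hJ hT σ hε,
    JRC.lintegral_dualAtomicNorm_commAdj_le hN hP hNr hJ hD σ hε⟩
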